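/- Let $n\ge 1$ be an integer, $0<\beta<n$ and $q=n/(n-\beta)$. For $f\in L^1_{loc}(\mathbb{R}^n)$ let $$M_\beta f(x)=\sup_{B(z,r)\ni x}\frac{r^\beta}{|B(z,r)|}\int_{B(z,r)}|f(y)|\,dy$$ be the non-centered fractional maximal function, the supremum being over all open balls $B(z,r)$, $r>0$, that contain $x$. There is a constant $C=C(n,\beta)>0$ such that for every radial function $f\in W^{1,1}(\mathbb{R}^n)$ (that is, $f(x)$ agrees almost everywhere with a function of $|x|$) the function $M_\beta f$ is finite almost everywhere and weakly differentiable on $\mathbb{R}^n$ (that is, $M_\beta f$ is locally integrable and has a locally integrable weak gradient $DM_\beta f$), and $$\|DM_\beta f\|_{L^q(\mathbb{R}^n)}\le C\,\|Df\|_{L^1(\mathbb{R}^n)}.$$ -/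

import Mathlib

open MeasureTheory
open scoped ENNReal ContDiff

/-- `G` is a weak gradient of `u : ℝⁿ → ℝ`: both are locally integrable and
`∫ u ∂ᵥφ = -∫ ⟨G, v⟩ φ` for every direction `v` and every test function `φ ∈ C_c^∞(ℝⁿ)`. -/
structure HasWeakGradient {n : ℕ} (u : EuclideanSpace ℝ (Fin n) → ℝ)
    (G : EuclideanSpace ℝ (Fin n) → EuclideanSpace ℝ (Fin n)) : Prop where
  locallyIntegrable : LocallyIntegrable u volume
  locallyIntegrable_grad : LocallyIntegrable G volume
  integral_eq : ∀ φ : EuclideanSpace ℝ (Fin n) → ℝ, ContDiff ℝ ∞ φ → HasCompactSupport φ →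
    ∀ v : EuclideanSpace ℝ (Fin n),
      ∫ x, u x * fderiv ℝ φ x v = -∫ x, inner ℝ (G x) v * φ x

/-- The non-centered fractional maximal function
`M_β f(x) = sup { r^β |B(z,r)|⁻¹ ∫_{B(z,r)} |f| : r > 0, x ∈ B(z,r) }`, with values in `[0, ∞]`. -/
noncomputable def fracMaximal {n : ℕ} (β : ℝ) (f : EuclideanSpace ℝ (Fin n) → ℝ)
    (x : EuclideanSpace ℝ (Fin n)) : ℝ≥0∞ :=
  ⨆ (z : EuclideanSpace ℝ (Fin n)) (r : ℝ) (_ : 0 < r) (_ : x ∈ Metric.ball z r),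
    ENNReal.ofReal (r ^ β) * ((∫⁻ y in Metric.ball z r, ‖f y‖ₑ ∂volume) / volume (Metric.ball z r))

/-- `f` is (a.e. equal to) a function of `|x|` alone. -/
def IsRadial {n : ℕ} (f : EuclideanSpace ℝ (Fin n) → ℝ) : Prop :=
  ∃ F : ℝ → ℝ, f =ᵐ[volume] fun x => F ‖x‖

/-!
Write `θ = n - β` and `q = n / θ`. Up to the volume of the unit ball, `M_β f(x)` is the supremum of
`r^{-θ} ν(B)` over the balls `B` of radius `r` containing `x`, where `ν = |f| dx`
(`fracMaximal_isLUB`).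

*Pointwise bound.* If `B` is nearly optimal at `x`, the ball of radius `r + |x - x'|` with the same
centre is admissible at `x'`; hence `|∇ M_β f(x)|` is at most a constant times `r^{-θ-1} ν(B)`, with
`B` nearly optimal (`isLUB_ballValues_sub_le`). Put `m = ν(B)`. Since `θ < n`, optimality of `B`
against balls of radius `K r` with a large factor `K` shows that the mean of `|f|` over these is much
smaller than its mean over `B`. So most of `m` comes from the part of `|f|` above a
level `s₀` whose superlevel set is thin at the scale `r`.

*One-dimensional step.* Let `F(|x|) = |f(x)|`, and let `h` be an upper gradient of `F` with
`E = ∫ h(t) t^{n-1} dt < ∞`; one obtains `h` from the spherical means of `|Df|` by testing the weak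
gradient with radial fields (`HasWeakGradient.exists_radialProfile`). A rising sun argument
(`ofReal_sub_le_measure_running_min`) bounds `F(y) - s₀` by the integral of `h` over the points `t`
such that `F(t)` is the minimum of `F` on `[t, y]`. Integrating in `y`, each `h(t)` is multiplied by
the length `ℓ(t)` of the set of such `y` (`RadialProfile.lintegral_excess_le`), and `ℓ(t) ≲ r`,
`|t - |x|| ≲ r`. Hence `ℓ(t) ≲ r² ℓ(t) / (ℓ(t)² + (t - |x|)²)`: up to the factor `r²`, a Poisson
kernel of the half-plane, whose total mass in `|x|` is `π` whatever `ℓ(t)` is. If `r` is not small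
compared to `|x|`, the same works with `t` in place of `ℓ(t)` and a kernel centred at `0`. In either
case (`exists_nearly_optimal_bound`)

  `m |x|^{n-1} ≲ r^{n+1} Φ(|x|)`  and  `m ≲ r E`,

where the potential `Φ` (`radialPotential`) satisfies `∫ Φ ≤ 2π E`.

*Conclusion.* As `(r^{-θ-1} m)^q = (m / r^{n+1}) (m / r)^{q-1}`, the two bounds give
`|∇ M_β f(x)|^q ≲ E^{q-1} Φ(|x|) |x|^{1-n}`, and integration in polar coordinates yields
`‖∇ M_β f‖_q ≲ E`, which is the claim because `E` is a multiple of `‖Df‖₁`. Away from the origin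
`M_β f` is locally Lipschitz (`RadialProfile.exists_local_lipschitz`), so this gradient is a weak
gradient there. For `n = 1` the same holds at the origin, and for `n ≥ 2` the growth
`M_β f(x) ≲ |x|^{1-θ} + 1` lets the integration by parts extend across the origin
(`integral_mul_fderiv_eq_of_tendsto`).
-/

open Set Metric Filter Topology

/-! ### Polar coordinates and balls -/

/-- Integration in polar coordinates for the Lebesgue integral of nonnegative functions. -/
theorem lintegral_polar {n : ℕ} (hn : 0 < n) {g : EuclideanSpace ℝ (Fin n) → ℝ≥0∞}
    (hg : Measurable g) :
    ∫⁻ x, g x = ∫⁻ t in Ioi (0 : ℝ), ENNReal.ofReal (t ^ (n - 1)) *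
      ∫⁻ w : sphere (0 : EuclideanSpace ℝ (Fin n)) 1, g (t • (w : EuclideanSpace ℝ (Fin n)))
        ∂(volume : Measure (EuclideanSpace ℝ (Fin n))).toSphere := by
  have : Nontrivial (EuclideanSpace ℝ (Fin n)) := by
    have : Nonempty (Fin n) := ⟨⟨0, hn⟩⟩
    infer_instance
  have mp :=
    (volume : Measure (EuclideanSpace ℝ (Fin n))).measurePreserving_homeomorphUnitSphereProd
  have h1 : ∫⁻ x, g x = ∫⁻ x : ({0}ᶜ : Set (EuclideanSpace ℝ (Fin n))), g x
      ∂((volume : Measure (EuclideanSpace ℝ (Fin n))).comap (↑)) := by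
    rw [lintegral_subtype_comap (measurableSet_singleton _).compl, restrict_compl_singleton]
  have h2 := mp.lintegral_comp_emb (Homeomorph.measurableEmbedding _)
    (fun p => g ((p.2 : ℝ) • (p.1 : EuclideanSpace ℝ (Fin n))))
  have h3 : ∀ x : ({0}ᶜ : Set (EuclideanSpace ℝ (Fin n))), g x =
      g (((homeomorphUnitSphereProd (EuclideanSpace ℝ (Fin n)) x).2 : ℝ) •
        ((homeomorphUnitSphereProd (EuclideanSpace ℝ (Fin n)) x).1 :
          EuclideanSpace ℝ (Fin n))) := by
    intro x
    congr 1
    have := congrArg Subtype.val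
      ((homeomorphUnitSphereProd (EuclideanSpace ℝ (Fin n))).symm_apply_apply x)
    rw [← this]
    have hx : ‖(x : (EuclideanSpace ℝ (Fin n)))‖ ≠ 0 := norm_ne_zero_iff.2 x.2
    simp [smul_smul, hx]
  have hm : Measurable (fun p : sphere (0 : EuclideanSpace ℝ (Fin n)) 1 × Ioi (0 : ℝ) =>
      g ((p.2 : ℝ) • (p.1 : EuclideanSpace ℝ (Fin n)))) :=
    hg.comp ((measurable_subtype_coe.comp measurable_snd).smul
      (measurable_subtype_coe.comp measurable_fst))
  rw [h1, lintegral_congr h3, h2, lintegral_prod_symm _ hm.aemeasurable,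
    Measure.volumeIoiPow, lintegral_withDensity_eq_lintegral_mul _ (by fun_prop)
      (hm.lintegral_prod_left'),
    ← lintegral_subtype_comap measurableSet_Ioi]
  simp

/-- Lebesgue integral of a radial function. -/
theorem lintegral_radial {n : ℕ} (hn : 0 < n) {φ : ℝ → ℝ≥0∞} (hφ : Measurable φ) :
    ∫⁻ x : EuclideanSpace ℝ (Fin n), φ ‖x‖ =
      (volume : Measure (EuclideanSpace ℝ (Fin n))).toSphere univ *
        ∫⁻ t in Ioi (0 : ℝ), ENNReal.ofReal (t ^ (n - 1)) * φ t := by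
  rw [lintegral_polar hn (g := fun x => φ ‖x‖) (hφ.comp measurable_norm),
    ← lintegral_const_mul _ (by fun_prop)]
  refine setLIntegral_congr_fun measurableSet_Ioi fun t ht => ?_
  simp only [norm_smul, norm_eq_of_mem_sphere, mul_one, Real.norm_eq_abs,
    abs_of_pos (mem_Ioi.1 ht), lintegral_const]
  ring

/-- The points of the unit sphere at distance (in the ambient space) less than `s` from `e`. -/
def sphericalCap {n : ℕ} (e : EuclideanSpace ℝ (Fin n)) (s : ℝ) :
    Set (sphere (0 : EuclideanSpace ℝ (Fin n)) 1) :=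
  {w | ‖(w : EuclideanSpace ℝ (Fin n)) - e‖ < s}

theorem volume_ball_eq {n : ℕ} (z : EuclideanSpace ℝ (Fin n)) {r : ℝ} (hr : 0 < r) :
    volume (ball z r) = ENNReal.ofReal (r ^ n) *
      volume (ball (0 : EuclideanSpace ℝ (Fin n)) 1) := by
  rw [Measure.addHaar_ball_of_pos _ _ hr, finrank_euclideanSpace_fin]

theorem lintegral_ball_polar {n : ℕ} (hn : 0 < n) {φ : ℝ → ℝ≥0∞} (hφ : Measurable φ)
    (z : EuclideanSpace ℝ (Fin n)) (r : ℝ) :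
    ∫⁻ y in ball z r, φ ‖y‖ = ∫⁻ t in Ioi (0 : ℝ), ENNReal.ofReal (t ^ (n - 1)) *
      (φ t * (volume : Measure (EuclideanSpace ℝ (Fin n))).toSphere
        {w | t • (w : EuclideanSpace ℝ (Fin n)) ∈ ball z r}) := by
  rw [← lintegral_indicator measurableSet_ball, lintegral_polar hn
    (g := (ball z r).indicator fun y => φ ‖y‖)
    ((hφ.comp measurable_norm).indicator measurableSet_ball)]
  refine setLIntegral_congr_fun measurableSet_Ioi fun t ht => ?_
  have hm : MeasurableSet {w : sphere (0 : EuclideanSpace ℝ (Fin n)) 1 |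
      t • (w : EuclideanSpace ℝ (Fin n)) ∈ ball z r} :=
    measurableSet_ball.preimage (f := fun w : sphere (0 : EuclideanSpace ℝ (Fin n)) 1 =>
      t • (w : EuclideanSpace ℝ (Fin n))) (by fun_prop)
  congr 1
  rw [← setLIntegral_const, ← lintegral_indicator hm]
  refine lintegral_congr fun w => ?_
  simp only [indicator, mem_ofPred_eq, norm_smul, norm_eq_of_mem_sphere, mul_one,
    Real.norm_eq_abs, abs_of_pos (mem_Ioi.1 ht)]

theorem volume_ball_polar {n : ℕ} (hn : 0 < n) (z : EuclideanSpace ℝ (Fin n)) (r : ℝ) :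
    volume (ball z r) = ∫⁻ t in Ioi (0 : ℝ), ENNReal.ofReal (t ^ (n - 1)) *
      (volume : Measure (EuclideanSpace ℝ (Fin n))).toSphere
        {w | t • (w : EuclideanSpace ℝ (Fin n)) ∈ ball z r} := by
  have := lintegral_ball_polar hn (φ := fun _ => 1) measurable_const z r
  simpa using this

/-- The cone over the cap of radius `s`, between the radii `1` and `1 + s`, lies in `B(e, 2s)`. -/
theorem sphericalCap_le {n : ℕ} (hn : 0 < n) {e : EuclideanSpace ℝ (Fin n)} (he : ‖e‖ = 1)
    {s : ℝ} (hs : 0 < s) (hs2 : s ≤ 1 / 2) :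
    (volume : Measure (EuclideanSpace ℝ (Fin n))).toSphere (sphericalCap e s) ≤
      ENNReal.ofReal (4 ^ n * s ^ (n - 1)) *
        volume (ball (0 : EuclideanSpace ℝ (Fin n)) 1) := by
  set σ := (volume : Measure (EuclideanSpace ℝ (Fin n))).toSphere
  obtain ⟨m, rfl⟩ : ∃ m, n = m + 1 := ⟨n - 1, by omega⟩
  simp only [Nat.add_sub_cancel]
  have key : ENNReal.ofReal (s * (1 / 2) ^ m) * σ (sphericalCap e s) ≤
      volume (ball e (2 * s)) := by
    rw [volume_ball_polar hn]
    calc _ = ∫⁻ t in Ioo 1 (1 + s), ENNReal.ofReal ((1 / 2) ^ m) * σ (sphericalCap e s) := by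
            rw [setLIntegral_const, Real.volume_Ioo, add_sub_cancel_left,
              ENNReal.ofReal_mul hs.le]
            ring
      _ ≤ ∫⁻ t in Ioo 1 (1 + s), ENNReal.ofReal (t ^ (m + 1 - 1)) *
            σ {w | t • (w : EuclideanSpace ℝ (Fin (m + 1))) ∈ ball e (2 * s)} := by
          refine setLIntegral_mono' measurableSet_Ioo fun t ht => ?_
          gcongr
          · simp only [Nat.add_sub_cancel]
            gcongr; linarith [ht.1]
          · intro w hw
            rw [mem_ofPred_eq, mem_ball, dist_eq_norm]
            have h1 : t • (w : EuclideanSpace ℝ (Fin (m + 1))) - e =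
              (t - 1) • (w : EuclideanSpace ℝ (Fin (m + 1))) + (w - e) := by
                rw [sub_smul, one_smul]; abel
            rw [h1]
            refine (norm_add_le _ _).trans_lt ?_
            rw [norm_smul, norm_eq_of_mem_sphere, mul_one, Real.norm_eq_abs,
              abs_of_pos (by linarith [ht.1])]
            have : ‖(w : EuclideanSpace ℝ (Fin (m + 1))) - e‖ < s := hw
            linarith [ht.2]
      _ ≤ _ := lintegral_mono_set fun t ht => mem_Ioi.2 (by linarith [ht.1])
  rw [volume_ball_eq _ (by positivity)] at key
  have h2 : ENNReal.ofReal ((2 * s) ^ (m + 1)) * ENNReal.ofReal ((s * (1 / 2) ^ m)⁻¹) ≤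
      ENNReal.ofReal (4 ^ (m + 1) * s ^ m) := by
    rw [← ENNReal.ofReal_mul (by positivity)]
    refine ENNReal.ofReal_le_ofReal ?_
    have h4 : (4 : ℝ) ^ m = 2 ^ m * 2 ^ m := by rw [← mul_pow]; norm_num
    simp only [pow_succ, mul_pow, one_div, inv_pow, h4]
    field_simp
    norm_num
  grw [← h2]
  rw [ENNReal.ofReal_inv_of_pos (by positivity), mul_right_comm]
  rw [← ENNReal.div_eq_inv_mul.trans (mul_comm _ _), ENNReal.le_div_iff_mul_le
    (Or.inl (by simp; positivity)) (Or.inl ENNReal.ofReal_ne_top), mul_comm]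
  exact key

/-- The ball `B(e, s/2)` lies in the cone over the cap of radius `s`. -/
theorem le_sphericalCap {n : ℕ} (hn : 0 < n) {e : EuclideanSpace ℝ (Fin n)} (he : ‖e‖ = 1)
    {s : ℝ} (hs : 0 < s) (hs2 : s ≤ 1) :
    ENNReal.ofReal (s ^ (n - 1)) * volume (ball (0 : EuclideanSpace ℝ (Fin n)) 1) ≤
      ENNReal.ofReal (4 ^ n) *
      (volume : Measure (EuclideanSpace ℝ (Fin n))).toSphere (sphericalCap e s) := by
  set σ := (volume : Measure (EuclideanSpace ℝ (Fin n))).toSphere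
  obtain ⟨m, rfl⟩ : ∃ m, n = m + 1 := ⟨n - 1, by omega⟩
  simp only [Nat.add_sub_cancel]
  have key : volume (ball e (s / 2)) ≤
      ENNReal.ofReal (s * 2 ^ m) * σ (sphericalCap e s) := by
    rw [volume_ball_polar hn]
    calc _ ≤ ∫⁻ t in Ioi (0 : ℝ), (Ioo (1 - s / 2) (1 + s / 2)).indicator
            (fun _ => ENNReal.ofReal (2 ^ m) * σ (sphericalCap e s)) t := by
          refine setLIntegral_mono' measurableSet_Ioi fun t ht => ?_
          have h0 : ∀ w : sphere (0 : EuclideanSpace ℝ (Fin (m + 1))) 1,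
              t • (w : EuclideanSpace ℝ (Fin (m + 1))) ∈ ball e (s / 2) → |t - 1| < s / 2 := by
            intro w hw
            rw [mem_ball, dist_eq_norm] at hw
            have := abs_norm_sub_norm_le (t • (w : EuclideanSpace ℝ (Fin (m + 1)))) e
            rw [norm_smul, norm_eq_of_mem_sphere, he, Real.norm_eq_abs,
              abs_of_pos (mem_Ioi.1 ht), mul_one] at this
            linarith
          by_cases hts : t ∈ Ioo (1 - s / 2) (1 + s / 2)
          · rw [indicator_of_mem hts]
            refine mul_le_mul' (ENNReal.ofReal_le_ofReal ?_) (measure_mono ?_)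
            · rw [Nat.add_sub_cancel]
              exact pow_le_pow_left₀ (mem_Ioi.1 ht).le (by linarith [hts.2]) _
            · intro w hw
              have h1 := h0 w hw
              rw [mem_ofPred_eq, mem_ball, dist_eq_norm] at hw
              have h2 : (w : EuclideanSpace ℝ (Fin (m + 1))) - e =
                (1 - t) • (w : EuclideanSpace ℝ (Fin (m + 1))) + (t • w - e) := by
                  rw [sub_smul, one_smul]; abel
              show ‖(w : EuclideanSpace ℝ (Fin (m + 1))) - e‖ < s
              rw [h2]
              refine (norm_add_le _ _).trans_lt ?_
              rw [norm_smul, norm_eq_of_mem_sphere, mul_one, Real.norm_eq_abs, abs_sub_comm]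
              linarith
          · rw [indicator_of_notMem hts]
            have : {w : sphere (0 : EuclideanSpace ℝ (Fin (m + 1))) 1 |
              t • (w : EuclideanSpace ℝ (Fin (m + 1))) ∈ ball e (s / 2)} = ∅ := by
              ext w
              simp only [mem_ofPred_eq, mem_empty_iff_false, iff_false]
              intro hw
              have := abs_lt.1 (h0 w hw)
              exact hts ⟨by linarith, by linarith⟩
            rw [this]; simp
      _ ≤ ∫⁻ t, (Ioo (1 - s / 2) (1 + s / 2)).indicator
            (fun _ => ENNReal.ofReal (2 ^ m) * σ (sphericalCap e s)) t :=
          setLIntegral_le_lintegral _ _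
      _ = _ := by
          rw [lintegral_indicator measurableSet_Ioo, setLIntegral_const, Real.volume_Ioo,
            mul_right_comm, ← ENNReal.ofReal_mul (by positivity)]
          congr 2; ring
  rw [volume_ball_eq _ (by positivity)] at key
  have h2 : ENNReal.ofReal (s ^ m) =
      ENNReal.ofReal ((s / 2) ^ (m + 1)) * ENNReal.ofReal (2 ^ (m + 1) / s) := by
    rw [← ENNReal.ofReal_mul (by positivity)]
    congr 1
    simp only [pow_succ, div_pow]
    field_simp
  have h3 : ENNReal.ofReal (4 ^ (m + 1)) =
      ENNReal.ofReal (s * 2 ^ m) * ENNReal.ofReal (2 ^ (m + 1) / s) * 2 := by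
    rw [← ENNReal.ofReal_mul (by positivity), ← ENNReal.ofReal_ofNat,
      ← ENNReal.ofReal_mul (by positivity)]
    congr 1
    have h4 : (4 : ℝ) ^ m = 2 ^ m * 2 ^ m := by rw [← mul_pow]; norm_num
    simp only [pow_succ, h4]
    field_simp
    norm_num
  rw [h2, h3, mul_right_comm]
  calc _ ≤ ENNReal.ofReal (s * 2 ^ m) * σ (sphericalCap e s) *
        ENNReal.ofReal (2 ^ (m + 1) / s) := by
        gcongr
    _ ≤ ENNReal.ofReal (s * 2 ^ m) * σ (sphericalCap e s) * ENNReal.ofReal (2 ^ (m + 1) / s) * 2 :=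
        le_mul_of_one_le_right' (by norm_num)
    _ = _ := by ring

/-- A small ball far from the origin sees a radial function through spherical caps of measure
comparable to `r ^ (n - 1)`: upper bound. -/
theorem lintegral_ball_radial_le {n : ℕ} (hn : 0 < n) {φ : ℝ → ℝ≥0∞} (hφ : Measurable φ)
    {z : EuclideanSpace ℝ (Fin n)} {r : ℝ} (hr : 0 < r) (hrz : 4 * r ≤ ‖z‖) :
    ∫⁻ y in ball z r, φ ‖y‖ ≤
      ENNReal.ofReal (16 ^ n * r ^ (n - 1)) * volume (ball (0 : EuclideanSpace ℝ (Fin n)) 1) *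
      ∫⁻ t in Ioo (‖z‖ - r) (‖z‖ + r), φ t := by
  set σ := (volume : Measure (EuclideanSpace ℝ (Fin n))).toSphere with hσ
  have hz : 0 < ‖z‖ := by linarith
  set e : EuclideanSpace ℝ (Fin n) := ‖z‖⁻¹ • z
  have he : ‖e‖ = 1 := by simp [e, norm_smul, hz.ne']
  have hze : z = ‖z‖ • e := by simp [e, smul_smul, hz.ne']
  have hcap := sphericalCap_le hn he (s := 2 * r / ‖z‖) (by positivity)
    (by rw [div_le_iff₀ hz]; linarith)
  rw [lintegral_ball_polar hn hφ, ← lintegral_const_mul _ hφ,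
    ← lintegral_indicator measurableSet_Ioo]
  refine le_trans ?_ (setLIntegral_le_lintegral (Ioi 0) _)
  refine setLIntegral_mono' measurableSet_Ioi fun t ht => ?_
  have ht0 : 0 < t := ht
  have h0 : ∀ w : sphere (0 : EuclideanSpace ℝ (Fin n)) 1,
      t • (w : EuclideanSpace ℝ (Fin n)) ∈ ball z r → |t - ‖z‖| < r := by
    intro w hw
    rw [mem_ball, dist_eq_norm] at hw
    have := abs_norm_sub_norm_le (t • (w : EuclideanSpace ℝ (Fin n))) z
    rw [norm_smul, norm_eq_of_mem_sphere, Real.norm_eq_abs,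
      abs_of_pos ht0, mul_one] at this
    linarith
  by_cases hts : t ∈ Ioo (‖z‖ - r) (‖z‖ + r)
  · rw [indicator_of_mem hts]
    have h1 : σ {w | t • (w : EuclideanSpace ℝ (Fin n)) ∈ ball z r} ≤
        σ (sphericalCap e (2 * r / ‖z‖)) := by
      refine measure_mono fun w hw => ?_
      have h1 := h0 w hw
      rw [mem_ofPred_eq, mem_ball, dist_eq_norm] at hw
      show ‖(w : EuclideanSpace ℝ (Fin n)) - e‖ < _
      rw [lt_div_iff₀ hz]
      have h2 : ‖z‖ • ((w : EuclideanSpace ℝ (Fin n)) - e) =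
          (‖z‖ - t) • (w : EuclideanSpace ℝ (Fin n)) + (t • w - z) := by
        rw [smul_sub, ← hze, sub_smul]; abel
      have h3 : ‖(w : EuclideanSpace ℝ (Fin n)) - e‖ * ‖z‖ =
          ‖‖z‖ • ((w : EuclideanSpace ℝ (Fin n)) - e)‖ := by
        rw [norm_smul, norm_norm, mul_comm]
      rw [h3, h2]
      refine (norm_add_le _ _).trans_lt ?_
      rw [norm_smul, norm_eq_of_mem_sphere, mul_one, Real.norm_eq_abs, abs_sub_comm]
      linarith
    calc _ ≤ ENNReal.ofReal ((2 * ‖z‖) ^ (n - 1)) * (φ t *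
            (ENNReal.ofReal (4 ^ n * (2 * r / ‖z‖) ^ (n - 1)) *
              volume (ball (0 : EuclideanSpace ℝ (Fin n)) 1))) := by
          gcongr
          · linarith [hts.2]
          · exact h1.trans hcap
      _ = ENNReal.ofReal ((2 * ‖z‖) ^ (n - 1)) *
            ENNReal.ofReal (4 ^ n * (2 * r / ‖z‖) ^ (n - 1)) *
              volume (ball (0 : EuclideanSpace ℝ (Fin n)) 1) * φ t := by ring
      _ ≤ _ := by
          gcongr
          rw [← ENNReal.ofReal_mul (by positivity)]
          refine ENNReal.ofReal_le_ofReal ?_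
          have : (2 * ‖z‖) ^ (n - 1) * (4 ^ n * (2 * r / ‖z‖) ^ (n - 1)) =
              4 ^ n * 4 ^ (n - 1) * r ^ (n - 1) := by
            rw [mul_left_comm, ← mul_pow, mul_assoc (4 ^ n : ℝ), ← mul_pow]
            congr 2; field_simp; norm_num
          rw [this]
          gcongr
          calc (4 : ℝ) ^ n * 4 ^ (n - 1) ≤ 4 ^ n * 4 ^ n := by
                gcongr
                · norm_num
                · omega
            _ = 16 ^ n := by rw [← mul_pow]; norm_num
  · have : {w : sphere (0 : EuclideanSpace ℝ (Fin n)) 1 |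
        t • (w : EuclideanSpace ℝ (Fin n)) ∈ ball z r} = ∅ := by
      ext w
      simp only [mem_ofPred_eq, mem_empty_iff_false, iff_false]
      intro hw
      have := abs_lt.1 (h0 w hw)
      exact hts ⟨by linarith, by linarith⟩
    rw [this]; simp

/-- Lower bound companion of `lintegral_ball_radial_le`. -/
theorem le_lintegral_ball_radial {n : ℕ} (hn : 0 < n) {φ : ℝ → ℝ≥0∞} (hφ : Measurable φ)
    {x : EuclideanSpace ℝ (Fin n)} {R : ℝ} (hR : 0 < R) (hRx : 2 * R ≤ ‖x‖) :
    ENNReal.ofReal (R ^ (n - 1)) * volume (ball (0 : EuclideanSpace ℝ (Fin n)) 1) *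
      ∫⁻ t in Ioo (‖x‖ - R) (‖x‖ + R), φ t ≤
    ENNReal.ofReal (8 ^ n) * ∫⁻ y in ball x (2 * R), φ ‖y‖ := by
  set σ := (volume : Measure (EuclideanSpace ℝ (Fin n))).toSphere with hσ
  have hx : 0 < ‖x‖ := by linarith
  set e : EuclideanSpace ℝ (Fin n) := ‖x‖⁻¹ • x
  have he : ‖e‖ = 1 := by simp [e, norm_smul, hx.ne']
  have hxe : x = ‖x‖ • e := by simp [e, smul_smul, hx.ne']
  have hcap := le_sphericalCap hn he (s := R / ‖x‖) (by positivity)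
    (by rw [div_le_iff₀ hx]; linarith)
  rw [lintegral_ball_polar hn hφ, ← lintegral_const_mul' _ _ ENNReal.ofReal_ne_top,
    ← lintegral_const_mul _ hφ]
  have hsub : Ioo (‖x‖ - R) (‖x‖ + R) ⊆ Ioi 0 := fun t ht => mem_Ioi.2 (by linarith [ht.1])
  refine le_trans ?_ (lintegral_mono_set hsub)
  refine setLIntegral_mono' measurableSet_Ioo fun t ht => ?_
  have ht0 : 0 < t := hsub ht
  have h1 : σ (sphericalCap e (R / ‖x‖)) ≤
      σ {w | t • (w : EuclideanSpace ℝ (Fin n)) ∈ ball x (2 * R)} := by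
    refine measure_mono fun w hw => ?_
    have hw : ‖(w : EuclideanSpace ℝ (Fin n)) - e‖ < R / ‖x‖ := hw
    rw [lt_div_iff₀ hx] at hw
    rw [mem_ofPred_eq, mem_ball, dist_eq_norm]
    have h2 : t • (w : EuclideanSpace ℝ (Fin n)) - x =
        (t - ‖x‖) • (w : EuclideanSpace ℝ (Fin n)) +
          ‖x‖ • ((w : EuclideanSpace ℝ (Fin n)) - e) := by
      rw [smul_sub, ← hxe, sub_smul]; abel
    rw [h2]
    refine (norm_add_le _ _).trans_lt ?_
    rw [norm_smul, norm_smul, norm_eq_of_mem_sphere, mul_one, Real.norm_eq_abs, norm_norm]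
    have := abs_lt.2 (⟨by linarith [ht.1], by linarith [ht.2]⟩ : -R < t - ‖x‖ ∧ t - ‖x‖ < R)
    linarith
  calc _ = ENNReal.ofReal (‖x‖ ^ (n - 1)) * φ t * (ENNReal.ofReal ((R / ‖x‖) ^ (n - 1)) *
        volume (ball (0 : EuclideanSpace ℝ (Fin n)) 1)) := by
        have : R ^ (n - 1) = ‖x‖ ^ (n - 1) * (R / ‖x‖) ^ (n - 1) := by
          rw [← mul_pow]; congr 1; field_simp
        rw [this, ENNReal.ofReal_mul (by positivity)]
        ring
    _ ≤ ENNReal.ofReal ((2 * t) ^ (n - 1)) * φ t * (ENNReal.ofReal (4 ^ n) *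
        σ {w | t • (w : EuclideanSpace ℝ (Fin n)) ∈ ball x (2 * R)}) := by
        refine mul_le_mul' ?_ (hcap.trans (by gcongr))
        gcongr
        linarith [ht.1]
    _ ≤ _ := by
        rw [mul_pow, ENNReal.ofReal_mul (by positivity)]
        have : ENNReal.ofReal (2 ^ (n - 1)) * ENNReal.ofReal (4 ^ n) ≤ ENNReal.ofReal (8 ^ n) := by
          rw [← ENNReal.ofReal_mul (by positivity)]
          gcongr
          calc (2 : ℝ) ^ (n - 1) * 4 ^ n ≤ 2 ^ n * 4 ^ n := by
                gcongr
                · norm_num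
                · omega
            _ = 8 ^ n := by rw [← mul_pow]; norm_num
        calc _ = (ENNReal.ofReal (2 ^ (n - 1)) * ENNReal.ofReal (4 ^ n)) *
              (ENNReal.ofReal (t ^ (n - 1)) * (φ t *
                σ {w | t • (w : EuclideanSpace ℝ (Fin n)) ∈ ball x (2 * R)})) := by ring
          _ ≤ _ := by gcongr

/-! ### Radial profiles and the rising sun inequality -/

/-- If `G` varies by at most `ν (s, t]` on each interval `(s, t]`, then the Lebesgue measure of
`G(A)` is at most `ν(A)`: the outer measure `A ↦ volume (G '' A)` is dominated by the Stieltjes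
outer measure of `ν`, as this can be checked on half-open intervals. -/
theorem volume_image_le_of_edist_le {ν : Measure ℝ} [IsFiniteMeasure ν] {G : ℝ → ℝ}
    (hG : ∀ s t, s ≤ t → edist (G s) (G t) ≤ ν (Ioc s t)) {A : Set ℝ} :
    volume (G '' A) ≤ ν A := by
  have hrc : ∀ x, ContinuousWithinAt (fun t => ν.real (Iic t)) (Ici x) x := by
    intro x
    rw [← continuousWithinAt_Ioi_iff_Ici]
    have h := tendsto_measure_biInter_gt (μ := ν) (s := fun t : ℝ => Iic t) (a := x)
      (fun r _ => measurableSet_Iic.nullMeasurableSet) (fun i j _ hij => Iic_subset_Iic.2 hij)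
      ⟨x + 1, by simp, measure_ne_top _ _⟩
    have h2 : ⋂ r > x, Iic r = Iic x := by
      ext y
      simp only [mem_iInter, mem_Iic]
      exact ⟨fun h => le_of_forall_gt_imp_ge_of_dense h, fun h r hr => h.trans hr.le⟩
    rw [h2] at h
    exact (ENNReal.tendsto_toReal (measure_ne_top _ _)).comp h
  let S : StieltjesFunction ℝ :=
    ⟨fun t => ν.real (Iic t), fun s t hst => measureReal_mono (Iic_subset_Iic.2 hst), hrc⟩
  have hS : ∀ s t, ENNReal.ofReal (S t - S s) = ν (Ioc s t) := by
    intro s t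
    rcases le_total s t with hst | hst
    · have : ν.real (Ioc s t) = ν.real (Iic t) - ν.real (Iic s) := by
        rw [← Iic_sdiff_Iic, measureReal_sdiff (Iic_subset_Iic.2 hst) measurableSet_Iic]
      change ENNReal.ofReal (ν.real (Iic t) - ν.real (Iic s)) = _
      rw [← this, ofReal_measureReal]
    · rw [Ioc_eq_empty (not_lt.2 hst), measure_empty, ENNReal.ofReal_eq_zero]
      exact sub_nonpos.2 (S.mono hst)
  have hSν : S.measure = ν := by
    refine Measure.ext_of_Ioc _ _ fun a b _ => ?_
    rw [S.measure_Ioc, hS]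
  have key : OuterMeasure.comap G (volume : Measure ℝ).toOuterMeasure ≤ S.outer := by
    unfold StieltjesFunction.outer
    rw [OuterMeasure.le_ofFunction]
    intro s
    rw [StieltjesFunction.length_eq]
    refine le_iInf fun a => le_iInf fun b => le_iInf fun hs => ?_
    have hs' : s ⊆ Ioc a b := fun x hx => hs ⟨hx, by simp [botSet]⟩
    rw [hS, OuterMeasure.comap_apply]
    refine (Real.volume_le_diam _).trans ?_
    refine Metric.ediam_le ?_
    rintro _ ⟨x, hx, rfl⟩ _ ⟨y, hy, rfl⟩
    rcases le_total x y with hxy | hxy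
    · exact (hG x y hxy).trans (measure_mono (Ioc_subset_Ioc (hs' hx).1.le (hs' hy).2))
    · rw [edist_comm]
      exact (hG y x hxy).trans (measure_mono (Ioc_subset_Ioc (hs' hy).1.le (hs' hx).2))
  calc volume (G '' A) = OuterMeasure.comap G (volume : Measure ℝ).toOuterMeasure A := rfl
    _ ≤ S.outer A := key A
    _ = S.measure A := by rw [StieltjesFunction.measure]; rfl
    _ = ν A := by rw [hSν]

/-- Rising sun inequality: the increase of a continuous function `G` from the level `s₀` to `G y` is
at most the mass `ν` of the points `t` at which `G t` is the minimum of `G` on `[t, y]`. Indeed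
every level `s ∈ [s₀, G y]` is attained at such a point, namely at the last `t ≤ y` with `G t ≤ s`.
-/
theorem ofReal_sub_le_measure_running_min {ν : Measure ℝ} [IsFiniteMeasure ν] {G : ℝ → ℝ}
    (hG : ∀ s t, s ≤ t → edist (G s) (G t) ≤ ν (Ioc s t)) (hc : Continuous G) {a y s₀ : ℝ}
    (hay : a ≤ y) (ha : G a ≤ s₀) :
    ENNReal.ofReal (G y - s₀) ≤
      ν {t | t ∈ Icc a y ∧ s₀ ≤ G t ∧ ∀ u ∈ Icc t y, G t ≤ G u} := by
  refine le_trans ?_ (volume_image_le_of_edist_le hG)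
  rw [← Real.volume_Icc]
  refine measure_mono fun s hs => ?_
  have hK : IsCompact (Icc a y ∩ {t | G t ≤ s}) :=
    isCompact_Icc.inter_right (isClosed_le hc continuous_const)
  obtain ⟨t, ⟨htK, hts⟩, htmax⟩ := hK.exists_isGreatest ⟨a, ⟨le_rfl, hay⟩, ha.trans hs.1⟩
  have hts : G t ≤ s := hts
  have hst : G t = s := by
    by_contra hne
    have hlt : G t < s := lt_of_le_of_ne hts hne
    obtain ⟨u, hu, hus⟩ := intermediate_value_Icc htK.2 hc.continuousOn ⟨hts, hs.2⟩
    have : u ≤ t := htmax ⟨⟨htK.1.trans hu.1, hu.2⟩, hus.le⟩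
    have : u = t := le_antisymm this hu.1
    rw [this] at hus
    exact hne hus
  refine ⟨t, ⟨htK, hst ▸ hs.1, fun u hu => ?_⟩, hst⟩
  by_contra! hlt
  have : u ≤ t := htmax ⟨⟨htK.1.trans hu.1, hu.2⟩, hlt.le.trans hts⟩
  have : u = t := le_antisymm this hu.1
  rw [this] at hlt
  exact lt_irrefl _ hlt

/-- The radial data of a Sobolev function on `ℝⁿ`: a profile `F ≥ 0` on `(0, ∞)` together with an
upper gradient `h` such that `∫₀^∞ h(t) t^{n-1} dt < ∞`. Only `F` on `(0, ∞)` matters; the value `0`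
elsewhere is a convention that makes `F` measurable. -/
structure RadialProfile (n : ℕ) (F : ℝ → ℝ) (h : ℝ → ℝ≥0∞) : Prop where
  eq_zero : ∀ t ≤ 0, F t = 0
  measurable_grad : Measurable h
  nonneg : ∀ t, 0 ≤ F t
  edist_le : ∀ s t, 0 < s → s ≤ t → edist (F s) (F t) ≤ ∫⁻ u in Ioc s t, h u
  energy : ∫⁻ t in Ioi (0 : ℝ), ENNReal.ofReal (t ^ (n - 1)) * h t ≠ ⊤

/-- The weighted energy `∫₀^∞ h(t) t^{n-1} dt`. -/
noncomputable def radialEnergy (n : ℕ) (h : ℝ → ℝ≥0∞) : ℝ≥0∞ :=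
  ∫⁻ t in Ioi (0 : ℝ), ENNReal.ofReal (t ^ (n - 1)) * h t

/-- Outside a ball the unweighted gradient is integrable. -/
theorem lintegral_Ioi_le_radialEnergy {n : ℕ} {h : ℝ → ℝ≥0∞} {a : ℝ} (ha : 0 < a) :
    ENNReal.ofReal (a ^ (n - 1)) * ∫⁻ t in Ioi a, h t ≤ radialEnergy n h := by
  rw [← lintegral_const_mul' _ _ ENNReal.ofReal_ne_top]
  refine le_trans ?_ (lintegral_mono_set (Ioi_subset_Ioi ha.le))
  refine setLIntegral_mono' measurableSet_Ioi fun t ht => ?_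
  have : a < t := ht
  gcongr

theorem lintegral_Ioi_ne_top_of_radialEnergy {n : ℕ} {h : ℝ → ℝ≥0∞} (hE : radialEnergy n h ≠ ⊤)
    {a : ℝ} (ha : 0 < a) : ∫⁻ t in Ioi a, h t ≠ ⊤ := by
  intro htop
  have := lintegral_Ioi_le_radialEnergy (n := n) (h := h) ha
  rw [htop, ENNReal.mul_top (by simp; positivity)] at this
  exact hE (top_le_iff.1 this)

/-- Pairs `(t, y)` with `t ≤ y` such that `F t` is the minimum of `F` on `[t, y]`, tested on
rational points only, so that the set is visibly measurable. -/
def runningMinSet (F : ℝ → ℝ) : Set (ℝ × ℝ) :=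
  {p | p.1 ≤ p.2 ∧ ∀ q : ℚ, p.1 ≤ q → q ≤ p.2 → F p.1 ≤ F q}

/-- The length of the largest interval with left endpoint `t` on which `F` is at least `F t`. -/
noncomputable def rightLength (F : ℝ → ℝ) (t : ℝ) : ℝ≥0∞ :=
  volume {y | (t, y) ∈ runningMinSet F}

theorem measurableSet_runningMinSet {F : ℝ → ℝ} (hF : Measurable F) :
    MeasurableSet (runningMinSet F) := by
  have : runningMinSet F = {p : ℝ × ℝ | p.1 ≤ p.2} ∩ ⋂ q : ℚ,
      ({p : ℝ × ℝ | p.1 ≤ q}ᶜ ∪ ({p : ℝ × ℝ | (q : ℝ) ≤ p.2}ᶜ ∪ {p : ℝ × ℝ | F p.1 ≤ F q})) := by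
    ext p
    simp only [runningMinSet, mem_ofPred_eq, mem_inter_iff, mem_iInter, mem_union, mem_compl_iff]
    refine and_congr_right fun _ => forall_congr' fun q => ?_
    tauto
  rw [this]
  refine (measurableSet_le measurable_fst measurable_snd).inter (MeasurableSet.iInter fun q => ?_)
  exact (measurableSet_le measurable_fst measurable_const).compl.union
    ((measurableSet_le measurable_const measurable_snd).compl.union
      (measurableSet_le (hF.comp measurable_fst) measurable_const))

theorem measurable_rightLength {F : ℝ → ℝ} (hF : Measurable F) : Measurable (rightLength F) :=
  measurable_measure_prodMk_left (measurableSet_runningMinSet hF)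

namespace RadialProfile

variable {n : ℕ} {F : ℝ → ℝ} {h : ℝ → ℝ≥0∞}

theorem radialEnergy_ne_top (hp : RadialProfile n F h) : radialEnergy n h ≠ ⊤ := hp.energy

theorem lintegral_Ioi_ne_top (hp : RadialProfile n F h) {a : ℝ} (ha : 0 < a) :
    ∫⁻ t in Ioi a, h t ≠ ⊤ :=
  lintegral_Ioi_ne_top_of_radialEnergy hp.energy ha

/-- The profile frozen below `a` varies on the whole line by at most a finite measure, although `h`
need not be integrable at the origin. -/
theorem edist_max_le (hp : RadialProfile n F h) {a : ℝ} (ha : 0 < a) (s t : ℝ) (hst : s ≤ t) :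
    edist (F (max s a)) (F (max t a)) ≤ ((volume.restrict (Ioi a)).withDensity h) (Ioc s t) := by
  refine (hp.edist_le (max s a) (max t a) (lt_max_of_lt_right ha) (max_le_max_right a hst)).trans ?_
  rw [withDensity_apply _ measurableSet_Ioc, Measure.restrict_restrict measurableSet_Ioc]
  refine lintegral_mono_set fun u hu => ?_
  have h1 : max s a < u := hu.1
  refine ⟨⟨(le_max_left _ _).trans_lt h1, ?_⟩, (le_max_right _ _).trans_lt h1⟩
  rcases le_max_iff.1 hu.2 with h2 | h2
  · exact h2
  · exact absurd ((le_max_right s a).trans_lt h1) (not_lt.2 h2)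

theorem isFiniteMeasure (hp : RadialProfile n F h) {a : ℝ} (ha : 0 < a) :
    IsFiniteMeasure ((volume.restrict (Ioi a)).withDensity h) :=
  isFiniteMeasure_withDensity (hp.lintegral_Ioi_ne_top ha)

theorem continuous_max (hp : RadialProfile n F h) {a : ℝ} (ha : 0 < a) :
    Continuous fun t => F (max t a) := by
  have hfin := hp.isFiniteMeasure ha
  set ν := (volume.restrict (Ioi a)).withDensity h with hν
  have hac : ν ≪ volume :=
    (withDensity_absolutelyContinuous _ _).trans Measure.restrict_le_self.absolutelyContinuous
  rw [continuous_iff_continuousAt]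
  intro x
  have h1 : Tendsto (fun δ : ℝ => ν (Icc (x - δ) (x + δ))) (𝓝[>] 0) (𝓝 (ν (⋂ δ > 0,
      Icc (x - δ) (x + δ)))) :=
    tendsto_measure_biInter_gt (μ := ν) (s := fun δ : ℝ => Icc (x - δ) (x + δ)) (a := 0)
      (fun r _ => measurableSet_Icc.nullMeasurableSet)
      (fun i j _ hij => Icc_subset_Icc (by linarith) (by linarith))
      ⟨1, by simp, measure_ne_top _ _⟩
  have h2 : ⋂ δ > (0 : ℝ), Icc (x - δ) (x + δ) = {x} := by
    ext y
    simp only [mem_iInter, mem_Icc, mem_singleton_iff]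
    constructor
    · intro H
      apply le_antisymm
      · exact le_of_forall_pos_le_add fun ε hε => (H ε hε).2
      · exact le_of_forall_pos_le_add fun ε hε => by linarith [(H ε hε).1]
    · rintro rfl δ hδ
      have : (0:ℝ) < δ := hδ
      constructor <;> linarith
  rw [h2, hac (measure_singleton x)] at h1
  refine EMetric.tendsto_nhds.2 fun ε hε => ?_
  obtain ⟨δ, hδε, hδ⟩ := ((h1.eventually (gt_mem_nhds hε)).and self_mem_nhdsWithin).exists
  have hδ : 0 < δ := hδ
  filter_upwards [Ioo_mem_nhds (show x - δ < x by linarith) (show x < x + δ by linarith)] with t ht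
  refine lt_of_le_of_lt ?_ hδε
  rcases le_total t x with htx | htx
  · exact (hp.edist_max_le ha t x htx).trans
      (measure_mono fun u hu => ⟨ht.1.le.trans hu.1.le, by linarith [hu.2]⟩)
  · rw [edist_comm]
    exact (hp.edist_max_le ha x t htx).trans
      (measure_mono fun u hu => ⟨by linarith [hu.1], hu.2.trans ht.2.le⟩)

theorem continuousOn (hp : RadialProfile n F h) : ContinuousOn F (Ioi 0) := by
  intro x hx
  have hx : 0 < x := hx
  refine ContinuousAt.continuousWithinAt ?_
  refine (hp.continuous_max (half_pos hx)).continuousAt.congr ?_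
  filter_upwards [Ioi_mem_nhds (half_lt_self hx)] with t ht
  rw [max_eq_left (le_of_lt ht)]

theorem measurable (hp : RadialProfile n F h) : Measurable F := by
  classical
  have h1 : F = (Ioi (0 : ℝ)).piecewise F fun _ => 0 := by
    funext t
    by_cases ht : 0 < t
    · rw [piecewise_eq_of_mem _ _ _ (show t ∈ Ioi (0 : ℝ) from ht)]
    · rw [piecewise_eq_of_notMem _ _ _ (show t ∉ Ioi (0 : ℝ) from ht), hp.eq_zero t (not_lt.1 ht)]
  rw [h1]
  exact hp.continuousOn.measurable_piecewise continuousOn_const measurableSet_Ioi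

/-- The rising sun inequality for a radial profile. -/
theorem ofReal_sub_le (hp : RadialProfile n F h) {a y s₀ : ℝ} (ha : 0 < a) (hay : a ≤ y)
    (has : F a ≤ s₀) :
    ENNReal.ofReal (F y - s₀) ≤ ∫⁻ t in Ioi a,
      {t | s₀ ≤ F t ∧ (t, y) ∈ runningMinSet F}.indicator h t := by
  have := hp.isFiniteMeasure ha
  have hm : MeasurableSet {t | s₀ ≤ F t ∧ (t, y) ∈ runningMinSet F} :=
    (measurableSet_le measurable_const hp.measurable).inter
      ((measurableSet_runningMinSet hp.measurable).preimage measurable_prodMk_right)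
  rw [lintegral_indicator hm, ← withDensity_apply _ hm]
  have key := ofReal_sub_le_measure_running_min (hp.edist_max_le ha) (hp.continuous_max ha) hay
    (s₀ := s₀) (by simpa using has)
  simp only [max_eq_left hay] at key
  refine key.trans (measure_mono fun t ht => ?_)
  obtain ⟨ht1, ht2, ht3⟩ := ht
  rw [max_eq_left ht1.1] at ht2 ht3
  refine ⟨ht2, ht1.2, fun q hq1 hq2 => ?_⟩
  have := ht3 q ⟨hq1, hq2⟩
  rwa [max_eq_left (ht1.1.trans hq1)] at this

/-- By continuity the rational points in `runningMinSet` can be replaced by real ones. -/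
theorem le_of_mem_runningMinSet (hp : RadialProfile n F h) {t y u : ℝ} (ht : 0 < t)
    (hty : (t, y) ∈ runningMinSet F) (htu : t ≤ u) (huy : u < y) : F t ≤ F u := by
  by_contra! hlt
  have hu : 0 < u := ht.trans_le htu
  have h1 : ∀ᶠ v in 𝓝 u, F v < F t :=
    (hp.continuousOn.continuousAt (Ioi_mem_nhds hu)).eventually (gt_mem_nhds hlt)
  obtain ⟨ε, hε, hball⟩ := Metric.eventually_nhds_iff.1 h1
  obtain ⟨q, hq1, hq2⟩ := exists_rat_btwn (show u < min y (u + ε) from lt_min huy (by linarith))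
  have h2 : F q < F t := by
    refine hball ?_
    rw [Real.dist_eq, abs_of_pos (by linarith)]
    linarith [hq2.trans_le (min_le_right _ _)]
  exact absurd (hty.2 q (htu.trans hq1.le) (hq2.le.trans (min_le_left _ _))) (not_le.2 h2)

/-- If the superlevel set at height `s₀` is thin near `ρ`, the excess of `F` over `s₀` is controlled
by the gradient weighted with `rightLength F`: in the rising sun inequality, integrated over `y`,
the point `t` is charged by the `y` with `(t, y) ∈ runningMinSet F`, whose measure is `rightLength F
t`. Thinness confines these `y` to an interval of length `d / 8`. -/
theorem lintegral_excess_le (hp : RadialProfile n F h) {ρ d s₀ : ℝ} (hd : 0 < d) (hρ : d ≤ ρ)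
    (hs : volume {t | t ∈ Ioo (ρ - d) (ρ + d) ∧ s₀ ≤ F t} ≤ ENNReal.ofReal (d / 8)) :
    ∫⁻ y in Ioo (ρ - d / 4) (ρ + d / 4), ENNReal.ofReal (F y - s₀) ≤
      ∫⁻ t in Ioo (ρ - d) (ρ + d), h t *
        (if rightLength F t ≤ ENNReal.ofReal (d / 8) then rightLength F t else 0) := by
  -- a starting point below the level, to the left of the interval of integration
  obtain ⟨a, ha, has⟩ : ∃ a ∈ Ioo (ρ - d) (ρ - d / 4), F a < s₀ := by
    by_contra! hcon
    have h1 : Ioo (ρ - d) (ρ - d / 4) ⊆ {t | t ∈ Ioo (ρ - d) (ρ + d) ∧ s₀ ≤ F t} :=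
      fun t ht => ⟨⟨ht.1, by linarith [ht.2]⟩, hcon t ht⟩
    have h2 := (measure_mono h1).trans hs
    rw [Real.volume_Ioo, ENNReal.ofReal_le_ofReal_iff (by positivity)] at h2
    linarith
  have ha0 : 0 < a := by linarith [ha.1]
  set Q : Set (ℝ × ℝ) := {p | s₀ ≤ F p.1 ∧ p ∈ runningMinSet F} with hQ
  have hQm : MeasurableSet Q :=
    (measurableSet_le measurable_const (hp.measurable.comp measurable_fst)).inter
      (measurableSet_runningMinSet hp.measurable)
  have hind : Measurable (Q.indicator fun p : ℝ × ℝ => h p.1) :=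
    (hp.measurable_grad.comp measurable_fst).indicator hQm
  calc _ ≤ ∫⁻ y in Ioo (ρ - d / 4) (ρ + d / 4), ∫⁻ t in Ioi a,
          Q.indicator (fun p : ℝ × ℝ => h p.1) (t, y) := by
        refine setLIntegral_mono' measurableSet_Ioo fun y hy => ?_
        exact hp.ofReal_sub_le ha0 (by linarith [ha.2, hy.1]) has.le
    _ = ∫⁻ t in Ioi a, ∫⁻ y in Ioo (ρ - d / 4) (ρ + d / 4),
          Q.indicator (fun p : ℝ × ℝ => h p.1) (t, y) :=
        lintegral_lintegral_swap (hind.comp measurable_swap).aemeasurable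
    _ ≤ ∫⁻ t in Ioi a, (Ioo (ρ - d) (ρ + d)).indicator (fun t => h t *
        (if rightLength F t ≤ ENNReal.ofReal (d / 8) then rightLength F t else 0)) t := by
        refine setLIntegral_mono' measurableSet_Ioi fun t ht => ?_
        have hat : a < t := ht
        by_cases hts : s₀ ≤ F t
        swap
        · have : ∀ y, Q.indicator (fun p : ℝ × ℝ => h p.1) (t, y) = 0 := fun y =>
            indicator_of_notMem (fun hq => hts hq.1) _
          simp [this]
        by_cases htr : ρ + d / 4 ≤ t
        · have : ∀ y ∈ Ioo (ρ - d / 4) (ρ + d / 4),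
              Q.indicator (fun p : ℝ × ℝ => h p.1) (t, y) = 0 := fun y hy =>
            indicator_of_notMem (fun hq => by
              have : t ≤ y := hq.2.1
              linarith [hy.2]) _
          rw [setLIntegral_congr_fun measurableSet_Ioo this]
          simp
        push Not at htr
        rw [indicator_of_mem (show t ∈ Ioo (ρ - d) (ρ + d) from
          ⟨ha.1.trans hat, by linarith⟩)]
        -- on the points charged to `t` the profile is at least `F t ≥ s₀`
        have hℓ : rightLength F t ≤ ENNReal.ofReal (d / 8) := by
          by_contra hcon
          have h1 : ¬ {y | (t, y) ∈ runningMinSet F} ⊆ Icc t (t + d / 8) := fun hsub =>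
            hcon ((measure_mono hsub).trans (by rw [Real.volume_Icc, add_sub_cancel_left]))
          obtain ⟨y, hy, hyn⟩ := not_subset.1 h1
          have hty : t ≤ y := hy.1
          have hy2 : t + d / 8 < y := by
            by_contra! hle
            exact hyn ⟨hty, hle⟩
          have h2 : Ioo t (min y (ρ + d)) ⊆ {t | t ∈ Ioo (ρ - d) (ρ + d) ∧ s₀ ≤ F t} :=
            fun u hu => ⟨⟨by linarith [hu.1, ha.1], hu.2.trans_le (min_le_right _ _)⟩,
              hts.trans (hp.le_of_mem_runningMinSet (ha0.trans hat) hy hu.1.le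
                (hu.2.trans_le (min_le_left _ _)))⟩
          have h3 := (measure_mono h2).trans hs
          rw [Real.volume_Ioo, ENNReal.ofReal_le_ofReal_iff (by positivity)] at h3
          have h4 : t + d / 8 < min y (ρ + d) := lt_min hy2 (by linarith)
          linarith
        rw [if_pos hℓ]
        calc _ ≤ ∫⁻ y, Q.indicator (fun p : ℝ × ℝ => h p.1) (t, y) := setLIntegral_le_lintegral _ _
          _ ≤ ∫⁻ y, {y | (t, y) ∈ runningMinSet F}.indicator (fun _ => h t) y := by
              refine lintegral_mono fun y => ?_
              by_cases hy : (t, y) ∈ Q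
              · rw [indicator_of_mem hy, indicator_of_mem (show y ∈ {y | (t, y) ∈ runningMinSet F}
                  from hy.2)]
              · rw [indicator_of_notMem hy]; exact zero_le
          _ = _ := by
              exact lintegral_indicator_const ((measurableSet_runningMinSet hp.measurable).preimage
                measurable_prodMk_left) _
    _ ≤ ∫⁻ t, (Ioo (ρ - d) (ρ + d)).indicator (fun t => h t *
        (if rightLength F t ≤ ENNReal.ofReal (d / 8) then rightLength F t else 0)) t :=
        setLIntegral_le_lintegral _ _
    _ = _ := lintegral_indicator measurableSet_Ioo _

end RadialProfile

/-! ### The potential and the mass of nearly optimal balls -/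

/-- The Poisson kernel of the half-plane at height `a`, up to the factor `π`. For `a = 0` it is `0`,
also at `s = 0`. -/
noncomputable def halfPlaneKernel (a s : ℝ) : ℝ := a / (a ^ 2 + s ^ 2)

theorem measurable_halfPlaneKernel {α : Type*} [MeasurableSpace α] {f g : α → ℝ} (hf : Measurable f)
    (hg : Measurable g) : Measurable fun x => halfPlaneKernel (f x) (g x) :=
  hf.div ((hf.pow_const 2).add (hg.pow_const 2))

/-- The total mass of the Poisson kernel is bounded independently of its height. -/
theorem lintegral_halfPlaneKernel_le {a : ℝ} (ha : 0 ≤ a) (t : ℝ) :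
    ∫⁻ s, ENNReal.ofReal (halfPlaneKernel a (t - s)) ≤ ENNReal.ofReal Real.pi := by
  rcases ha.eq_or_lt with rfl | ha
  · simp [halfPlaneKernel]
  have h1 : ∀ s, halfPlaneKernel a (t - s) = a⁻¹ * (1 + ((t - s) / a) ^ 2)⁻¹ := by
    intro s; unfold halfPlaneKernel; field_simp
  have hi : Integrable fun s : ℝ => a⁻¹ * (1 + ((t - s) / a) ^ 2)⁻¹ := by
    refine Integrable.const_mul ?_ _
    exact (integrable_inv_one_add_sq.comp_div ha.ne').comp_sub_left t
  simp_rw [h1]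
  rw [← ofReal_integral_eq_lintegral_ofReal hi (ae_of_all _ fun s => by positivity)]
  refine ENNReal.ofReal_le_ofReal (le_of_eq ?_)
  rw [integral_const_mul, integral_sub_left_eq_self (fun s : ℝ => (1 + (s / a) ^ 2)⁻¹) volume t,
    Measure.integral_comp_div (fun s : ℝ => (1 + s ^ 2)⁻¹) a, integral_univ_inv_one_add_sq,
    abs_of_pos ha, smul_eq_mul]
  field_simp

/-- The potential that dominates the gradient of the maximal function, as a function of `|x|`. Each
point `t` of the profile spreads its energy by two Poisson kernels of total mass at most `π`: one of
height `rightLength F t` around `t`, and one of height `t` around the origin. -/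
noncomputable def radialPotential (n : ℕ) (F : ℝ → ℝ) (h : ℝ → ℝ≥0∞) (ρ : ℝ) : ℝ≥0∞ :=
  ∫⁻ t in Ioi (0 : ℝ), ENNReal.ofReal (t ^ (n - 1)) * h t *
    (ENNReal.ofReal (halfPlaneKernel (rightLength F t).toReal (t - ρ)) +
      ENNReal.ofReal (halfPlaneKernel t ρ))

namespace RadialProfile

variable {n : ℕ} {F : ℝ → ℝ} {h : ℝ → ℝ≥0∞}

theorem measurable_potential_integrand (hp : RadialProfile n F h) :
    Measurable fun p : ℝ × ℝ => ENNReal.ofReal (p.2 ^ (n - 1)) * h p.2 *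
    (ENNReal.ofReal (halfPlaneKernel (rightLength F p.2).toReal (p.2 - p.1)) +
      ENNReal.ofReal (halfPlaneKernel p.2 p.1)) := by
  have h1 : Measurable fun p : ℝ × ℝ => h p.2 := hp.measurable_grad.comp measurable_snd
  have h2 : Measurable fun p : ℝ × ℝ => (rightLength F p.2).toReal :=
    ((measurable_rightLength hp.measurable).comp measurable_snd).ennreal_toReal
  have h3 := measurable_halfPlaneKernel h2 (measurable_snd.sub measurable_fst (α := ℝ × ℝ))
  have h4 := measurable_halfPlaneKernel (measurable_snd (α := ℝ) (β := ℝ)) measurable_fst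
  exact ((measurable_snd.pow_const (n - 1)).ennreal_ofReal.mul h1).mul
    (h3.ennreal_ofReal.add h4.ennreal_ofReal)

theorem measurable_radialPotential (hp : RadialProfile n F h) :
    Measurable (radialPotential n F h) :=
  hp.measurable_potential_integrand.lintegral_prod_right'

theorem lintegral_radialPotential_le (hp : RadialProfile n F h) :
    ∫⁻ ρ, radialPotential n F h ρ ≤ ENNReal.ofReal (2 * Real.pi) * radialEnergy n h := by
  unfold radialPotential radialEnergy
  rw [lintegral_lintegral_swap hp.measurable_potential_integrand.aemeasurable,
    ← lintegral_const_mul' _ _ ENNReal.ofReal_ne_top]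
  refine setLIntegral_mono' measurableSet_Ioi fun t ht => ?_
  have ht : 0 < t := ht
  have hm1 : Measurable fun ρ : ℝ =>
      ENNReal.ofReal (halfPlaneKernel (rightLength F t).toReal (t - ρ)) :=
    (measurable_halfPlaneKernel measurable_const
      (measurable_const.sub measurable_id)).ennreal_ofReal
  have hm2 : Measurable fun ρ : ℝ => ENNReal.ofReal (halfPlaneKernel t ρ) :=
    (measurable_halfPlaneKernel measurable_const measurable_id).ennreal_ofReal
  have e := lintegral_const_mul (μ := volume) (ENNReal.ofReal (t ^ (n - 1)) * h t) (hm1.add hm2)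
  simp only [Pi.add_apply] at e
  rw [e, lintegral_add_left hm1, mul_comm]
  gcongr
  have h1 := lintegral_halfPlaneKernel_le (a := (rightLength F t).toReal) ENNReal.toReal_nonneg t
  have h2 := lintegral_halfPlaneKernel_le ht.le 0
  have h3 : ∀ s, halfPlaneKernel t (0 - s) = halfPlaneKernel t s := by
    intro s; simp [halfPlaneKernel]
  simp only [h3] at h2
  calc _ ≤ ENNReal.ofReal Real.pi + ENNReal.ofReal Real.pi := add_le_add h1 h2
    _ = _ := by rw [← ENNReal.ofReal_add Real.pi_pos.le Real.pi_pos.le, two_mul]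

end RadialProfile

theorem ENNReal.ofReal_half_le_of_le_add {m : ℝ} {X : ℝ≥0∞} (hm : 0 ≤ m)
    (h : ENNReal.ofReal m ≤ X + ENNReal.ofReal (m / 2)) : ENNReal.ofReal (m / 2) ≤ X := by
  have : ENNReal.ofReal m = ENNReal.ofReal (m / 2) + ENNReal.ofReal (m / 2) := by
    rw [← ENNReal.ofReal_add (by positivity) (by positivity)]; ring_nf
  rw [this] at h
  exact (ENNReal.add_le_add_iff_right ENNReal.ofReal_ne_top).1 h

theorem exists_pos_volume_unitBall (n : ℕ) : ∃ κ : ℝ, 0 < κ ∧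
    volume (ball (0 : EuclideanSpace ℝ (Fin n)) 1) = ENNReal.ofReal κ :=
  ⟨(volume (ball (0 : EuclideanSpace ℝ (Fin n)) 1)).toReal,
    ENNReal.toReal_pos (measure_ball_pos _ _ one_pos).ne' measure_ball_lt_top.ne,
    (ENNReal.ofReal_toReal measure_ball_lt_top.ne).symm⟩

theorem lintegral_le_excess_add {α : Type*} [MeasurableSpace α] {μ : Measure α} (f : α → ℝ)
    (s : ℝ) : ∫⁻ y, ENNReal.ofReal (f y) ∂μ ≤
      ∫⁻ y, ENNReal.ofReal (f y - s) ∂μ + ENNReal.ofReal s * μ univ := by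
  rw [← lintegral_const, ← lintegral_add_right _ measurable_const]
  refine lintegral_mono fun y => ?_
  calc ENNReal.ofReal (f y) = ENNReal.ofReal (f y - s + s) := by rw [sub_add_cancel]
    _ ≤ _ := ENNReal.ofReal_add_le

/-- Estimate at a point `x` for a ball `B(z, r) ∋ x` of mass `m` that is nearly optimal (`hopt`) and
whose radius is small compared to `|x|`. Compared with `B(x, 2Kr)`, near optimality bounds the
integral of `F` over `(|x| - Kr, |x| + Kr)`. As `θ < n`, for large `K` this makes the superlevel set
at a height `s₀` comparable to `m / rⁿ` so thin that `RadialProfile.lintegral_excess_le` applies at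
the scale `Kr`, while at least half of `m` comes from the excess of `F` over `s₀`. -/
theorem RadialProfile.near_bound {n : ℕ} (hn : 0 < n) {κ : ℝ} (hκ : 0 < κ)
    (hκv : volume (ball (0 : EuclideanSpace ℝ (Fin n)) 1) = ENNReal.ofReal κ)
    {K θ : ℝ} (hK : 8 ≤ K) (hKθ : 128 * 128 ^ n * (2 * K) ^ θ ≤ K ^ n)
    {F : ℝ → ℝ} {h : ℝ → ℝ≥0∞} (hp : RadialProfile n F h)
    {x z : EuclideanSpace ℝ (Fin n)} {r m : ℝ} (hr : 0 < r) (hxz : x ∈ ball z r) (hm : 0 < m)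
    (hmB : ∫⁻ y in ball z r, ENNReal.ofReal (F ‖y‖) = ENNReal.ofReal m)
    (hopt : ∀ w R, 0 < R → x ∈ ball w R →
      ∫⁻ y in ball w R, ENNReal.ofReal (F ‖y‖) ≤ ENNReal.ofReal (2 * (R / r) ^ θ * m))
    (hnear : 2 * K * r ≤ ‖x‖) :
    ENNReal.ofReal (m * ‖x‖ ^ (n - 1)) ≤
        ENNReal.ofReal (2 * 32 ^ n * κ * K ^ 2 * r ^ (n + 1)) * radialPotential n F h ‖x‖ ∧
      ENNReal.ofReal m ≤ ENNReal.ofReal (16 ^ n * κ * K * r) * radialEnergy n h := by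
  obtain ⟨k, rfl⟩ : ∃ k, n = k + 1 := ⟨n - 1, by omega⟩
  set ρ := ‖x‖ with hρdef
  set d := K * r with hd
  have hd0 : 0 < d := by positivity
  have hρ0 : 0 < ρ := by nlinarith
  have h8 : 8 * r ≤ d := by rw [hd]; gcongr
  have hxz' : |ρ - ‖z‖| < r := by
    have := abs_norm_sub_norm_le x z
    rw [mem_ball, dist_eq_norm] at hxz
    linarith
  rw [abs_lt] at hxz'
  have hFm : Measurable fun t => ENNReal.ofReal (F t) := hp.measurable.ennreal_ofReal
  -- lower bound for the mass near the sphere `|y| = ρ`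
  have f2 := le_lintegral_ball_radial hn hFm (x := x) hd0 (by linarith)
  rw [hκv] at f2
  have f2' := f2.trans (mul_le_mul_right (hopt x (2 * d) (by positivity)
    (mem_ball_self (by positivity))) _)
  set c := 16 ^ (k + 1) * r ^ k * κ with hc
  have hc0 : 0 < c := by positivity
  -- the level for which `c * s₀ * (4 * r) = m / 2`
  set s₀ := m / (8 * r * c) with hs₀
  have hs₀0 : 0 < s₀ := by positivity
  have hlevel : volume {t | t ∈ Ioo (ρ - d) (ρ + d) ∧ s₀ ≤ F t} ≤ ENNReal.ofReal (d / 8) := by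
    have h1 : ENNReal.ofReal s₀ * volume {t | t ∈ Ioo (ρ - d) (ρ + d) ∧ s₀ ≤ F t} ≤
        ∫⁻ t in Ioo (ρ - d) (ρ + d), ENNReal.ofReal (F t) := by
      have := mul_meas_ge_le_lintegral (μ := volume.restrict (Ioo (ρ - d) (ρ + d))) hFm
        (ENNReal.ofReal s₀)
      rw [Measure.restrict_apply (measurableSet_le measurable_const hFm)] at this
      refine le_trans (mul_le_mul_right (measure_mono fun t ht => ?_) _) this
      exact ⟨ENNReal.ofReal_le_ofReal ht.2, ht.1⟩
    have hpos : 0 < d ^ k * κ * s₀ := by positivity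
    have h2 : ENNReal.ofReal (d ^ k * κ * s₀) *
        volume {t | t ∈ Ioo (ρ - d) (ρ + d) ∧ s₀ ≤ F t} ≤
        ENNReal.ofReal (8 ^ (k + 1)) * ENNReal.ofReal (2 * (2 * d / r) ^ θ * m) := by
      rw [ENNReal.ofReal_mul (by positivity), ENNReal.ofReal_mul (by positivity), mul_assoc]
      exact (mul_le_mul_right h1 _).trans f2'
    rw [← ENNReal.ofReal_mul (by positivity)] at h2
    have h3 : 8 ^ (k + 1) * (2 * (2 * d / r) ^ θ * m) ≤ d ^ k * κ * s₀ * (d / 8) := by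
      have e1 : 2 * d / r = 2 * K := by rw [hd]; field_simp
      have e2 : d ^ k * κ * s₀ * (d / 8) = K ^ (k + 1) * m / (64 * 16 ^ (k + 1)) := by
        rw [hs₀, hc, hd]; field_simp; ring
      rw [e1, e2, le_div_iff₀ (by positivity)]
      have e3 : (128 : ℝ) ^ (k + 1) = 8 ^ (k + 1) * 16 ^ (k + 1) := by
        rw [← mul_pow]; norm_num
      rw [e3] at hKθ
      calc _ = (128 * (8 ^ (k + 1) * 16 ^ (k + 1)) * (2 * K) ^ θ) * m := by ring
        _ ≤ _ := by gcongr
    have h4 := h2.trans (ENNReal.ofReal_le_ofReal h3)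
    rw [ENNReal.ofReal_mul hpos.le] at h4
    exact (ENNReal.mul_le_mul_iff_right (by simpa using hpos) ENNReal.ofReal_ne_top).1 h4
  have hrise := hp.lintegral_excess_le hd0 (by linarith) hlevel
  have f1 := lintegral_ball_radial_le hn hFm (z := z) hr (by linarith)
  rw [hκv, hmB, ← ENNReal.ofReal_mul (by positivity)] at f1
  simp only [Nat.add_sub_cancel] at f1 ⊢
  have hhalf : ENNReal.ofReal (m / 2) ≤ ENNReal.ofReal c *
      ∫⁻ t in Ioo (ρ - d / 4) (ρ + d / 4), ENNReal.ofReal (F t - s₀) := by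
    refine ENNReal.ofReal_half_le_of_le_add hm.le (f1.trans ?_)
    have hsub : Ioo (‖z‖ - r) (‖z‖ + r) ⊆ Ioo (ρ - 2 * r) (ρ + 2 * r) :=
      Ioo_subset_Ioo (by linarith) (by linarith)
    calc _ ≤ ENNReal.ofReal c * ∫⁻ t in Ioo (ρ - 2 * r) (ρ + 2 * r), ENNReal.ofReal (F t) := by
          gcongr
      _ ≤ ENNReal.ofReal c * ((∫⁻ t in Ioo (ρ - 2 * r) (ρ + 2 * r), ENNReal.ofReal (F t - s₀)) +
            ENNReal.ofReal s₀ * ENNReal.ofReal (4 * r)) := by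
          gcongr
          refine (lintegral_le_excess_add F s₀).trans (le_of_eq ?_)
          rw [Measure.restrict_apply_univ, Real.volume_Ioo]
          congr 3; ring
      _ ≤ _ := by
          rw [mul_add, ← ENNReal.ofReal_mul hs₀0.le, ← ENNReal.ofReal_mul hc0.le]
          have : c * (s₀ * (4 * r)) = m / 2 := by rw [hs₀]; field_simp; ring
          rw [this]
          gcongr <;> linarith
  have htop := hhalf.trans (mul_le_mul_right hrise _)
  have hm2 : ∀ a : ℝ, 0 ≤ a → ENNReal.ofReal (m * a) =
      ENNReal.ofReal (2 * a) * ENNReal.ofReal (m / 2) := by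
    intro a ha
    rw [← ENNReal.ofReal_mul (by positivity)]
    congr 1; ring
  constructor
  · rw [hm2 _ (by positivity)]
    have hker : ENNReal.ofReal (ρ ^ k) * ∫⁻ t in Ioo (ρ - d) (ρ + d), h t *
        (if rightLength F t ≤ ENNReal.ofReal (d / 8) then rightLength F t else 0) ≤
        ENNReal.ofReal (2 ^ k * (2 * d ^ 2)) * radialPotential (k + 1) F h ρ := by
      unfold radialPotential
      rw [← lintegral_const_mul' _ _ ENNReal.ofReal_ne_top,
        ← lintegral_const_mul' _ _ ENNReal.ofReal_ne_top]
      refine le_trans ?_ (lintegral_mono_set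
        (show Ioo (ρ - d) (ρ + d) ⊆ Ioi 0 from fun t ht => mem_Ioi.2 (by linarith [ht.1])))
      refine setLIntegral_mono' measurableSet_Ioo fun t ht => ?_
      split_ifs with hℓ
      swap
      · simp
      have hfin : rightLength F t ≠ ⊤ := ne_top_of_le_ne_top ENNReal.ofReal_ne_top hℓ
      set ℓ := (rightLength F t).toReal with hℓdef
      have hℓeq : rightLength F t = ENNReal.ofReal ℓ := (ENNReal.ofReal_toReal hfin).symm
      have hℓ0 : 0 ≤ ℓ := ENNReal.toReal_nonneg
      have hℓd : ℓ ≤ d := by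
        rw [hℓeq, ENNReal.ofReal_le_ofReal_iff (by positivity)] at hℓ
        linarith
      -- both `ℓ` and `|t - ρ|` are at most `d`
      have hP : ℓ ≤ 2 * d ^ 2 * halfPlaneKernel ℓ (t - ρ) := by
        unfold halfPlaneKernel
        rcases hℓ0.eq_or_lt with h0 | h0
        · simp [← h0]
        rw [← mul_div_assoc, le_div_iff₀ (by positivity)]
        have h1 : (t - ρ) ^ 2 ≤ d ^ 2 := by
          rw [sq_le_sq, abs_of_pos hd0, abs_le]; constructor <;> linarith [ht.1, ht.2]
        have h2 : ℓ ^ 2 ≤ d ^ 2 := by gcongr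
        nlinarith
      have htk : ρ ^ k ≤ 2 ^ k * t ^ k := by
        rw [← mul_pow]; gcongr; linarith [ht.1]
      have ht0 : 0 ≤ t := by linarith [ht.1]
      calc _ ≤ ENNReal.ofReal (2 ^ k * t ^ k) * (h t *
              ENNReal.ofReal (2 * d ^ 2 * halfPlaneKernel ℓ (t - ρ))) := by
            rw [hℓeq]; gcongr
        _ = ENNReal.ofReal (2 ^ k * (2 * d ^ 2)) * (ENNReal.ofReal (t ^ k) * h t *
              ENNReal.ofReal (halfPlaneKernel ℓ (t - ρ))) := by
            rw [ENNReal.ofReal_mul (by positivity), ENNReal.ofReal_mul (by positivity),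
              ENNReal.ofReal_mul (p := 2 ^ k) (by positivity)]
            ring
        _ ≤ _ := by
            simp only [Nat.add_sub_cancel]
            gcongr
            exact le_self_add
    calc _ ≤ ENNReal.ofReal (2 * ρ ^ k) * (ENNReal.ofReal c *
            ∫⁻ t in Ioo (ρ - d) (ρ + d), h t *
        (if rightLength F t ≤ ENNReal.ofReal (d / 8) then rightLength F t else 0)) := by gcongr
      _ = ENNReal.ofReal (2 * c) * (ENNReal.ofReal (ρ ^ k) *
            ∫⁻ t in Ioo (ρ - d) (ρ + d), h t *
        (if rightLength F t ≤ ENNReal.ofReal (d / 8) then rightLength F t else 0)) := by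
          rw [ENNReal.ofReal_mul (p := 2) (by positivity),
            ENNReal.ofReal_mul (p := 2) (by positivity)]
          ring
      _ ≤ ENNReal.ofReal (2 * c) * (ENNReal.ofReal (2 ^ k * (2 * d ^ 2)) *
            radialPotential (k + 1) F h ρ) := by gcongr
      _ = _ := by
          rw [← mul_assoc, ← ENNReal.ofReal_mul (by positivity)]
          congr 2
          have e3 : (32 : ℝ) ^ (k + 1) = 2 ^ (k + 1) * 16 ^ (k + 1) := by
            rw [← mul_pow]; norm_num
          rw [hc, hd, e3]; ring
  · rw [← mul_one m, hm2 1 zero_le_one, mul_one]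
    have hE : ∫⁻ t in Ioo (ρ - d) (ρ + d), h t *
        (if rightLength F t ≤ ENNReal.ofReal (d / 8) then rightLength F t else 0) ≤
        ENNReal.ofReal (d / 8) * ∫⁻ t in Ioi r, h t := by
      rw [← lintegral_const_mul' _ _ ENNReal.ofReal_ne_top]
      refine le_trans ?_ (lintegral_mono_set
        (show Ioo (ρ - d) (ρ + d) ⊆ Ioi r from fun t ht => mem_Ioi.2 (by linarith [ht.1])))
      refine lintegral_mono fun t => ?_
      rw [mul_comm]
      gcongr
      split_ifs with hℓ
      · exact hℓ
      · exact zero_le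
    calc _ ≤ ENNReal.ofReal 2 * (ENNReal.ofReal c *
            (ENNReal.ofReal (d / 8) * ∫⁻ t in Ioi r, h t)) := by
          gcongr
          exact htop.trans (by gcongr)
      _ = ENNReal.ofReal (2 * 16 ^ (k + 1) * κ * (d / 8)) *
            (ENNReal.ofReal (r ^ k) * ∫⁻ t in Ioi r, h t) := by
          rw [← mul_assoc, ← mul_assoc, ← mul_assoc, ← ENNReal.ofReal_mul (by positivity),
            ← ENNReal.ofReal_mul (by positivity), ← ENNReal.ofReal_mul (by positivity)]
          congr 2
          rw [hc]; ring
      _ ≤ ENNReal.ofReal (2 * 16 ^ (k + 1) * κ * (d / 8)) * radialEnergy (k + 1) h := by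
          gcongr
          exact lintegral_Ioi_le_radialEnergy hr
      _ ≤ _ := by
          refine mul_le_mul_left (ENNReal.ofReal_le_ofReal ?_) _
          rw [hd]
          have : 0 ≤ 16 ^ (k + 1) * κ * K * r := by positivity
          nlinarith

/-- Estimate at a point `x` for a ball `B(z, r) ∋ x` of mass `m` that is nearly optimal (`hopt`) and
whose radius is at least comparable to `|x|`. Compared with `B(0, 2Lr)`, near optimality yields a
radius `R` between `Lr` and `2Lr` at which `F` is small, so that half of `m` comes from the excess
of `F` over `F R` in `B(0, R)`, and this is at most a multiple of `∫₀ᴿ h(s) sⁿ ds`. -/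
theorem RadialProfile.far_bound {n : ℕ} (hn : 0 < n) {κ : ℝ} (hκ : 0 < κ)
    (hκv : volume (ball (0 : EuclideanSpace ℝ (Fin n)) 1) = ENNReal.ofReal κ)
    {τ : ℝ} (hτ : (volume : Measure (EuclideanSpace ℝ (Fin n))).toSphere univ = ENNReal.ofReal τ)
    (hτ0 : 0 < τ)
    {L θ : ℝ} (hL : 1 ≤ L) (hLθ : 4 * (2 * L) ^ θ < L ^ n)
    {F : ℝ → ℝ} {h : ℝ → ℝ≥0∞} (hp : RadialProfile n F h)
    {x z : EuclideanSpace ℝ (Fin n)} {r m : ℝ} (hr : 0 < r) (hxz : x ∈ ball z r) (hm : 0 < m)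
    (hmB : ∫⁻ y in ball z r, ENNReal.ofReal (F ‖y‖) = ENNReal.ofReal m)
    (hopt : ∀ w R, 0 < R → x ∈ ball w R →
      ∫⁻ y in ball w R, ENNReal.ofReal (F ‖y‖) ≤ ENNReal.ofReal (2 * (R / r) ^ θ * m))
    (hfar : ‖x‖ + 2 * r ≤ L * r) :
    ENNReal.ofReal (m * ‖x‖ ^ (n - 1)) ≤
        ENNReal.ofReal (16 * τ * L ^ (n + 1) * r ^ (n + 1)) * radialPotential n F h ‖x‖ ∧
      ENNReal.ofReal m ≤ ENNReal.ofReal (4 * L * τ * r) * radialEnergy n h := by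
  obtain ⟨k, rfl⟩ : ∃ k, n = k + 1 := ⟨n - 1, by omega⟩
  have hx0 : 0 ≤ ‖x‖ := norm_nonneg x
  have hLr : 0 < L * r := by positivity
  set s₁ := m / (2 * κ * r ^ (k + 1)) with hs₁
  have hs₁0 : 0 < s₁ := by positivity
  have hFm : Measurable fun y : EuclideanSpace ℝ (Fin (k + 1)) => ENNReal.ofReal (F ‖y‖) :=
    (hp.measurable.comp measurable_norm).ennreal_ofReal
  -- a radius at which the profile is small
  obtain ⟨R, hR, hFR⟩ : ∃ R ∈ Ico (L * r) (2 * (L * r)), F R ≤ s₁ := by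
    by_contra! hcon
    have h1 : ENNReal.ofReal s₁ * volume (ball (0 : EuclideanSpace ℝ (Fin (k + 1))) (2 * (L * r)) \
        ball 0 (L * r)) ≤ ∫⁻ y in ball (0 : EuclideanSpace ℝ (Fin (k + 1))) (2 * (L * r)),
          ENNReal.ofReal (F ‖y‖) := by
      rw [← setLIntegral_const]
      refine le_trans ?_ (lintegral_mono_set (sdiff_subset (t := ball 0 (L * r))))
      refine setLIntegral_mono' (measurableSet_ball.diff measurableSet_ball) fun y hy => ?_
      refine ENNReal.ofReal_le_ofReal (hcon _ ⟨?_, ?_⟩).le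
      · simpa using hy.2
      · simpa using hy.1
    have h2 := h1.trans (hopt 0 (2 * (L * r)) (by positivity)
      (by rw [mem_ball_zero_iff]; linarith))
    rw [measure_sdiff (ball_subset_ball (by linarith)) measurableSet_ball.nullMeasurableSet
      measure_ball_lt_top.ne, volume_ball_eq _ (by positivity), volume_ball_eq _ hLr, hκv,
      ← ENNReal.ofReal_mul (by positivity), ← ENNReal.ofReal_mul (by positivity),
      ← ENNReal.ofReal_sub _ (by positivity), ← ENNReal.ofReal_mul (by positivity),
      ENNReal.ofReal_le_ofReal_iff (by positivity)] at h2
    have e1 : 2 * (L * r) / r = 2 * L := by field_simp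
    have e2 : s₁ * ((2 * (L * r)) ^ (k + 1) * κ - (L * r) ^ (k + 1) * κ) =
        L ^ (k + 1) * m / 2 * (2 ^ (k + 1) - 1) := by
      rw [hs₁]; simp only [mul_pow]; field_simp
    rw [e1, e2] at h2
    have h3 : (1 : ℝ) ≤ 2 ^ (k + 1) - 1 := by
      have : (2 : ℝ) ^ 1 ≤ 2 ^ (k + 1) := pow_le_pow_right₀ (by norm_num) (by omega)
      linarith
    have h4 : L ^ (k + 1) * m / 2 ≤ 2 * (2 * L) ^ θ * m :=
      (le_mul_of_one_le_right (by positivity) h3).trans h2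
    nlinarith
  have hR0 : 0 < R := hLr.trans_le hR.1
  have hhalf : ENNReal.ofReal (m / 2) ≤
      ∫⁻ y in ball (0 : EuclideanSpace ℝ (Fin (k + 1))) R, ENNReal.ofReal (F ‖y‖ - F R) := by
    refine ENNReal.ofReal_half_le_of_le_add hm.le ?_
    rw [← hmB]
    refine (lintegral_le_excess_add (fun y => F ‖y‖) (F R)).trans ?_
    have hsub : ball z r ⊆ ball (0 : EuclideanSpace ℝ (Fin (k + 1))) R := by
      intro y hy
      rw [mem_ball_zero_iff]
      rw [mem_ball, dist_eq_norm] at hy hxz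
      have h1 : ‖y‖ ≤ ‖x‖ + ‖y - z‖ + ‖x - z‖ := by
        have : y = x + (y - z) - (x - z) := by abel
        calc ‖y‖ = ‖x + (y - z) - (x - z)‖ := by rw [← this]
          _ ≤ _ := (norm_sub_le _ _).trans (add_le_add_left (norm_add_le _ _) _)
      linarith [hR.1]
    gcongr
    rw [Measure.restrict_apply_univ, volume_ball_eq _ hr, hκv, ← ENNReal.ofReal_mul (by positivity),
      ← ENNReal.ofReal_mul (hp.nonneg R)]
    refine ENNReal.ofReal_le_ofReal ?_
    calc F R * (r ^ (k + 1) * κ) ≤ s₁ * (r ^ (k + 1) * κ) := by gcongr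
      _ = m / 2 := by rw [hs₁]; field_simp
  have hint : ∫⁻ y in ball (0 : EuclideanSpace ℝ (Fin (k + 1))) R, ENNReal.ofReal (F ‖y‖ - F R) ≤
      ENNReal.ofReal τ * ∫⁻ s in Ioc 0 R, h s * ENNReal.ofReal (s ^ (k + 1)) := by
    have e1 : ∀ y : EuclideanSpace ℝ (Fin (k + 1)),
        (ball (0 : EuclideanSpace ℝ (Fin (k + 1))) R).indicator
          (fun y => ENNReal.ofReal (F ‖y‖ - F R)) y =
        (Iio R).indicator (fun t => ENNReal.ofReal (F t - F R)) ‖y‖ := by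
      intro y; simp [indicator]
    rw [← lintegral_indicator measurableSet_ball, lintegral_congr e1, lintegral_radial hn
      ((hp.measurable.sub_const _).ennreal_ofReal.indicator measurableSet_Iio), hτ]
    refine mul_le_mul_right ?_ _
    set Q : Set (ℝ × ℝ) := {p | 0 < p.1 ∧ p.1 < p.2 ∧ p.2 ≤ R} with hQ
    have hQm : MeasurableSet Q := (measurableSet_lt measurable_const measurable_fst).inter
      ((measurableSet_lt measurable_fst measurable_snd).inter
        (measurableSet_le measurable_snd measurable_const))
    have hQi : Measurable (Q.indicator fun p => ENNReal.ofReal (p.1 ^ k) * h p.2) :=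
      ((measurable_fst.pow_const k).ennreal_ofReal.mul
        (hp.measurable_grad.comp measurable_snd)).indicator hQm
    calc _ ≤ ∫⁻ t in Ioi (0 : ℝ), ∫⁻ s, Q.indicator (fun p => ENNReal.ofReal (p.1 ^ k) * h p.2)
            (t, s) := by
          refine setLIntegral_mono' measurableSet_Ioi fun t ht => ?_
          have ht : 0 < t := ht
          by_cases htR : t < R
          swap
          · simp [htR]
          rw [indicator_of_mem (show t ∈ Iio R from htR), Nat.add_sub_cancel]
          have e2 : ∀ s, Q.indicator (fun p => ENNReal.ofReal (p.1 ^ k) * h p.2) (t, s) =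
              (Ioc t R).indicator (fun s => ENNReal.ofReal (t ^ k) * h s) s := by
            intro s; simp [indicator, hQ, ht]
          rw [lintegral_congr e2, lintegral_indicator measurableSet_Ioc,
            lintegral_const_mul _ hp.measurable_grad]
          gcongr
          refine le_trans ?_ (hp.edist_le t R ht htR.le)
          rw [edist_dist, Real.dist_eq]
          exact ENNReal.ofReal_le_ofReal (le_abs_self _)
      _ ≤ ∫⁻ t, ∫⁻ s, Q.indicator (fun p => ENNReal.ofReal (p.1 ^ k) * h p.2) (t, s) :=
          setLIntegral_le_lintegral _ _
      _ = ∫⁻ s, ∫⁻ t, Q.indicator (fun p => ENNReal.ofReal (p.1 ^ k) * h p.2) (t, s) :=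
          lintegral_lintegral_swap hQi.aemeasurable
      _ ≤ ∫⁻ s, (Ioc 0 R).indicator (fun s => h s * ENNReal.ofReal (s ^ (k + 1))) s := by
          refine lintegral_mono fun s => ?_
          by_cases hs : s ∈ Ioc 0 R
          swap
          · have : ∀ t, Q.indicator (fun p => ENNReal.ofReal (p.1 ^ k) * h p.2) (t, s) = 0 :=
              fun t => indicator_of_notMem (fun hq => hs ⟨hq.1.trans hq.2.1, hq.2.2⟩) _
            simp [this]
          rw [indicator_of_mem hs]
          have hs0 : 0 < s := hs.1
          calc _ ≤ ∫⁻ t, (Ioo 0 s).indicator (fun _ => ENNReal.ofReal (s ^ k) * h s) t := by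
                refine lintegral_mono fun t => ?_
                by_cases ht : (t, s) ∈ Q
                · rw [indicator_of_mem ht, indicator_of_mem (show t ∈ Ioo 0 s from ⟨ht.1, ht.2.1⟩)]
                  have h1 : 0 < t := ht.1
                  have h2 : t < s := ht.2.1
                  gcongr
                · rw [indicator_of_notMem ht]; exact zero_le
            _ = ENNReal.ofReal (s ^ k) * h s * ENNReal.ofReal s := by
                rw [lintegral_indicator_const measurableSet_Ioo, Real.volume_Ioo, sub_zero]
            _ = _ := by
                rw [pow_succ, ENNReal.ofReal_mul (by positivity)]; ring
      _ = _ := lintegral_indicator measurableSet_Ioc _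
  have htop := hhalf.trans hint
  have hm2 : ∀ a : ℝ, 0 ≤ a → ENNReal.ofReal (m * a) =
      ENNReal.ofReal (2 * a) * ENNReal.ofReal (m / 2) := by
    intro a ha
    rw [← ENNReal.ofReal_mul (by positivity)]
    congr 1; ring
  have hsubI : Ioc 0 R ⊆ Ioi (0 : ℝ) := fun s hs => hs.1
  constructor
  · rw [hm2 _ (by positivity)]
    have hker : ∫⁻ s in Ioc 0 R, h s * ENNReal.ofReal (s ^ (k + 1)) ≤
        ENNReal.ofReal (8 * (L * r) ^ 2) * radialPotential (k + 1) F h ‖x‖ := by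
      unfold radialPotential
      rw [← lintegral_const_mul' _ _ ENNReal.ofReal_ne_top]
      refine le_trans ?_ (lintegral_mono_set hsubI)
      refine setLIntegral_mono' measurableSet_Ioc fun s hs => ?_
      have hs0 : 0 < s := hs.1
      have hP : s ≤ 8 * (L * r) ^ 2 * halfPlaneKernel s ‖x‖ := by
        unfold halfPlaneKernel
        rw [← mul_div_assoc, le_div_iff₀ (by positivity)]
        have h1 : s ^ 2 ≤ (2 * (L * r)) ^ 2 := by gcongr; linarith [hs.2, hR.2]
        have h2 : ‖x‖ ^ 2 ≤ (L * r) ^ 2 := by gcongr; linarith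
        nlinarith
      calc _ ≤ h s * ENNReal.ofReal (s ^ k * (8 * (L * r) ^ 2 * halfPlaneKernel s ‖x‖)) := by
            rw [pow_succ]; gcongr
        _ = ENNReal.ofReal (8 * (L * r) ^ 2) * (ENNReal.ofReal (s ^ k) * h s *
              ENNReal.ofReal (halfPlaneKernel s ‖x‖)) := by
            rw [ENNReal.ofReal_mul (by positivity),
              ENNReal.ofReal_mul (p := 8 * (L * r) ^ 2) (by positivity)]
            ring
        _ ≤ _ := by
            simp only [Nat.add_sub_cancel]
            gcongr
            exact le_add_self
    calc _ ≤ ENNReal.ofReal (2 * (L * r) ^ k) * (ENNReal.ofReal τ *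
            (ENNReal.ofReal (8 * (L * r) ^ 2) * radialPotential (k + 1) F h ‖x‖)) := by
          gcongr
          · rw [Nat.add_sub_cancel]; gcongr; linarith
          · exact htop.trans (by gcongr)
      _ = _ := by
          rw [← mul_assoc, ← mul_assoc, ← ENNReal.ofReal_mul (by positivity),
            ← ENNReal.ofReal_mul (by positivity)]
          congr 2; ring
  · rw [← mul_one m, hm2 1 zero_le_one, mul_one]
    have hE : ∫⁻ s in Ioc 0 R, h s * ENNReal.ofReal (s ^ (k + 1)) ≤
        ENNReal.ofReal (2 * (L * r)) * radialEnergy (k + 1) h := by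
      unfold radialEnergy
      rw [← lintegral_const_mul' _ _ ENNReal.ofReal_ne_top]
      refine le_trans ?_ (lintegral_mono_set hsubI)
      refine setLIntegral_mono' measurableSet_Ioc fun s hs => ?_
      have hs0 : 0 < s := hs.1
      rw [pow_succ, ENNReal.ofReal_mul (by positivity), Nat.add_sub_cancel, mul_comm, mul_assoc,
        mul_left_comm]
      gcongr
      linarith [hs.2, hR.2]
    calc _ ≤ ENNReal.ofReal 2 * (ENNReal.ofReal τ *
            (ENNReal.ofReal (2 * (L * r)) * radialEnergy (k + 1) h)) := by
          gcongr
          exact htop.trans (by gcongr)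
      _ = _ := by
          rw [← mul_assoc, ← mul_assoc, ← ENNReal.ofReal_mul (by positivity),
            ← ENNReal.ofReal_mul (by positivity)]
          congr 2; ring

/-! ### The maximal function as a supremum over balls -/

/-- The values `r ^ (-θ) * ν (B(z, r))` over the open balls containing `x`; for `θ = n - β` and
`ν = |f| dx` their supremum is `M_β f(x)` up to the volume of the unit ball. -/
def ballValues {n : ℕ} (ν : Measure (EuclideanSpace ℝ (Fin n))) (θ : ℝ)
    (x : EuclideanSpace ℝ (Fin n)) : Set ℝ :=
  {a | ∃ z r, 0 < r ∧ x ∈ ball z r ∧ a = r ^ (-θ) * ν.real (ball z r)}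

theorem fracMaximal_congr {n : ℕ} {β : ℝ} {f g : EuclideanSpace ℝ (Fin n) → ℝ}
    (hfg : ∀ᵐ x, ‖f x‖ₑ = ‖g x‖ₑ) : fracMaximal β f = fracMaximal β g := by
  funext x
  unfold fracMaximal
  refine iSup_congr fun z => iSup_congr fun r => ?_
  rw [lintegral_congr_ae (ae_restrict_of_ae hfg)]

theorem fracMaximal_term_eq {n : ℕ} {β κ : ℝ} (hκ : 0 < κ)
    (hκv : volume (ball (0 : EuclideanSpace ℝ (Fin n)) 1) = ENNReal.ofReal κ)
    {f : EuclideanSpace ℝ (Fin n) → ℝ} (hf : ∫⁻ y, ‖f y‖ₑ ≠ ⊤) (z : EuclideanSpace ℝ (Fin n))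
    {r : ℝ} (hr : 0 < r) :
    ENNReal.ofReal (r ^ β) * ((∫⁻ y in ball z r, ‖f y‖ₑ ∂volume) / volume (ball z r)) =
      ENNReal.ofReal (κ⁻¹ * (r ^ (-(n - β)) *
        (volume.withDensity fun y => ‖f y‖ₑ).real (ball z r))) := by
  have hfin : ∫⁻ y in ball z r, ‖f y‖ₑ ≠ ⊤ :=
    ne_top_of_le_ne_top hf (setLIntegral_le_lintegral _ _)
  rw [measureReal_def, withDensity_apply _ measurableSet_ball, volume_ball_eq _ hr, hκv,
    ← ENNReal.ofReal_mul (by positivity), ← ENNReal.ofReal_toReal hfin,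
    ← ENNReal.ofReal_div_of_pos (by positivity), ← ENNReal.ofReal_mul (by positivity),
    ENNReal.toReal_ofReal ENNReal.toReal_nonneg]
  congr 1
  rw [neg_sub, Real.rpow_sub hr, Real.rpow_natCast]
  field_simp

/-- Where the values over balls are bounded, the fractional maximal function is finite and its real
value is, up to the factor `κ`, their supremum. -/
theorem fracMaximal_isLUB {n : ℕ} {β κ : ℝ} (hκ : 0 < κ)
    (hκv : volume (ball (0 : EuclideanSpace ℝ (Fin n)) 1) = ENNReal.ofReal κ)
    {f : EuclideanSpace ℝ (Fin n) → ℝ} (hf : ∫⁻ y, ‖f y‖ₑ ≠ ⊤) {x : EuclideanSpace ℝ (Fin n)}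
    (hb : BddAbove (ballValues (volume.withDensity fun y => ‖f y‖ₑ) (n - β) x)) :
    fracMaximal β f x < ⊤ ∧
      IsLUB (ballValues (volume.withDensity fun y => ‖f y‖ₑ) (n - β) x)
        (κ * (fracMaximal β f x).toReal) := by
  have hub : ∀ b ∈ upperBounds (ballValues (volume.withDensity fun y => ‖f y‖ₑ) (n - β) x),
      fracMaximal β f x ≤ ENNReal.ofReal (κ⁻¹ * b) := by
    intro b hb
    refine iSup_le fun z => iSup_le fun r => iSup_le fun hr => iSup_le fun hx => ?_
    rw [fracMaximal_term_eq hκ hκv hf z hr]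
    refine ENNReal.ofReal_le_ofReal ?_
    gcongr
    exact hb ⟨z, r, hr, hx, rfl⟩
  have hfin : fracMaximal β f x < ⊤ := by
    obtain ⟨b, hb⟩ := hb
    exact (hub b hb).trans_lt ENNReal.ofReal_lt_top
  refine ⟨hfin, ?_, ?_⟩
  · rintro _ ⟨z, r, hr, hx, rfl⟩
    have h1 : ENNReal.ofReal (κ⁻¹ * (r ^ (-(n - β)) *
        (volume.withDensity fun y => ‖f y‖ₑ).real (ball z r))) ≤ fracMaximal β f x := by
      rw [← fracMaximal_term_eq hκ hκv hf z hr]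
      unfold fracMaximal
      exact le_iSup_of_le z (le_iSup_of_le r (le_iSup_of_le hr (le_iSup_of_le hx le_rfl)))
    have h2 := (ENNReal.ofReal_le_iff_le_toReal hfin.ne).1 h1
    rwa [inv_mul_le_iff₀ hκ] at h2
  · intro b hb
    have hb0 : 0 ≤ b := by
      refine le_trans ?_ (hb ⟨x, 1, one_pos, mem_ball_self one_pos, rfl⟩)
      positivity
    have := ENNReal.toReal_le_of_le_ofReal (by positivity) (hub b hb)
    rwa [← le_inv_mul_iff₀ hκ]

theorem rpow_neg_add_ge {r δ θ : ℝ} (hr : 0 < r) (hδ : 0 ≤ δ) (hθ : 0 ≤ θ) :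
    r ^ (-θ) - θ * δ * r ^ (-θ - 1) ≤ (r + δ) ^ (-θ) := by
  have h1 : r + δ = r * (1 + δ / r) := by field_simp
  have hs : 0 ≤ δ / r := by positivity
  have h2 : 1 - θ * (δ / r) ≤ (1 + δ / r) ^ (-θ) := by
    rw [Real.rpow_def_of_pos (by positivity)]
    have h3 := Real.add_one_le_exp (Real.log (1 + δ / r) * -θ)
    have h4 := Real.log_le_sub_one_of_pos (show 0 < 1 + δ / r by positivity)
    nlinarith
  rw [h1, Real.mul_rpow hr.le (by positivity), Real.rpow_sub_one hr.ne']
  have h5 : 0 < r ^ (-θ) := by positivity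
  calc _ = r ^ (-θ) * (1 - θ * (δ / r)) := by field_simp
    _ ≤ _ := by gcongr

/-- One-sided Lipschitz bound for the supremum over balls: enlarging a nearly optimal ball of radius
`r` at `x` by `dist x x'` produces a competitor at `x'`. -/
theorem isLUB_ballValues_sub_le {n : ℕ} {ν : Measure (EuclideanSpace ℝ (Fin n))}
    [IsFiniteMeasure ν] {θ N N' L : ℝ} (hθ : 0 ≤ θ) {x x' : EuclideanSpace ℝ (Fin n)}
    (hN : IsLUB (ballValues ν θ x) N) (hN' : IsLUB (ballValues ν θ x') N') (hpos : 0 < N)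
    (hL : ∀ z r, 0 < r → x ∈ ball z r → N / 2 ≤ r ^ (-θ) * ν.real (ball z r) →
      r ^ (-θ - 1) * ν.real (ball z r) ≤ L) :
    N - N' ≤ θ * L * dist x x' := by
  refine le_of_forall_pos_le_add fun ε hε => ?_
  obtain ⟨_, ⟨z, r, hr, hx, rfl⟩, ha, -⟩ := hN.exists_between
    (show max (N / 2) (N - ε) < N from max_lt (by linarith) (by linarith))
  have h1 := hL z r hr hx ((le_max_left _ _).trans ha.le)
  have h2 : N - ε ≤ r ^ (-θ) * ν.real (ball z r) := (le_max_right _ _).trans ha.le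
  set δ := dist x x' with hδ
  have hδ0 : 0 ≤ δ := dist_nonneg
  have h3 : (r + δ) ^ (-θ) * ν.real (ball z (r + δ)) ≤ N' := by
    refine hN'.1 ⟨z, r + δ, by positivity, ?_, rfl⟩
    rw [mem_ball] at hx ⊢
    have := dist_triangle x' x z
    rw [dist_comm x' x] at this
    linarith
  have h4 : ν.real (ball z r) ≤ ν.real (ball z (r + δ)) :=
    measureReal_mono (ball_subset_ball (by linarith))
  have h5 := rpow_neg_add_ge hr hδ0 hθ
  have h6 : (r ^ (-θ) - θ * δ * r ^ (-θ - 1)) * ν.real (ball z r) ≤ N' :=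
    le_trans (mul_le_mul h5 h4 measureReal_nonneg (by positivity)) h3
  have h7 : θ * δ * (r ^ (-θ - 1) * ν.real (ball z r)) ≤ θ * δ * L := by gcongr
  nlinarith

theorem eventually_mul_rpow_lt {n : ℕ} {θ : ℝ} (hθ : θ < n) (A : ℝ) :
    ∀ᶠ K : ℝ in atTop, A * (2 * K) ^ θ < K ^ n := by
  have h1 := (tendsto_rpow_atTop (show 0 < n - θ by linarith)).eventually_gt_atTop (A * 2 ^ θ)
  filter_upwards [h1, eventually_gt_atTop 0] with K hK hK0
  have h2 : K ^ n = K ^ θ * K ^ (n - θ) := by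
    rw [← Real.rpow_add hK0, add_sub_cancel, Real.rpow_natCast]
  rw [h2, Real.mul_rpow (by norm_num) hK0.le]
  have : 0 < K ^ θ := by positivity
  nlinarith

theorem exists_pos_toSphere {n : ℕ} (hn : 0 < n) : ∃ τ : ℝ, 0 < τ ∧
    (volume : Measure (EuclideanSpace ℝ (Fin n))).toSphere univ = ENNReal.ofReal τ := by
  have : Nontrivial (EuclideanSpace ℝ (Fin n)) := by
    have : Nonempty (Fin n) := ⟨⟨0, hn⟩⟩
    infer_instance
  refine ⟨((volume : Measure (EuclideanSpace ℝ (Fin n))).toSphere univ).toReal,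
    ENNReal.toReal_pos ?_ (measure_ne_top _ _), (ENNReal.ofReal_toReal (measure_ne_top _ _)).symm⟩
  rw [Ne, Measure.measure_univ_eq_zero]
  exact Measure.toSphere_ne_zero _

/-- Bounds for the mass `m` of a ball `B(z, r) ∋ x` that is nearly optimal at `x`, in the sense that
`R^{-θ}` times the mass of any ball of radius `R` containing `x` is at most `2 r^{-θ} m`. -/
theorem exists_nearly_optimal_bound {n : ℕ} (hn : 0 < n) {θ : ℝ} (hθn : θ < n) :
    ∃ C : ℝ, 0 < C ∧ ∀ (F : ℝ → ℝ) (h : ℝ → ℝ≥0∞), RadialProfile n F h →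
      ∀ (x z : EuclideanSpace ℝ (Fin n)) (r m : ℝ), 0 < r → x ∈ ball z r → 0 < m →
      ∫⁻ y in ball z r, ENNReal.ofReal (F ‖y‖) = ENNReal.ofReal m →
      (∀ w R, 0 < R → x ∈ ball w R →
        ∫⁻ y in ball w R, ENNReal.ofReal (F ‖y‖) ≤ ENNReal.ofReal (2 * (R / r) ^ θ * m)) →
      ENNReal.ofReal (m * ‖x‖ ^ (n - 1)) ≤
        ENNReal.ofReal (C * r ^ (n + 1)) * radialPotential n F h ‖x‖ ∧
      ENNReal.ofReal m ≤ ENNReal.ofReal (C * r) * radialEnergy n h := by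
  obtain ⟨κ, hκ, hκv⟩ := exists_pos_volume_unitBall n
  obtain ⟨τ, hτ, hτv⟩ := exists_pos_toSphere hn
  obtain ⟨K, hKθ, hK⟩ := ((eventually_mul_rpow_lt hθn (128 * 128 ^ n)).and
    (eventually_ge_atTop 8)).exists
  obtain ⟨L, hLθ, hL⟩ := ((eventually_mul_rpow_lt hθn 4).and
    (eventually_ge_atTop (2 * K + 2))).exists
  have hL0 : 0 < L := by linarith
  have hK0 : 0 < K := by linarith
  refine ⟨2 * 32 ^ n * κ * K ^ 2 + 16 ^ n * κ * K + 16 * τ * L ^ (n + 1) + 4 * L * τ,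
    by positivity, fun F h hp x z r m hr hxz hm hmB hopt => ?_⟩
  have p1 : 0 < 2 * 32 ^ n * κ * K ^ 2 := by positivity
  have p2 : 0 < 16 ^ n * κ * K := by positivity
  have p3 : 0 < 16 * τ * L ^ (n + 1) := by positivity
  have p4 : 0 < 4 * L * τ := by positivity
  rcases le_total (2 * K * r) ‖x‖ with hcase | hcase
  · obtain ⟨h1, h2⟩ := hp.near_bound hn hκ hκv hK hKθ.le hr hxz hm hmB hopt hcase
    refine ⟨h1.trans ?_, h2.trans ?_⟩
    · gcongr; linarith
    · gcongr; linarith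
  · obtain ⟨h1, h2⟩ := hp.far_bound hn hκ hκv hτv hτ (by linarith) hLθ hr hxz hm hmB hopt
      (by nlinarith)
    refine ⟨h1.trans ?_, h2.trans ?_⟩
    · gcongr; linarith
    · gcongr; linarith

/-- With `q = n / θ`, the exponents match: `(r^{-θ-1} m)^q = (m / r^{n+1}) (m / r)^{q-1}`. The first
factor is bounded by `h1`, the second by `h2`. -/
theorem rpow_gradient_bound {n : ℕ} {θ m r ρ C P E : ℝ} (hθ : 0 < θ) (hθn : θ ≤ n) (hm : 0 < m)
    (hr : 0 < r) (hρ : 0 < ρ) (hC : 0 ≤ C) (hE : 0 ≤ E)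
    (h1 : m * ρ ^ (n - 1) ≤ C * r ^ (n + 1) * P) (h2 : m ≤ C * r * E) :
    (r ^ (-θ - 1) * m) ^ (n / θ) ≤
      C ^ (n / θ) * E ^ (n / θ - 1) * (P / ρ ^ (n - 1)) := by
  set q : ℝ := n / θ with hq
  have hq1 : 1 ≤ q := (one_le_div hθ).2 hθn
  have hC : 0 < C := by
    rcases hC.eq_or_lt with rfl | hC
    · simp at h2; linarith
    · exact hC
  have e1 : (r ^ (-θ - 1) * m) ^ q = (m / r ^ (n + 1)) * (m / r) ^ (q - 1) := by
    rw [Real.mul_rpow (by positivity) hm.le, ← Real.rpow_mul hr.le, Real.div_rpow hm.le hr.le,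
      Real.rpow_sub_one hm.ne', ← Real.rpow_natCast r (n + 1)]
    have : (-θ - 1) * q = -(((n + 1 : ℕ) : ℝ) + (q - 1)) := by
      rw [hq]; push_cast; field_simp; ring
    rw [this, Real.rpow_neg hr.le, Real.rpow_add hr]
    field_simp
  have e2 : m / r ^ (n + 1) ≤ C * (P / ρ ^ (n - 1)) := by
    rw [div_le_iff₀ (by positivity), ← mul_div_assoc, div_mul_eq_mul_div,
      le_div_iff₀ (by positivity)]
    linarith
  have e3 : m / r ≤ C * E := by
    rw [div_le_iff₀ hr]; linarith
  have e4 : C ^ q = C * C ^ (q - 1) := by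
    rw [Real.rpow_sub_one hC.ne']; field_simp
  calc _ = (m / r ^ (n + 1)) * (m / r) ^ (q - 1) := e1
    _ ≤ (C * (P / ρ ^ (n - 1))) * (C * E) ^ (q - 1) := by
        gcongr
        · exact le_trans (by positivity) e2
    _ = _ := by rw [Real.mul_rpow hC.le hE, e4]; ring

/-- The points at which the maximal function of a radial function is locally Lipschitz: all points
but the origin, and in dimension one, where the profile is bounded, the origin as well. -/
def regularPoints (n : ℕ) : Set (EuclideanSpace ℝ (Fin n)) := {x | x ≠ 0 ∨ n = 1}

/-- The measure on `ℝⁿ` with density the radial function `F(|y|)`. -/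
noncomputable def radialMeasure (n : ℕ) (F : ℝ → ℝ) : Measure (EuclideanSpace ℝ (Fin n)) :=
  volume.withDensity fun y => ENNReal.ofReal (F ‖y‖)

theorem radialMeasure_ball {n : ℕ} {F : ℝ → ℝ} (z : EuclideanSpace ℝ (Fin n)) (r : ℝ) :
    radialMeasure n F (ball z r) = ∫⁻ y in ball z r, ENNReal.ofReal (F ‖y‖) :=
  withDensity_apply _ measurableSet_ball

theorem radialMeasure_real_ball_le {n : ℕ} {F : ℝ → ℝ} {κ : ℝ} (hκ : 0 < κ)
    (hκv : volume (ball (0 : EuclideanSpace ℝ (Fin n)) 1) = ENNReal.ofReal κ)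
    {z : EuclideanSpace ℝ (Fin n)} {r S : ℝ} (hr : 0 < r) (hS : 0 ≤ S)
    (hF : ∀ᵐ y : EuclideanSpace ℝ (Fin n), y ∈ ball z r → F ‖y‖ ≤ S) :
    (radialMeasure n F).real (ball z r) ≤ S * κ * r ^ n := by
  rw [measureReal_def, radialMeasure_ball]
  refine ENNReal.toReal_le_of_le_ofReal (by positivity) ?_
  calc _ ≤ ∫⁻ y in ball z r, ENNReal.ofReal S := by
        refine lintegral_mono_ae ?_
        rw [ae_restrict_iff' measurableSet_ball]
        filter_upwards [hF] with y hy hyb using ENNReal.ofReal_le_ofReal (hy hyb)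
    _ = _ := by
        rw [setLIntegral_const, volume_ball_eq _ hr, hκv, ← ENNReal.ofReal_mul (by positivity),
          ← ENNReal.ofReal_mul hS]
        congr 1; ring

namespace RadialProfile

variable {n : ℕ} {F : ℝ → ℝ} {h : ℝ → ℝ≥0∞}

/-- Pointwise decay of an integrable radial Sobolev function. Integrability forces `F` to come close
to `0` at infinity, so `F t ≤ ∫ h` over `(t, ∞)`. -/
theorem mul_pow_le (hp : RadialProfile n F h) (hn : 0 < n)
    (hF : ∫⁻ y : EuclideanSpace ℝ (Fin n), ENNReal.ofReal (F ‖y‖) ≠ ⊤) {t : ℝ} (ht : 0 < t) :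
    F t * t ^ (n - 1) ≤ (radialEnergy n h).toReal := by
  have hFm : Measurable fun t => ENNReal.ofReal (F t) := hp.measurable.ennreal_ofReal
  have hle : ENNReal.ofReal (F t) ≤ ∫⁻ s in Ioi t, h s := by
    by_contra! hlt
    obtain ⟨τ, hτ, hτv⟩ := exists_pos_toSphere hn
    rw [lintegral_radial hn hFm, hτv] at hF
    have h1 : ∫⁻ s in Ioi (0 : ℝ), ENNReal.ofReal (s ^ (n - 1)) * ENNReal.ofReal (F s) ≠ ⊤ := by
      intro htop
      rw [htop, ENNReal.mul_top (by simpa using hτ)] at hF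
      exact hF rfl
    set ε := ENNReal.ofReal (F t) - ∫⁻ s in Ioi t, h s with hε
    have hε0 : ε ≠ 0 := (tsub_pos_of_lt hlt).ne'
    refine h1 (top_le_iff.1 ?_)
    calc ⊤ = ∫⁻ s in Ioi t, ENNReal.ofReal (t ^ (n - 1)) * ε := by
          rw [setLIntegral_const, Real.volume_Ioi, ENNReal.mul_top]
          exact mul_ne_zero (by simpa using pow_pos ht _) hε0
      _ ≤ ∫⁻ s in Ioi t, ENNReal.ofReal (s ^ (n - 1)) * ENNReal.ofReal (F s) := by
          refine setLIntegral_mono' measurableSet_Ioi fun s hs => ?_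
          have hs : t < s := hs
          gcongr
          rw [hε, tsub_le_iff_right]
          have h2 := hp.edist_le t s ht hs.le
          calc ENNReal.ofReal (F t) ≤ ENNReal.ofReal (F s) + ENNReal.ofReal (|F t - F s|) := by
                rw [← ENNReal.ofReal_add (hp.nonneg s) (abs_nonneg _)]
                refine ENNReal.ofReal_le_ofReal ?_
                linarith [le_abs_self (F t - F s)]
            _ ≤ _ := by
                gcongr
                rw [← Real.dist_eq, ← edist_dist]
                exact h2.trans (lintegral_mono_set Ioc_subset_Ioi_self)
      _ ≤ _ := lintegral_mono_set (Ioi_subset_Ioi ht.le)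
  have h3 := (mul_le_mul_right hle (ENNReal.ofReal (t ^ (n - 1)))).trans
    (lintegral_Ioi_le_radialEnergy ht)
  rw [← ENNReal.ofReal_mul (by positivity), mul_comm] at h3
  exact (ENNReal.ofReal_le_iff_le_toReal hp.energy).1 h3

theorem le_div_pow (hp : RadialProfile n F h) (hn : 0 < n)
    (hF : ∫⁻ y : EuclideanSpace ℝ (Fin n), ENNReal.ofReal (F ‖y‖) ≠ ⊤) {c t : ℝ} (hc : 0 < c)
    (hct : c ≤ t) : F t ≤ (radialEnergy n h).toReal / c ^ (n - 1) := by
  rw [le_div_iff₀ (by positivity)]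
  have := hp.nonneg t
  calc F t * c ^ (n - 1) ≤ F t * t ^ (n - 1) := by gcongr
    _ ≤ _ := hp.mul_pow_le hn hF (hc.trans_le hct)

/-- A ball inside `B(0, R)` has mass `O(R)`, because `F(t) t^{n-1}` is bounded. -/
theorem radialMeasure_real_le_linear (hp : RadialProfile n F h) (hn : 0 < n)
    (hF : ∫⁻ y : EuclideanSpace ℝ (Fin n), ENNReal.ofReal (F ‖y‖) ≠ ⊤) {τ : ℝ} (hτ : 0 < τ)
    (hτv : (volume : Measure (EuclideanSpace ℝ (Fin n))).toSphere univ = ENNReal.ofReal τ)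
    {z : EuclideanSpace ℝ (Fin n)} {r R : ℝ} (hR : 0 ≤ R) (hsub : ball z r ⊆ ball 0 R) :
    (radialMeasure n F).real (ball z r) ≤ τ * R * (radialEnergy n h).toReal := by
  rw [measureReal_def, radialMeasure_ball]
  refine ENNReal.toReal_le_of_le_ofReal (by positivity) ?_
  have e1 : ∀ y : EuclideanSpace ℝ (Fin n),
      (ball (0 : EuclideanSpace ℝ (Fin n)) R).indicator (fun y => ENNReal.ofReal (F ‖y‖)) y =
      (Iio R).indicator (fun t => ENNReal.ofReal (F t)) ‖y‖ := by
    intro y; simp [indicator]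
  refine (lintegral_mono_set hsub).trans ?_
  rw [← lintegral_indicator measurableSet_ball, lintegral_congr e1,
    lintegral_radial hn (hp.measurable.ennreal_ofReal.indicator measurableSet_Iio), hτv,
    mul_assoc, ENNReal.ofReal_mul hτ.le]
  refine mul_le_mul_right ?_ _
  calc _ ≤ ∫⁻ t in Ioi (0 : ℝ), (Iio R).indicator
          (fun _ => ENNReal.ofReal (radialEnergy n h).toReal) t := by
        refine setLIntegral_mono' measurableSet_Ioi fun t ht => ?_
        have ht : 0 < t := ht
        by_cases htR : t < R
        · have htI : t ∈ Iio R := htR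
          rw [indicator_of_mem htI, indicator_of_mem htI,
            ← ENNReal.ofReal_mul (by positivity), mul_comm]
          exact ENNReal.ofReal_le_ofReal (hp.mul_pow_le hn hF ht)
        · simp [htR]
    _ = _ := by
        rw [lintegral_indicator_const measurableSet_Iio, Measure.restrict_apply measurableSet_Iio,
          inter_comm, Ioi_inter_Iio, Real.volume_Ioo, sub_zero, mul_comm,
          ← ENNReal.ofReal_mul hR]

theorem isFiniteMeasure_radialMeasure
    (hF : ∫⁻ y : EuclideanSpace ℝ (Fin n), ENNReal.ofReal (F ‖y‖) ≠ ⊤) :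
    IsFiniteMeasure (radialMeasure n F) := isFiniteMeasure_withDensity hF

/-- Growth of the maximal function at the origin. A ball small compared to `|x|` is estimated by the
decay of `F`, a larger one of radius at most `1` by `RadialProfile.radialMeasure_real_le_linear`,
and one of radius above `1` by the total mass. -/
theorem exists_ballValues_le (hp : RadialProfile n F h) (hn : 0 < n)
    (hF : ∫⁻ y : EuclideanSpace ℝ (Fin n), ENNReal.ofReal (F ‖y‖) ≠ ⊤) {θ : ℝ} (hθ : 0 < θ)
    (hθn : θ < n) : ∃ C, 0 ≤ C ∧ ∀ x ∈ regularPoints n, ∀ a ∈ ballValues (radialMeasure n F) θ x,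
      a ≤ C * (‖x‖ ^ (1 - θ) + 1) := by
  have := isFiniteMeasure_radialMeasure hF
  obtain ⟨κ, hκ, hκv⟩ := exists_pos_volume_unitBall n
  obtain ⟨τ, hτ, hτv⟩ := exists_pos_toSphere hn
  set E := (radialEnergy n h).toReal with hE
  have hE0 : 0 ≤ E := ENNReal.toReal_nonneg
  set M := (radialMeasure n F).real univ
  have hM0 : 0 ≤ M := measureReal_nonneg
  refine ⟨E * κ * 2 ^ (n - 1) + 6 * τ * E * ((1 / 4) ^ (1 - θ) + 1) + M, by positivity, ?_⟩
  rintro x hx _ ⟨z, r, hr, hxz, rfl⟩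
  have c1 : 0 ≤ E * κ * 2 ^ (n - 1) := by positivity
  have c2 : 0 ≤ 6 * τ * E * ((1 / 4) ^ (1 - θ) + 1) := by positivity
  set ρ := ‖x‖ with hρ
  have hρ0 : 0 ≤ ρ := norm_nonneg x
  have hργ : 0 ≤ ρ ^ (1 - θ) := by positivity
  have hball : ∀ y ∈ ball z r, ‖y - x‖ < 2 * r := by
    intro y hy
    rw [mem_ball, dist_eq_norm] at hy hxz
    calc ‖y - x‖ = ‖(y - z) - (x - z)‖ := by congr 1; abel
      _ ≤ _ := norm_sub_le _ _
      _ < _ := by linarith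
  rcases le_or_gt (4 * r) ρ with hcase | hcase
  · have hρpos : 0 < ρ := by linarith
    have h1 := radialMeasure_real_ball_le hκ hκv (F := F) (z := z) (S := E / (ρ / 2) ^ (n - 1)) hr
      (by positivity) (ae_of_all _ fun y hy => hp.le_div_pow hn hF (by positivity) (by
        have h2 := hball y hy
        have h3 := norm_sub_norm_le x y
        rw [norm_sub_rev] at h3
        linarith))
    calc _ ≤ r ^ (-θ) * (E / (ρ / 2) ^ (n - 1) * κ * r ^ n) := by gcongr
      _ = E * κ * 2 ^ (n - 1) * (r ^ (n - θ) / ρ ^ (n - 1)) := by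
          rw [Real.rpow_sub hr, Real.rpow_natCast, Real.rpow_neg hr.le, div_pow]
          field_simp
      _ ≤ E * κ * 2 ^ (n - 1) * (ρ ^ (n - θ) / ρ ^ (n - 1)) := by
          gcongr
          linarith
      _ = E * κ * 2 ^ (n - 1) * ρ ^ (1 - θ) := by
          rw [← Real.rpow_natCast ρ (n - 1), ← Real.rpow_sub hρpos, Nat.cast_sub hn]
          congr 2; push_cast; ring
      _ ≤ _ := by nlinarith
  rcases le_or_gt r 1 with hr1 | hr1
  · have h1 := hp.radialMeasure_real_le_linear hn hF hτ hτv (z := z) (r := r) (R := 6 * r)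
      (by positivity) (by
        intro y hy
        rw [mem_ball_zero_iff]
        have h2 := hball y hy
        have h3 := norm_sub_norm_le y x
        linarith)
    have h4 : r ^ (1 - θ) ≤ ((1 / 4) ^ (1 - θ) + 1) * (ρ ^ (1 - θ) + 1) := by
      have h5 : 0 ≤ (1 / 4 : ℝ) ^ (1 - θ) := by positivity
      rcases le_total 0 (1 - θ) with hγ | hγ
      · have := Real.rpow_le_one hr.le hr1 hγ
        nlinarith
      · have hρpos : 0 < ρ := by
          rcases hx with hx | hx
          · exact norm_pos_iff.2 hx
          · rw [hx, Nat.cast_one] at hθn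
            linarith
        have := Real.rpow_le_rpow_of_nonpos (show 0 < 1 / 4 * ρ by positivity)
          (show 1 / 4 * ρ ≤ r by linarith) hγ
        rw [Real.mul_rpow (by norm_num) hρ0] at this
        nlinarith
    calc _ ≤ r ^ (-θ) * (τ * (6 * r) * E) := by gcongr
      _ = 6 * τ * E * r ^ (1 - θ) := by
          rw [Real.rpow_sub hr, Real.rpow_one, Real.rpow_neg hr.le]; field_simp
      _ ≤ 6 * τ * E * (((1 / 4) ^ (1 - θ) + 1) * (ρ ^ (1 - θ) + 1)) := by gcongr
      _ ≤ _ := by nlinarith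
  · have h1 : (radialMeasure n F).real (ball z r) ≤ M := measureReal_mono (subset_univ _)
    have h2 : r ^ (-θ) ≤ 1 := Real.rpow_le_one_of_one_le_of_nonpos hr1.le (by linarith)
    calc _ ≤ 1 * M := by gcongr
      _ ≤ _ := by nlinarith

/-- Near a regular point small balls carry mass `O(r ^ n)`. -/
theorem exists_small_ball_bound (hp : RadialProfile n F h) (hn : 0 < n)
    (hF : ∫⁻ y : EuclideanSpace ℝ (Fin n), ENNReal.ofReal (F ‖y‖) ≠ ⊤)
    {x₀ : EuclideanSpace ℝ (Fin n)} (hx₀ : x₀ ∈ regularPoints n) :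
    ∃ δ S : ℝ, 0 < δ ∧ 0 ≤ S ∧ ∀ x ∈ ball x₀ δ, ∀ z r, 0 < r → r ≤ δ → x ∈ ball z r →
      (radialMeasure n F).real (ball z r) ≤ S * r ^ n := by
  obtain ⟨κ, hκ, hκv⟩ := exists_pos_volume_unitBall n
  set E := (radialEnergy n h).toReal with hE
  have hE0 : 0 ≤ E := ENNReal.toReal_nonneg
  by_cases h0 : x₀ = 0
  · have hn1 : n = 1 := hx₀.resolve_left (not_not.2 h0)
    subst hn1
    refine ⟨1, E * κ, one_pos, by positivity, fun x _ z r hr _ _ => ?_⟩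
    refine radialMeasure_real_ball_le hκ hκv hr hE0 ?_
    have : ∀ᵐ y : EuclideanSpace ℝ (Fin 1), y ≠ 0 := by
      have : Nontrivial (EuclideanSpace ℝ (Fin 1)) := inferInstance
      exact compl_mem_ae_iff.2 (measure_singleton _)
    filter_upwards [this] with y hy _
    simpa using hp.mul_pow_le hn hF (norm_pos_iff.2 hy)
  · have hρ : 0 < ‖x₀‖ := norm_pos_iff.2 h0
    refine ⟨‖x₀‖ / 8, E / (‖x₀‖ / 2) ^ (n - 1) * κ, by positivity, by positivity,
      fun x hx z r hr hrδ hxz => ?_⟩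
    refine radialMeasure_real_ball_le hκ hκv hr (by positivity) (ae_of_all _ fun y hy =>
      hp.le_div_pow hn hF (by positivity) ?_)
    rw [mem_ball, dist_eq_norm] at hx hxz hy
    have h1 : ‖x₀‖ - ‖y‖ ≤ ‖x - x₀‖ + ‖x - z‖ + ‖y - z‖ := by
      calc ‖x₀‖ - ‖y‖ ≤ ‖x₀ - y‖ := norm_sub_norm_le _ _
        _ = ‖-(x - x₀) + (x - z) - (y - z)‖ := by congr 1; abel
        _ ≤ _ := by
          refine (norm_sub_le _ _).trans ?_
          gcongr
          refine (norm_add_le _ _).trans ?_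
          rw [norm_neg]
    linarith

end RadialProfile

/-! ### Local Lipschitz regularity and the pointwise gradient bound -/

theorem isOpen_regularPoints (n : ℕ) : IsOpen (regularPoints n) := by
  by_cases hn : n = 1
  · have : regularPoints n = univ := by ext; simp [regularPoints, hn]
    rw [this]; exact isOpen_univ
  · have : regularPoints n = {0}ᶜ := by ext; simp [regularPoints, hn]
    rw [this]; exact isOpen_compl_singleton

theorem ae_ne_zero {n : ℕ} (hn : 0 < n) : ∀ᵐ x : EuclideanSpace ℝ (Fin n), x ≠ 0 := by
  have : Nontrivial (EuclideanSpace ℝ (Fin n)) := by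
    have : Nonempty (Fin n) := ⟨⟨0, hn⟩⟩
    infer_instance
  exact compl_mem_ae_iff.2 (measure_singleton _)

namespace RadialProfile

variable {n : ℕ} {F : ℝ → ℝ} {h : ℝ → ℝ≥0∞}

/-- The supremum over balls is locally Lipschitz at regular points: small balls are not nearly
optimal there. -/
theorem exists_local_lipschitz (hp : RadialProfile n F h) (hn : 0 < n)
    (hF : ∫⁻ y : EuclideanSpace ℝ (Fin n), ENNReal.ofReal (F ‖y‖) ≠ ⊤) {θ : ℝ} (hθ : 0 < θ)
    (hθn : θ < n) {N : EuclideanSpace ℝ (Fin n) → ℝ}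
    (hN : ∀ x ∈ regularPoints n, IsLUB (ballValues (radialMeasure n F) θ x) (N x))
    (hpos : 0 < (radialMeasure n F).real univ)
    {x₀ : EuclideanSpace ℝ (Fin n)} (hx₀ : x₀ ∈ regularPoints n) :
    ∃ s ∈ 𝓝 x₀, ∃ L : ℝ, ∀ x ∈ s, ∀ x' ∈ regularPoints n, N x - N x' ≤ L * dist x x' := by
  have := isFiniteMeasure_radialMeasure hF
  set ν := radialMeasure n F
  obtain ⟨δ, S, hδ, hS, hsmall⟩ := hp.exists_small_ball_bound hn hF hx₀
  -- a ball of positive mass bounds `N` from below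
  obtain ⟨R, hRx, hRν⟩ : ∃ R : ℝ, ‖x₀‖ + δ < R ∧
      0 < ν.real (ball (0 : EuclideanSpace ℝ (Fin n)) R) := by
    by_contra! hcon
    have h0 : ν univ = 0 := by
      have hU : (univ : Set (EuclideanSpace ℝ (Fin n))) =
          ⋃ k : ℕ, ball 0 (‖x₀‖ + δ + 1 + k) := by
        symm
        rw [eq_univ_iff_forall]
        intro y
        obtain ⟨k, hk⟩ := exists_nat_gt ‖y‖
        exact mem_iUnion.2 ⟨k, by rw [mem_ball_zero_iff]; linarith [norm_nonneg x₀]⟩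
      rw [hU, measure_iUnion_null_iff]
      intro k
      have := hcon (‖x₀‖ + δ + 1 + k) (by have := k.cast_nonneg (α := ℝ); linarith)
      exact (measureReal_eq_zero_iff).1 (le_antisymm this measureReal_nonneg)
    rw [measureReal_def, h0] at hpos
    simp at hpos
  have hR0 : 0 < R := by linarith [norm_nonneg x₀]
  set c₀ := R ^ (-θ) * ν.real (ball (0 : EuclideanSpace ℝ (Fin n)) R) with hc₀
  have hc₀pos : 0 < c₀ := by positivity
  set M := ν.real univ
  -- below the radius `r₂` a ball has value less than `c₀ / 2`
  obtain ⟨r₂, hr₂, hr₂δ, hr₂S⟩ : ∃ r₂ : ℝ, 0 < r₂ ∧ r₂ ≤ δ ∧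
      ∀ r, 0 < r → r < r₂ → S * r ^ (n - θ) < c₀ / 2 := by
    have hcont : ContinuousAt (fun r : ℝ => S * r ^ ((n : ℝ) - θ)) 0 :=
      (Real.continuousAt_rpow_const 0 _ (Or.inr (by linarith))).const_mul S
    have h0 : S * (0 : ℝ) ^ ((n : ℝ) - θ) < c₀ / 2 := by
      rw [Real.zero_rpow (by linarith), mul_zero]; positivity
    obtain ⟨ε, hε, hball⟩ := Metric.eventually_nhds_iff.1 (hcont.eventually (gt_mem_nhds h0))
    refine ⟨min ε δ, lt_min hε hδ, min_le_right _ _, fun r hr hr2 => hball ?_⟩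
    rw [Real.dist_eq, sub_zero, abs_of_pos hr]
    exact hr2.trans_le (min_le_left _ _)
  refine ⟨ball x₀ δ ∩ regularPoints n,
    inter_mem (ball_mem_nhds _ hδ) ((isOpen_regularPoints n).mem_nhds hx₀),
    θ * (r₂ ^ (-θ - 1) * M), fun x hx x' hx' => ?_⟩
  have hNc : c₀ ≤ N x := by
    refine (hN x hx.2).1 ⟨0, R, hR0, ?_, rfl⟩
    have h1 := hx.1
    rw [mem_ball, dist_eq_norm] at h1
    rw [mem_ball_zero_iff]
    have h2 := norm_sub_norm_le x x₀
    linarith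
  refine isLUB_ballValues_sub_le hθ.le (hN x hx.2) (hN x' hx') (hc₀pos.trans_le hNc)
    fun z r hr hxz hopt => ?_
  have hrr : r₂ ≤ r := by
    by_contra! hlt
    have h1 := hsmall x hx.1 z r hr (hlt.le.trans hr₂δ) hxz
    have h2 := hr₂S r hr hlt
    have h3 : r ^ (-θ) * ν.real (ball z r) ≤ S * r ^ (n - θ) := by
      calc _ ≤ r ^ (-θ) * (S * r ^ n) := by gcongr
        _ = _ := by
          rw [Real.rpow_sub hr, Real.rpow_natCast, Real.rpow_neg hr.le]; field_simp
    linarith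
  have h4 : r ^ (-θ - 1) ≤ r₂ ^ (-θ - 1) := Real.rpow_le_rpow_of_nonpos hr₂ hrr (by linarith)
  have h5 : ν.real (ball z r) ≤ M := measureReal_mono (subset_univ _)
  gcongr

/-- The pointwise gradient bound for the supremum `N` over balls: its `q`-th power, `q = n / θ`, is
controlled by the radial potential. Stated as a one-sided Lipschitz bound at `x`. -/
theorem exists_gradient_bound {n : ℕ} (hn : 0 < n) {θ : ℝ} (hθ : 0 < θ) (hθn : θ < n) :
    ∃ C : ℝ, 0 < C ∧ ∀ (F : ℝ → ℝ) (h : ℝ → ℝ≥0∞), RadialProfile n F h →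
      ∫⁻ y : EuclideanSpace ℝ (Fin n), ENNReal.ofReal (F ‖y‖) ≠ ⊤ →
      ∀ N : EuclideanSpace ℝ (Fin n) → ℝ,
      (∀ x ∈ regularPoints n, IsLUB (ballValues (radialMeasure n F) θ x) (N x)) →
      ∀ x, x ≠ 0 → radialPotential n F h ‖x‖ ≠ ⊤ → ∀ x' ∈ regularPoints n,
        N x - N x' ≤ (C * (radialEnergy n h).toReal ^ (n / θ - 1) *
          ((radialPotential n F h ‖x‖).toReal / ‖x‖ ^ (n - 1))) ^ (θ / n) * dist x x' := by
  obtain ⟨C, hC, hbound⟩ := exists_nearly_optimal_bound hn hθn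
  have hn0 : (0 : ℝ) < n := by exact_mod_cast hn
  refine ⟨θ ^ (n / θ) * C ^ (n / θ), by positivity, fun F h hp hF N hN x hx hΦ x' hx' => ?_⟩
  have := isFiniteMeasure_radialMeasure hF
  set ν := radialMeasure n F with hν
  set E := (radialEnergy n h).toReal with hE
  set P := (radialPotential n F h ‖x‖).toReal with hP
  have hE0 : 0 ≤ E := ENNReal.toReal_nonneg
  have hP0 : 0 ≤ P := ENNReal.toReal_nonneg
  have hρ : 0 < ‖x‖ := norm_pos_iff.2 hx
  have hxr : x ∈ regularPoints n := Or.inl hx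
  have hnonneg : ∀ y ∈ regularPoints n, 0 ≤ N y := fun y hy => by
    refine le_trans ?_ ((hN y hy).1 ⟨y, 1, one_pos, mem_ball_self one_pos, rfl⟩)
    positivity
  rcases (hnonneg x hxr).eq_or_lt with h0 | hpos
  · rw [← h0, zero_sub]
    have := hnonneg x' hx'
    refine le_trans (neg_nonpos.2 this) (by positivity)
  set L := (C ^ (n / θ) * E ^ (n / θ - 1) * (P / ‖x‖ ^ (n - 1))) ^ (θ / n) with hL
  have hmain : N x - N x' ≤ θ * L * dist x x' := by
    refine isLUB_ballValues_sub_le hθ.le (hN x hxr) (hN x' hx') hpos fun z r hr hxz hopt => ?_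
    set m := ν.real (ball z r) with hm
    have hm0 : 0 < m := by
      by_contra! hle
      have : r ^ (-θ) * m ≤ 0 := mul_nonpos_of_nonneg_of_nonpos (by positivity) hle
      linarith
    have hmB : ∀ w R, ∫⁻ y in ball w R, ENNReal.ofReal (F ‖y‖) =
        ENNReal.ofReal (ν.real (ball w R)) := by
      intro w R
      rw [ofReal_measureReal, hν, radialMeasure_ball]
    obtain ⟨h1, h2⟩ := hbound F h hp x z r m hr hxz hm0 (hmB z r) (by
      intro w R hR hxw
      rw [hmB]
      refine ENNReal.ofReal_le_ofReal ?_
      have h1 : R ^ (-θ) * ν.real (ball w R) ≤ N x := (hN x hxr).1 ⟨w, R, hR, hxw, rfl⟩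
      have h2 : R ^ (-θ) * ν.real (ball w R) ≤ 2 * (r ^ (-θ) * m) := by linarith
      rw [Real.rpow_neg hR.le, Real.rpow_neg hr.le, inv_mul_le_iff₀ (by positivity)] at h2
      rw [Real.div_rpow hR.le hr.le]
      refine h2.trans (le_of_eq ?_)
      field_simp)
    rw [← ENNReal.ofReal_toReal hΦ, ← ENNReal.ofReal_mul (by positivity),
      ENNReal.ofReal_le_ofReal_iff (by positivity)] at h1
    rw [← ENNReal.ofReal_toReal hp.radialEnergy_ne_top, ← ENNReal.ofReal_mul (by positivity),
      ENNReal.ofReal_le_ofReal_iff (by positivity)] at h2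
    have h3 := rpow_gradient_bound hθ hθn.le hm0 hr hρ hC.le hE0 h1 h2
    rw [hL, ← Real.rpow_le_rpow_iff (z := n / θ) (by positivity) (by positivity) (by positivity),
      ← Real.rpow_mul (by positivity)]
    have : θ / n * (n / θ) = 1 := by field_simp
    rwa [this, Real.rpow_one]
  refine hmain.trans (le_of_eq ?_)
  congr 1
  have e1 : θ = (θ ^ (n / θ)) ^ (θ / n) := by
    rw [← Real.rpow_mul hθ.le]
    have : n / θ * (θ / n) = 1 := by field_simp
    rw [this, Real.rpow_one]
  rw [hL]
  nth_rewrite 1 [e1]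
  rw [← Real.mul_rpow (by positivity) (by positivity)]
  congr 1; ring

end RadialProfile

/-! ### Integration by parts across the origin -/

/-- A local one-sided Lipschitz bound against all points of `U` gives a Lipschitz bound on compact
subsets of `U`. -/
theorem exists_lipschitzOnWith_of_local {n : ℕ} {u : EuclideanSpace ℝ (Fin n) → ℝ}
    {U K : Set (EuclideanSpace ℝ (Fin n))}
    (hu : ∀ x₀ ∈ U, ∃ s ∈ 𝓝 x₀, ∃ L : ℝ, ∀ x ∈ s, ∀ x' ∈ U, u x - u x' ≤ L * dist x x')
    (hK : IsCompact K) (hKU : K ⊆ U) : ∃ L : NNReal, LipschitzOnWith L u K := by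
  have key : ∃ L : ℝ, ∀ x ∈ K, ∀ x' ∈ U, u x - u x' ≤ L * dist x x' := by
    refine hK.induction_on (p := fun s => ∃ L : ℝ, ∀ x ∈ s, ∀ x' ∈ U, u x - u x' ≤ L * dist x x')
      ⟨0, by simp⟩ (fun s t hst ⟨L, hL⟩ => ⟨L, fun x hx => hL x (hst hx)⟩) ?_ ?_
    · rintro s t ⟨L, hL⟩ ⟨L', hL'⟩
      refine ⟨max L L', fun x hx x' hx' => ?_⟩
      rcases hx with hx | hx
      · exact (hL x hx x' hx').trans (by gcongr; exact le_max_left _ _)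
      · exact (hL' x hx x' hx').trans (by gcongr; exact le_max_right _ _)
    · intro x hx
      obtain ⟨s, hs, L, hL⟩ := hu x (hKU hx)
      exact ⟨s, mem_nhdsWithin_of_mem_nhds hs, L, hL⟩
  obtain ⟨L, hL⟩ := key
  refine ⟨L.toNNReal, LipschitzOnWith.of_dist_le_mul fun x hx y hy => ?_⟩
  have h1 : L * dist x y ≤ L.toNNReal * dist x y := by
    gcongr; exact Real.le_coe_toNNReal L
  rw [Real.dist_eq, abs_le]
  constructor
  · have := hL y hy x (hKU hx)
    rw [dist_comm] at this
    linarith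
  · have := hL x hx y (hKU hy)
    linarith

theorem continuousOn_of_local {n : ℕ} {u : EuclideanSpace ℝ (Fin n) → ℝ}
    {U : Set (EuclideanSpace ℝ (Fin n))} (hU : IsOpen U)
    (hu : ∀ x₀ ∈ U, ∃ s ∈ 𝓝 x₀, ∃ L : ℝ, ∀ x ∈ s, ∀ x' ∈ U, u x - u x' ≤ L * dist x x') :
    ContinuousOn u U := by
  intro x hx
  obtain ⟨K, hK, hxK, hKU⟩ := exists_compact_subset hU hx
  obtain ⟨L, hL⟩ := exists_lipschitzOnWith_of_local hu hK hKU
  exact (hL.continuousOn.continuousAt (mem_interior_iff_mem_nhds.1 hxK)).continuousWithinAt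

/-- Integration by parts for a locally Lipschitz function on `U` against a test function supported
in `U`: near the support the function agrees with a globally Lipschitz one. -/
theorem integral_mul_fderiv_eq_of_tsupport_subset {n : ℕ} {u : EuclideanSpace ℝ (Fin n) → ℝ}
    {U : Set (EuclideanSpace ℝ (Fin n))} (hU : IsOpen U)
    (hu : ∀ x₀ ∈ U, ∃ s ∈ 𝓝 x₀, ∃ L : ℝ, ∀ x ∈ s, ∀ x' ∈ U, u x - u x' ≤ L * dist x x')
    {ψ : EuclideanSpace ℝ (Fin n) → ℝ} (hψ : ContDiff ℝ ∞ ψ) (hψc : HasCompactSupport ψ)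
    (hψU : tsupport ψ ⊆ U) (v : EuclideanSpace ℝ (Fin n)) :
    ∫ x, u x * fderiv ℝ ψ x v = -∫ x, fderiv ℝ u x v * ψ x := by
  obtain ⟨K, hK, hψK, hKU⟩ := exists_compact_between hψc.isCompact hU hψU
  obtain ⟨L, hL⟩ := exists_lipschitzOnWith_of_local hu hK hKU
  obtain ⟨w, hw, huw⟩ := hL.extend_real
  obtain ⟨D, hD⟩ := hψ.lipschitzWith_of_hasCompactSupport hψc (by simp)
  have hev : ∀ x ∈ tsupport ψ, u =ᶠ[𝓝 x] w := fun x hx => by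
    filter_upwards [mem_interior_iff_mem_nhds.1 (hψK hx)] with y hy using huw hy
  have main := hw.integral_lineDeriv_mul_eq (μ := volume) hD hψc v
  have e1 : ∫ x, lineDeriv ℝ w x v * ψ x = ∫ x, fderiv ℝ u x v * ψ x := by
    refine integral_congr_ae ?_
    filter_upwards [hw.ae_differentiableAt (μ := volume)] with x hx
    by_cases hxs : x ∈ tsupport ψ
    · rw [hx.lineDeriv_eq_fderiv, (hev x hxs).fderiv_eq]
    · rw [image_eq_zero_of_notMem_tsupport hxs, mul_zero, mul_zero]
  have e2 : ∫ x, lineDeriv ℝ ψ x (-v) * w x = -∫ x, u x * fderiv ℝ ψ x v := by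
    rw [← integral_neg]
    refine integral_congr_ae (ae_of_all _ fun x => ?_)
    have hdiff : DifferentiableAt ℝ ψ x := (hψ.differentiable (by simp)) x
    simp only
    rw [hdiff.lineDeriv_eq_fderiv, map_neg]
    by_cases hxs : x ∈ tsupport ψ
    · rw [(hev x hxs).eq_of_nhds]; ring
    · have : fderiv ℝ ψ x = 0 := by
        by_contra hne
        exact hxs (support_fderiv_subset ℝ hne)
      simp [this]
  rw [← e1, main, e2, neg_neg]

/-- Integration by parts extends across the origin if the integral of `|u|` over `B(0, R)` is
`o(R)`: the gradient of a cut-off at the scale `R` has size `1 / R`. -/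
theorem integral_mul_fderiv_eq_of_tendsto {n : ℕ} (hn : 0 < n) {u : EuclideanSpace ℝ (Fin n) → ℝ}
    (hu : ∀ x₀ ∈ ({0}ᶜ : Set (EuclideanSpace ℝ (Fin n))), ∃ s ∈ 𝓝 x₀, ∃ L : ℝ, ∀ x ∈ s,
      ∀ x' ∈ ({0}ᶜ : Set (EuclideanSpace ℝ (Fin n))), u x - u x' ≤ L * dist x x')
    (hui : LocallyIntegrable u) (hG : LocallyIntegrable (fderiv ℝ u))
    (hlim : Tendsto (fun k : ℕ => (k + 1 : ℝ) *
      ∫ x in ball (0 : EuclideanSpace ℝ (Fin n)) (2 / (k + 1)), |u x|) atTop (𝓝 0))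
    {φ : EuclideanSpace ℝ (Fin n) → ℝ} (hφ : ContDiff ℝ ∞ φ) (hφc : HasCompactSupport φ)
    (v : EuclideanSpace ℝ (Fin n)) :
    ∫ x, u x * fderiv ℝ φ x v = -∫ x, fderiv ℝ u x v * φ x := by
  let b : ContDiffBump (0 : EuclideanSpace ℝ (Fin n)) := ⟨1, 2, one_pos, one_lt_two⟩
  have hb : ContDiff ℝ ∞ b := b.contDiff
  obtain ⟨D, hD⟩ := hb.lipschitzWith_of_hasCompactSupport b.hasCompactSupport (by simp)
  set bk : ℕ → EuclideanSpace ℝ (Fin n) → ℝ := fun k x => b ((k + 1 : ℝ) • x) with hbk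
  have hbkd : ∀ k, ContDiff ℝ ∞ (bk k) := fun k => hb.comp (contDiff_const_smul _)
  have hk0 : ∀ k : ℕ, (0 : ℝ) < k + 1 := fun k => by positivity
  have hbk01 : ∀ k x, |1 - bk k x| ≤ 1 := fun k x => by
    have h1 := b.nonneg' ((k + 1 : ℝ) • x)
    have h2 := b.le_one (x := (k + 1 : ℝ) • x)
    rw [abs_le]; constructor <;> simp only [hbk] <;> linarith
  have hbk0 : ∀ (k : ℕ) x, 2 / (k + 1 : ℝ) ≤ ‖x‖ → bk k x = 0 := fun k x hx => by
    refine b.zero_of_le_dist ?_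
    rw [dist_zero_right, norm_smul, Real.norm_eq_abs, abs_of_pos (hk0 k)]
    rwa [div_le_iff₀' (hk0 k)] at hx
  have hlip : ∀ k x, |fderiv ℝ (bk k) x v| ≤ D * (k + 1) * ‖v‖ := fun k x => by
    have h1 : LipschitzWith (D * ‖(k + 1 : ℝ)‖₊) (bk k) := hD.comp (lipschitzWith_smul (k + 1 : ℝ))
    have h2 := norm_fderiv_le_of_lipschitz ℝ h1 (x₀ := x)
    refine ((fderiv ℝ (bk k) x).le_opNorm v).trans ?_
    gcongr
    refine h2.trans (le_of_eq ?_)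
    push_cast
    rw [Real.norm_eq_abs, abs_of_pos (hk0 k)]
  have hlip0 : ∀ (k : ℕ) x, 2 / (k + 1 : ℝ) < ‖x‖ → fderiv ℝ (bk k) x = 0 := fun k x hx => by
    have : bk k =ᶠ[𝓝 x] fun _ => 0 := by
      filter_upwards [continuous_norm.continuousAt.eventually (lt_mem_nhds hx)] with y hy
      exact hbk0 k y hy.le
    rw [this.fderiv_eq]; simp
  have hφint : Integrable fun x => u x * fderiv ℝ φ x v := by
    have := hui.integrable_smul_right_of_hasCompactSupport
      (g := fun x => fderiv ℝ φ x v) ((hφ.continuous_fderiv (by simp)).clm_apply continuous_const)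
      (hφc.fderiv_apply ℝ v)
    simpa [mul_comm] using this
  have hGint : Integrable fun x => fderiv ℝ u x v * φ x := by
    have := (hG.integrable_smul_left_of_hasCompactSupport hφ.continuous hφc)
    have h2 := this.apply_continuousLinearMap v
    simpa [mul_comm] using h2
  have hbkm : ∀ k, Continuous (bk k) := fun k => (hbkd k).continuous
  -- integration by parts with the cut-off test function
  have hparts : ∀ k, (∫ x, (1 - bk k x) * (u x * fderiv ℝ φ x v)) -
      ∫ x, u x * (φ x * fderiv ℝ (bk k) x v) =
      -∫ x, (1 - bk k x) * (fderiv ℝ u x v * φ x) := by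
    intro k
    have hψ : ContDiff ℝ ∞ fun x => φ x * (1 - bk k x) := hφ.mul (contDiff_const.sub (hbkd k))
    have hψc : HasCompactSupport fun x => φ x * (1 - bk k x) := hφc.mul_right
    have h1 := integral_mul_fderiv_eq_of_tsupport_subset isOpen_compl_singleton hu hψ hψc (by
      intro x hx hx0
      rw [mem_singleton_iff] at hx0
      subst hx0
      refine notMem_tsupport_iff_eventuallyEq.2 ?_ hx
      filter_upwards [ball_mem_nhds (0 : EuclideanSpace ℝ (Fin n))
        (show 0 < 1 / (k + 1 : ℝ) by have := hk0 k; positivity)] with y hy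
      have : bk k y = 1 := by
        refine b.one_of_mem_closedBall ?_
        rw [mem_ball_zero_iff, lt_div_iff₀' (hk0 k)] at hy
        rw [mem_closedBall_zero_iff, norm_smul, Real.norm_eq_abs, abs_of_pos (hk0 k)]
        exact hy.le
      simp [this]) v
    have h2 : ∀ x, fderiv ℝ (fun x => φ x * (1 - bk k x)) x v =
        (1 - bk k x) * fderiv ℝ φ x v - φ x * fderiv ℝ (bk k) x v := by
      intro x
      have d1 : DifferentiableAt ℝ φ x := hφ.differentiable (by simp) x
      have d2 : DifferentiableAt ℝ (bk k) x := (hbkd k).differentiable (by simp) x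
      rw [fderiv_fun_mul d1 (d2.const_sub 1), fderiv_const_sub]
      simp
      ring
    have i1 : Integrable fun x => (1 - bk k x) * (u x * fderiv ℝ φ x v) :=
      hφint.bdd_mul (c := 1) (continuous_const.sub (hbkm k)).aestronglyMeasurable
        (ae_of_all _ fun x => hbk01 k x)
    have i2 : Integrable fun x => u x * (φ x * fderiv ℝ (bk k) x v) := by
      have := hui.integrable_smul_right_of_hasCompactSupport
        (g := fun x => φ x * fderiv ℝ (bk k) x v)
        (hφ.continuous.mul (((hbkd k).continuous_fderiv (by simp)).clm_apply continuous_const))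
        hφc.mul_right
      simpa [mul_comm] using this
    rw [← integral_sub i1 i2]
    calc _ = ∫ x, u x * fderiv ℝ (fun x => φ x * (1 - bk k x)) x v := by
          refine integral_congr_ae (ae_of_all _ fun x => ?_)
          simp only [h2]; ring
      _ = _ := h1
      _ = _ := by
          congr 1
          refine integral_congr_ae (ae_of_all _ fun x => ?_)
          simp only; ring
  have hae : ∀ᵐ x : EuclideanSpace ℝ (Fin n), ∀ᶠ k : ℕ in atTop, bk k x = 0 := by
    filter_upwards [ae_ne_zero hn] with x hx
    have h1 : Tendsto (fun k : ℕ => 2 / (k + 1 : ℝ)) atTop (𝓝 0) :=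
      tendsto_const_div_atTop_nhds_zero_nat (𝕜 := ℝ) 2 |>.comp (tendsto_add_atTop_nat 1) |>.congr
        (by intro k; simp)
    filter_upwards [h1.eventually (gt_mem_nhds (norm_pos_iff.2 hx))] with k hk
    exact hbk0 k x hk.le
  have hconv : ∀ g : EuclideanSpace ℝ (Fin n) → ℝ, Integrable g →
      Tendsto (fun k => ∫ x, (1 - bk k x) * g x) atTop (𝓝 (∫ x, g x)) := by
    intro g hg
    refine tendsto_integral_of_dominated_convergence (fun x => ‖g x‖)
      (fun k => ((continuous_const.sub (hbkm k)).aestronglyMeasurable).mul hg.aestronglyMeasurable)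
      hg.norm (fun k => ae_of_all _ fun x => ?_) ?_
    · rw [norm_mul]
      exact mul_le_of_le_one_left (norm_nonneg _) (hbk01 k x)
    · filter_upwards [hae] with x hx
      refine tendsto_const_nhds.congr' ?_
      filter_upwards [hx] with k hk
      simp [hk]
  obtain ⟨B, hB⟩ := hφc.exists_bound_of_continuous hφ.continuous
  have hB0 : 0 ≤ B := (norm_nonneg _).trans (hB 0)
  have herr : Tendsto (fun k => ∫ x, u x * (φ x * fderiv ℝ (bk k) x v)) atTop (𝓝 0) := by
    refine squeeze_zero_norm (a := fun k : ℕ => B * D * ‖v‖ * ((k + 1 : ℝ) *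
      ∫ x in ball (0 : EuclideanSpace ℝ (Fin n)) (2 / (k + 1)), |u x|)) (fun k => ?_) ?_
    swap
    · simpa using hlim.const_mul (B * D * ‖v‖)
    have hR : IntegrableOn u (closedBall 0 (2 / (k + 1 : ℝ))) :=
      hui.integrableOn_isCompact (isCompact_closedBall _ _)
    have hae2 : ball (0 : EuclideanSpace ℝ (Fin n)) (2 / (k + 1 : ℝ)) =ᵐ[volume]
        closedBall 0 (2 / (k + 1 : ℝ)) := by
      refine (ball_subset_closedBall.eventuallyLE).antisymm ?_
      rw [ae_le_set, closedBall_sdiff_ball]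
      exact Measure.addHaar_sphere_of_ne_zero _ _ (by have := hk0 k; positivity)
    rw [setIntegral_congr_set hae2]
    have h1 : ∀ x, ‖u x * (φ x * fderiv ℝ (bk k) x v)‖ ≤
        (closedBall (0 : EuclideanSpace ℝ (Fin n)) (2 / (k + 1 : ℝ))).indicator
          (fun x => B * D * ‖v‖ * (k + 1) * |u x|) x := by
      intro x
      by_cases hx : x ∈ closedBall (0 : EuclideanSpace ℝ (Fin n)) (2 / (k + 1 : ℝ))
      · rw [indicator_of_mem hx, norm_mul, norm_mul, Real.norm_eq_abs (u x)]
        calc |u x| * (‖φ x‖ * ‖fderiv ℝ (bk k) x v‖) ≤ |u x| * (B * (D * (k + 1) * ‖v‖)) := by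
              gcongr
              · exact hB x
              · exact hlip k x
          _ = _ := by ring
      · rw [indicator_of_notMem hx]
        rw [mem_closedBall_zero_iff, not_le] at hx
        simp [hlip0 k x hx]
    calc _ ≤ ∫ x, (closedBall (0 : EuclideanSpace ℝ (Fin n)) (2 / (k + 1 : ℝ))).indicator
          (fun x => B * D * ‖v‖ * (k + 1) * |u x|) x :=
          norm_integral_le_of_norm_le ((integrable_indicator_iff measurableSet_closedBall).2
            (hR.abs.const_mul _)) (ae_of_all _ h1)
      _ = _ := by
          rw [integral_indicator measurableSet_closedBall, integral_const_mul]; ring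
  have t1 := (hconv _ hφint).sub herr
  have t2 := (hconv _ hGint).neg
  rw [sub_zero] at t1
  exact tendsto_nhds_unique t1 (t2.congr fun k => (hparts k).symm)

/-! ### The gradient of the maximal function of a radial profile -/

/-- A one-sided bound suffices, as the derivative is linear. At points where `u` is not
differentiable `fderiv` is `0` and there is nothing to show. -/
theorem norm_fderiv_le_of_sub_le {n : ℕ} {u : EuclideanSpace ℝ (Fin n) → ℝ}
    {x : EuclideanSpace ℝ (Fin n)} {L : ℝ} (hL : 0 ≤ L)
    (h : ∀ᶠ x' in 𝓝 x, u x - u x' ≤ L * dist x x') : ‖fderiv ℝ u x‖ ≤ L := by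
  by_cases hd : DifferentiableAt ℝ u x
  swap
  · rw [fderiv_zero_of_not_differentiableAt hd, norm_zero]; exact hL
  have key : ∀ v, -(fderiv ℝ u x v) ≤ L * ‖v‖ := by
    intro v
    have h1 : HasLineDerivAt ℝ u (fderiv ℝ u x v) x v := hd.hasFDerivAt.hasLineDerivAt v
    have h2 := h1.tendsto_slope_zero_right
    have h3 : ∀ᶠ t : ℝ in 𝓝[>] 0, u x - u (x + t • v) ≤ L * dist x (x + t • v) := by
      have hc : Tendsto (fun t : ℝ => x + t • v) (𝓝[>] 0) (𝓝 x) := by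
        have : Continuous fun t : ℝ => x + t • v := by fun_prop
        simpa using (this.tendsto 0).mono_left nhdsWithin_le_nhds
      exact hc.eventually h
    have h4 : -(L * ‖v‖) ≤ fderiv ℝ u x v := by
      refine ge_of_tendsto h2 ?_
      filter_upwards [h3, self_mem_nhdsWithin] with t ht ht0
      have ht0 : 0 < t := ht0
      rw [dist_self_add_right, norm_smul, Real.norm_eq_abs, abs_of_pos ht0] at ht
      rw [smul_eq_mul, le_inv_mul_iff₀ ht0]
      nlinarith
    linarith
  refine ContinuousLinearMap.opNorm_le_bound _ hL fun v => ?_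
  rw [Real.norm_eq_abs, abs_le']
  have h1 := key v
  have h2 := key (-v)
  rw [map_neg, neg_neg, norm_neg] at h2
  exact ⟨h2, h1⟩

theorem lintegral_ball_le_of_growth {n : ℕ} (hn : 0 < n) {u : EuclideanSpace ℝ (Fin n) → ℝ}
    {θ C τ : ℝ} (hθn : θ < n) (hC : 0 ≤ C) (hτ : 0 < τ)
    (hτv : (volume : Measure (EuclideanSpace ℝ (Fin n))).toSphere univ = ENNReal.ofReal τ)
    (hu : ∀ x, x ≠ 0 → u x ≤ C * (‖x‖ ^ (1 - θ) + 1)) {R : ℝ} (hR : 0 < R) :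
    ∫⁻ x in ball (0 : EuclideanSpace ℝ (Fin n)) R, ENNReal.ofReal (u x) ≤
      ENNReal.ofReal (τ * C * (R ^ (n - θ) + R ^ (n - 1)) * R) := by
  have hm : Measurable ((Iio R).indicator fun t : ℝ =>
      ENNReal.ofReal (C * (t ^ (1 - θ) + 1))) :=
    (((measurable_id.pow_const (1 - θ)).add_const 1).const_mul C).ennreal_ofReal.indicator
      measurableSet_Iio
  calc _ ≤ ∫⁻ x : EuclideanSpace ℝ (Fin n), (Iio R).indicator (fun t : ℝ =>
          ENNReal.ofReal (C * (t ^ (1 - θ) + 1))) ‖x‖ := by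
        rw [← lintegral_indicator measurableSet_ball]
        refine lintegral_mono_ae ?_
        filter_upwards [ae_ne_zero hn] with x hx
        by_cases hxR : ‖x‖ < R
        · rw [indicator_of_mem (show x ∈ ball 0 R by simpa using hxR),
            indicator_of_mem (show ‖x‖ ∈ Iio R from hxR)]
          exact ENNReal.ofReal_le_ofReal (hu x hx)
        · rw [indicator_of_notMem (show x ∉ ball 0 R by simpa using hxR)]
          exact zero_le
    _ = ENNReal.ofReal τ * ∫⁻ t in Ioi (0 : ℝ), ENNReal.ofReal (t ^ (n - 1)) *
          (Iio R).indicator (fun t : ℝ => ENNReal.ofReal (C * (t ^ (1 - θ) + 1))) t := by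
        rw [lintegral_radial hn hm, hτv]
    _ ≤ ENNReal.ofReal τ * ∫⁻ t in Ioi (0 : ℝ), (Iio R).indicator
          (fun _ : ℝ => ENNReal.ofReal (C * (R ^ (n - θ) + R ^ (n - 1)))) t := by
        refine mul_le_mul_right (setLIntegral_mono' measurableSet_Ioi fun t ht => ?_) _
        have ht : 0 < t := ht
        by_cases htR : t < R
        · have htI : t ∈ Iio R := htR
          rw [indicator_of_mem htI, indicator_of_mem htI,
            ← ENNReal.ofReal_mul (by positivity)]
          refine ENNReal.ofReal_le_ofReal ?_
          have e1 : t ^ (n - 1) * t ^ (1 - θ) = t ^ (n - θ) := by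
            rw [← Real.rpow_natCast t (n - 1), ← Real.rpow_add ht, Nat.cast_sub hn]
            congr 1; push_cast; ring
          have e2 : t ^ (n - θ) ≤ R ^ (n - θ) :=
            Real.rpow_le_rpow ht.le htR.le (by linarith)
          have e3 : t ^ (n - 1) ≤ R ^ (n - 1) := by gcongr
          calc _ = C * (t ^ (n - 1) * t ^ (1 - θ) + t ^ (n - 1)) := by ring
            _ ≤ _ := by rw [e1]; gcongr
        · simp [htR]
    _ = _ := by
        rw [lintegral_indicator_const measurableSet_Iio, Measure.restrict_apply measurableSet_Iio,
          inter_comm, Ioi_inter_Iio, Real.volume_Ioo, sub_zero,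
          ← ENNReal.ofReal_mul (by positivity), ← ENNReal.ofReal_mul hτ.le]
        congr 1; ring

/-- The weight `|x|^{1-n}` turns the integral over `ℝⁿ` into the integral of the potential over
`(0, ∞)`. -/
theorem lintegral_potential_weight_le {n : ℕ} (hn : 0 < n) {F : ℝ → ℝ} {h : ℝ → ℝ≥0∞}
    (hp : RadialProfile n F h) {τ : ℝ} (hτ : 0 < τ)
    (hτv : (volume : Measure (EuclideanSpace ℝ (Fin n))).toSphere univ = ENNReal.ofReal τ) :
    ∫⁻ x : EuclideanSpace ℝ (Fin n), radialPotential n F h ‖x‖ *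
      (ENNReal.ofReal (‖x‖ ^ (n - 1)))⁻¹ ≤
      ENNReal.ofReal (τ * (2 * Real.pi)) * radialEnergy n h := by
  have hm : Measurable fun t : ℝ => radialPotential n F h t * (ENNReal.ofReal (t ^ (n - 1)))⁻¹ :=
    hp.measurable_radialPotential.mul (measurable_id.pow_const _).ennreal_ofReal.inv
  rw [lintegral_radial hn hm, hτv, ENNReal.ofReal_mul hτ.le, mul_assoc]
  refine mul_le_mul_right (le_trans ?_ hp.lintegral_radialPotential_le) _
  refine le_trans (le_of_eq ?_) (setLIntegral_le_lintegral (Ioi 0) _)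
  refine setLIntegral_congr_fun measurableSet_Ioi fun t ht => ?_
  have ht : 0 < t := ht
  have h0 : ENNReal.ofReal (t ^ (n - 1)) ≠ 0 := by
    simpa using pow_pos ht _
  rw [mul_left_comm, ENNReal.mul_inv_cancel h0 ENNReal.ofReal_ne_top, mul_one]

/-- The maximal function of a radial profile is weakly differentiable and its gradient is controlled
by the radial energy. -/
theorem exists_weakGradient_bound {n : ℕ} (hn : 0 < n) {β : ℝ} (hβ : 0 < β) (hβn : β < n) :
    ∃ C : ℝ, 0 < C ∧ ∀ (F : ℝ → ℝ) (h : ℝ → ℝ≥0∞), RadialProfile n F h →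
      ∫⁻ y : EuclideanSpace ℝ (Fin n), ENNReal.ofReal (F ‖y‖) ≠ ⊤ →
      ∀ U : EuclideanSpace ℝ (Fin n) → ℝ≥0∞, U = fracMaximal β (fun y => F ‖y‖) →
      (∀ᵐ x, U x < ⊤) ∧ ∃ G : EuclideanSpace ℝ (Fin n) → EuclideanSpace ℝ (Fin n),
        HasWeakGradient (fun x => (U x).toReal) G ∧
        eLpNorm G (ENNReal.ofReal ((n : ℝ) / ((n : ℝ) - β))) volume ≤
          ENNReal.ofReal C * radialEnergy n h := by
  set θ : ℝ := n - β with hθdef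
  have hθ : 0 < θ := by rw [hθdef]; linarith
  have hθn : θ < n := by rw [hθdef]; linarith
  set q : ℝ := n / θ with hq
  have hn0 : (0 : ℝ) < n := by exact_mod_cast hn
  have hq0 : 0 < q := by positivity
  have hq1 : 1 ≤ q := (one_le_div hθ).2 hθn.le
  obtain ⟨C, hC, hgrad⟩ := RadialProfile.exists_gradient_bound hn hθ hθn
  obtain ⟨κ, hκ, hκv⟩ := exists_pos_volume_unitBall n
  obtain ⟨τ, hτ, hτv⟩ := exists_pos_toSphere hn
  refine ⟨κ⁻¹ * (C * τ * (2 * Real.pi)) ^ (1 / q), by positivity, ?_⟩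
  intro F h hp hF U hU
  set E := (radialEnergy n h).toReal with hE
  have hE0 : 0 ≤ E := ENNReal.toReal_nonneg
  have hEe : radialEnergy n h = ENNReal.ofReal E := (ENNReal.ofReal_toReal hp.energy).symm
  have hfe : (fun y : EuclideanSpace ℝ (Fin n) => ‖F ‖y‖‖ₑ) = fun y => ENNReal.ofReal (F ‖y‖) := by
    funext y; exact Real.enorm_of_nonneg (hp.nonneg _)
  have hfin : ∫⁻ y : EuclideanSpace ℝ (Fin n), ‖F ‖y‖‖ₑ ≠ ⊤ := by rwa [hfe]
  have hν : (volume.withDensity fun y : EuclideanSpace ℝ (Fin n) => ‖F ‖y‖‖ₑ) =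
      radialMeasure n F := by rw [hfe]; rfl
  obtain ⟨B, hB, hgrowth⟩ := hp.exists_ballValues_le hn hF hθ hθn
  have hlub : ∀ x ∈ regularPoints n, U x < ⊤ ∧
      IsLUB (ballValues (radialMeasure n F) θ x) (κ * (U x).toReal) := by
    intro x hx
    have := fracMaximal_isLUB hκ hκv hfin (β := β) (x := x)
      (by rw [hν]; exact ⟨_, fun a ha => hgrowth x hx a ha⟩)
    rwa [hν, ← hU] at this
  set u : EuclideanSpace ℝ (Fin n) → ℝ := fun x => (U x).toReal with hu
  have hu0 : ∀ x, 0 ≤ u x := fun x => ENNReal.toReal_nonneg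
  have hN : ∀ x ∈ regularPoints n,
      IsLUB (ballValues (radialMeasure n F) θ x) ((fun x => κ * u x) x) :=
    fun x hx => (hlub x hx).2
  have huB : ∀ x, x ≠ 0 → u x ≤ (κ⁻¹ * B) * (‖x‖ ^ (1 - θ) + 1) := by
    intro x hx
    have h1 : κ * u x ≤ B * (‖x‖ ^ (1 - θ) + 1) :=
      (hN x (Or.inl hx)).2 fun a ha => hgrowth x (Or.inl hx) a ha
    rw [mul_assoc, le_inv_mul_iff₀ hκ]
    exact h1
  have hmono : ∀ x x' (L : ℝ), κ * u x - κ * u x' ≤ L * dist x x' →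
      u x - u x' ≤ (κ⁻¹ * L) * dist x x' := by
    intro x x' L hL
    rw [mul_assoc, le_inv_mul_iff₀ hκ, mul_sub]
    exact hL
  have hlip : ∀ x₀ ∈ regularPoints n, ∃ s ∈ 𝓝 x₀, ∃ L : ℝ, ∀ x ∈ s, ∀ x' ∈ regularPoints n,
      u x - u x' ≤ L * dist x x' := by
    intro x₀ hx₀
    have := RadialProfile.isFiniteMeasure_radialMeasure hF
    rcases (measureReal_nonneg (μ := radialMeasure n F) (s := univ)).eq_or_lt with h0 | hpos
    · refine ⟨regularPoints n, (isOpen_regularPoints n).mem_nhds hx₀, 0, fun x hx x' hx' => ?_⟩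
      have h1 : κ * u x ≤ 0 := (hN x hx).2 (by
        rintro _ ⟨z, r, hr, -, rfl⟩
        have : (radialMeasure n F).real (ball z r) = 0 :=
          le_antisymm ((measureReal_mono (subset_univ _)).trans h0.ge) measureReal_nonneg
        rw [this, mul_zero])
      have h2 : u x ≤ 0 := by
        by_contra! hlt
        have := mul_pos hκ hlt
        linarith
      linarith [hu0 x']
    · obtain ⟨s, hs, L, hL⟩ := hp.exists_local_lipschitz hn hF hθ hθn hN hpos hx₀
      exact ⟨s, hs, κ⁻¹ * L, fun x hx x' hx' => hmono x x' L (hL x hx x' hx')⟩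
  have hcont := continuousOn_of_local (isOpen_regularPoints n) hlip
  have hreg : ∀ᵐ x : EuclideanSpace ℝ (Fin n), x ∈ regularPoints n := by
    filter_upwards [ae_ne_zero hn] with x hx using Or.inl hx
  have hum : AEStronglyMeasurable u volume := by
    have h1 := hcont.aestronglyMeasurable (μ := volume) (isOpen_regularPoints n).measurableSet
    rwa [Measure.restrict_eq_self_of_ae_mem hreg] at h1
  have hball : ∀ R : ℝ, 0 < R →
      ∫⁻ x in ball (0 : EuclideanSpace ℝ (Fin n)) R, ENNReal.ofReal (u x) ≤
      ENNReal.ofReal (τ * (κ⁻¹ * B) * (R ^ (n - θ) + R ^ (n - 1)) * R) := fun R hR =>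
    lintegral_ball_le_of_growth hn hθn (by positivity) hτ hτv huB hR
  have hui : LocallyIntegrable u := by
    intro x
    refine ⟨ball 0 (‖x‖ + 1), isOpen_ball.mem_nhds (by simp), hum.restrict, ?_⟩
    rw [hasFiniteIntegral_iff_ofReal (ae_of_all _ hu0)]
    exact (hball _ (by positivity)).trans_lt ENNReal.ofReal_lt_top
  -- the `L^q` bound for the pointwise gradient
  have hwt := lintegral_potential_weight_le hn hp hτ hτv
  have hΦfin : ∀ᵐ x : EuclideanSpace ℝ (Fin n), radialPotential n F h ‖x‖ ≠ ⊤ := by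
    have h1 := ae_lt_top' (f := fun x : EuclideanSpace ℝ (Fin n) => radialPotential n F h ‖x‖ *
      (ENNReal.ofReal (‖x‖ ^ (n - 1)))⁻¹)
      ((hp.measurable_radialPotential.comp measurable_norm).mul
        (measurable_norm.pow_const _).ennreal_ofReal.inv).aemeasurable
      (ne_top_of_le_ne_top (ENNReal.mul_ne_top ENNReal.ofReal_ne_top hp.energy) hwt)
    filter_upwards [h1] with x hx htop
    rw [htop, ENNReal.top_mul (ENNReal.inv_ne_zero.2 ENNReal.ofReal_ne_top)] at hx
    exact lt_irrefl _ hx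
  have hptw : ∀ᵐ x : EuclideanSpace ℝ (Fin n), ‖fderiv ℝ u x‖ₑ ^ q ≤
      ENNReal.ofReal ((κ⁻¹) ^ q * (C * E ^ (q - 1))) * (radialPotential n F h ‖x‖ *
        (ENNReal.ofReal (‖x‖ ^ (n - 1)))⁻¹) := by
    filter_upwards [hΦfin, ae_ne_zero hn] with x hx hx0
    have hρ : 0 < ‖x‖ := norm_pos_iff.2 hx0
    set P := (radialPotential n F h ‖x‖).toReal with hP
    have hP0 : 0 ≤ P := ENNReal.toReal_nonneg
    have h1 : ‖fderiv ℝ u x‖ ≤ κ⁻¹ * (C * E ^ (q - 1) * (P / ‖x‖ ^ (n - 1))) ^ (θ / n) := by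
      refine norm_fderiv_le_of_sub_le (by positivity) ?_
      filter_upwards [(isOpen_regularPoints n).mem_nhds (Or.inl hx0)] with x' hx'
      exact hmono _ _ _ (hgrad F h hp hF _ hN x hx0 hx x' hx')
    have h2 : ‖fderiv ℝ u x‖ ^ q ≤ κ⁻¹ ^ q * (C * E ^ (q - 1) * (P / ‖x‖ ^ (n - 1))) := by
      refine (Real.rpow_le_rpow (norm_nonneg _) h1 hq0.le).trans (le_of_eq ?_)
      rw [Real.mul_rpow (by positivity) (by positivity), ← Real.rpow_mul (by positivity)]
      have : θ / n * q = 1 := by rw [hq]; field_simp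
      rw [this, Real.rpow_one]
    rw [← ofReal_norm, ENNReal.ofReal_rpow_of_nonneg (norm_nonneg _) hq0.le,
      ← ENNReal.ofReal_toReal hx, ← hP, ← ENNReal.ofReal_inv_of_pos (by positivity),
      ← ENNReal.ofReal_mul hP0, ← ENNReal.ofReal_mul (by positivity)]
    refine ENNReal.ofReal_le_ofReal (h2.trans (le_of_eq ?_))
    rw [div_eq_mul_inv]; ring
  have hlq : ∫⁻ x, ‖fderiv ℝ u x‖ₑ ^ q ≤
      ENNReal.ofReal ((κ⁻¹) ^ q * ((C * τ * (2 * Real.pi)) * E ^ q)) := by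
    refine (lintegral_mono_ae hptw).trans ?_
    rw [lintegral_const_mul' _ _ ENNReal.ofReal_ne_top]
    refine (mul_le_mul_right hwt _).trans (le_of_eq ?_)
    have hEq : E ^ q = E ^ (q - 1) * E := by
      rw [← Real.rpow_add_one' hE0 (by rw [sub_add_cancel]; exact hq0.ne'), sub_add_cancel]
    rw [hEe, ← ENNReal.ofReal_mul (by positivity), ← ENNReal.ofReal_mul (by positivity), hEq]
    congr 1; ring
  have hqe0 : ENNReal.ofReal q ≠ 0 := by simpa using hq0
  have hnormG : ∀ x, ‖gradient u x‖ₑ = ‖fderiv ℝ u x‖ₑ := fun x => by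
    unfold gradient; rw [← ofReal_norm, ← ofReal_norm, LinearIsometryEquiv.norm_map]
  have hGq : eLpNorm (gradient u) (ENNReal.ofReal q) volume ≤
      ENNReal.ofReal (κ⁻¹ * (C * τ * (2 * Real.pi)) ^ (1 / q)) * radialEnergy n h := by
    rw [eLpNorm_eq_lintegral_rpow_enorm_toReal hqe0 ENNReal.ofReal_ne_top,
      ENNReal.toReal_ofReal hq0.le]
    simp only [hnormG]
    refine (ENNReal.rpow_le_rpow hlq (by positivity)).trans (le_of_eq ?_)
    rw [ENNReal.ofReal_rpow_of_nonneg (by positivity) (by positivity), hEe,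
      ← ENNReal.ofReal_mul (by positivity), Real.mul_rpow (by positivity) (by positivity),
      Real.mul_rpow (by positivity) (by positivity), ← Real.rpow_mul (by positivity),
      ← Real.rpow_mul hE0, mul_one_div_cancel hq0.ne', Real.rpow_one, Real.rpow_one, ← mul_assoc]
  have hGm : Measurable (gradient u) :=
    (InnerProductSpace.toDual ℝ (EuclideanSpace ℝ (Fin n))).symm.continuous.measurable.comp
      (measurable_fderiv ℝ u)
  have hGmem : MemLp (gradient u) (ENNReal.ofReal q) volume :=
    ⟨hGm.aestronglyMeasurable, hGq.trans_lt (ENNReal.mul_lt_top ENNReal.ofReal_lt_top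
      (lt_top_iff_ne_top.2 hp.energy))⟩
  have hGi : LocallyIntegrable (gradient u) :=
    hGmem.locallyIntegrable (by simpa using hq1)
  have hDi : LocallyIntegrable (fderiv ℝ u) := by
    have : MemLp (fderiv ℝ u) (ENNReal.ofReal q) volume :=
      hGmem.congr_norm (measurable_fderiv ℝ u).aestronglyMeasurable (ae_of_all _ fun x => by
        unfold gradient; rw [LinearIsometryEquiv.norm_map])
    exact this.locallyIntegrable (by simpa using hq1)
  refine ⟨by filter_upwards [hreg] with x hx using (hlub x hx).1, gradient u,
    ⟨hui, hGi, fun φ hφ hφc v => ?_⟩, hGq⟩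
  have hinner : ∀ x, inner ℝ (gradient u x) v = fderiv ℝ u x v := fun x => by
    unfold gradient; exact InnerProductSpace.toDual_symm_apply
  simp only [hinner]
  by_cases hn1 : n = 1
  · -- in dimension one `u` is locally Lipschitz on the whole line
    exact integral_mul_fderiv_eq_of_tsupport_subset (isOpen_regularPoints n) hlip hφ hφc
      (fun x _ => Or.inr hn1) v
  · have hreq : regularPoints n = {0}ᶜ := by ext; simp [regularPoints, hn1]
    refine integral_mul_fderiv_eq_of_tendsto hn (by rwa [hreq] at hlip) hui hDi ?_ hφ hφc v
    have hR : Tendsto (fun k : ℕ => 2 / (k + 1 : ℝ)) atTop (𝓝 0) :=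
      (tendsto_const_div_atTop_nhds_zero_nat (𝕜 := ℝ) 2).comp (tendsto_add_atTop_nat 1) |>.congr
        (by intro k; simp)
    -- the integral of `u` over `B(0, R)` is `O((R^{n-θ} + R^{n-1}) R) = o(R)`, as `n ≥ 2`
    have hpow : Tendsto (fun R : ℝ => τ * (κ⁻¹ * B) * (R ^ (n - θ) + R ^ (n - 1)) * 2) (𝓝 0)
        (𝓝 0) := by
      have h1 : ContinuousAt (fun R : ℝ => τ * (κ⁻¹ * B) * (R ^ (n - θ) + R ^ (n - 1)) * 2) 0 :=
        (((Real.continuousAt_rpow_const 0 _ (Or.inr (by linarith))).add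
          (continuousAt_id.pow _)).const_mul _).mul_const _
      have h2 : n - 1 ≠ 0 := by omega
      have h3 : (n : ℝ) - θ ≠ 0 := by linarith
      simpa [ContinuousAt, Real.zero_rpow h3, h2] using h1
    refine squeeze_zero (fun k => by positivity) (fun k => ?_) (hpow.comp hR)
    have hk : (0 : ℝ) < k + 1 := by positivity
    have hRk : (0 : ℝ) < 2 / (k + 1) := by positivity
    have h1 : ∫ x in ball (0 : EuclideanSpace ℝ (Fin n)) (2 / (k + 1)), |u x| ≤
        τ * (κ⁻¹ * B) * ((2 / (k + 1 : ℝ)) ^ (n - θ) + (2 / (k + 1 : ℝ)) ^ (n - 1)) *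
          (2 / (k + 1)) := by
      simp only [abs_of_nonneg (hu0 _)]
      rw [integral_eq_lintegral_of_nonneg_ae (ae_of_all _ hu0) hum.restrict]
      exact ENNReal.toReal_le_of_le_ofReal (by positivity) (hball _ hRk)
    calc _ ≤ (k + 1 : ℝ) * (τ * (κ⁻¹ * B) * ((2 / (k + 1 : ℝ)) ^ (n - θ) +
          (2 / (k + 1 : ℝ)) ^ (n - 1)) * (2 / (k + 1))) := by gcongr
      _ = _ := by
        simp only [Function.comp]
        field_simp

/-! ### Testing weak gradients with radial fields -/

/-- Testing the weak gradient with the radial vector field `η(|x|) |x|⁻ⁿ x`, whose divergence is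
`η'(|x|) |x|¹⁻ⁿ`. -/
theorem HasWeakGradient.integral_radial_test {n : ℕ} (hn : 0 < n)
    {f : EuclideanSpace ℝ (Fin n) → ℝ}
    {G : EuclideanSpace ℝ (Fin n) → EuclideanSpace ℝ (Fin n)} (hw : HasWeakGradient f G)
    {η : ℝ → ℝ} (hη : ContDiff ℝ ∞ η) {a b : ℝ} (ha : 0 < a)
    (hab : ∀ t, t ∉ Icc a b → η t = 0) :
    ∫ x, f x * (deriv η ‖x‖ * (‖x‖ ^ (n - 1))⁻¹) =
      -∫ x, inner ℝ (G x) x * (η ‖x‖ * (‖x‖ ^ n)⁻¹) := by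
  set Ψ : EuclideanSpace ℝ (Fin n) → ℝ := fun x => η ‖x‖ * (‖x‖ ^ n)⁻¹ with hΨ
  have hΨ0 : ∀ x : EuclideanSpace ℝ (Fin n), ‖x‖ < a → Ψ x = 0 := fun x hx => by
    simp only [hΨ]; rw [hab _ (fun h => absurd h.1 (not_le.2 hx)), zero_mul]
  have hΨs : ContDiff ℝ ∞ Ψ := by
    rw [contDiff_iff_contDiffAt]
    intro x
    by_cases hx : x = 0
    · have : Ψ =ᶠ[𝓝 x] fun _ => 0 := by
        rw [hx]
        filter_upwards [ball_mem_nhds (0 : EuclideanSpace ℝ (Fin n)) ha] with y hy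
        exact hΨ0 y (by simpa using hy)
      exact contDiffAt_const.congr_of_eventuallyEq this
    · have h1 : ContDiffAt ℝ ∞ (fun x : EuclideanSpace ℝ (Fin n) => ‖x‖) x := contDiffAt_norm ℝ hx
      exact (hη.contDiffAt.comp x h1).mul ((h1.pow n).inv (pow_ne_zero _ (norm_ne_zero_iff.2 hx)))
  have hΨc : HasCompactSupport Ψ := by
    refine HasCompactSupport.intro (isCompact_closedBall 0 b) fun x hx => ?_
    simp only [hΨ]
    rw [hab _ (fun h => hx (by simpa using h.2)), zero_mul]
  -- the divergence, in polar form
  have hdiv : ∀ x : EuclideanSpace ℝ (Fin n), x ≠ 0 →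
      n * Ψ x + fderiv ℝ Ψ x x = deriv η ‖x‖ * (‖x‖ ^ (n - 1))⁻¹ := by
    intro x hx
    have hρ : 0 < ‖x‖ := norm_pos_iff.2 hx
    have hnorm : DifferentiableAt ℝ (fun x : EuclideanSpace ℝ (Fin n) => ‖x‖) x :=
      (contDiffAt_norm (n := 1) ℝ hx).differentiableAt (by simp)
    have hd : HasDerivAt (fun t : ℝ => η t * (t ^ n)⁻¹)
        (deriv η ‖x‖ * (‖x‖ ^ n)⁻¹ + η ‖x‖ * (-(n * ‖x‖ ^ (n - 1)) / (‖x‖ ^ n) ^ 2)) ‖x‖ :=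
      ((hη.differentiable (by simp)) ‖x‖).hasDerivAt.mul
        ((hasDerivAt_pow n ‖x‖).inv (pow_ne_zero _ hρ.ne'))
    have hf := hd.comp_hasFDerivAt x hnorm.hasFDerivAt
    have hf2 : fderiv ℝ Ψ x = _ := hf.fderiv
    rw [hf2]
    simp only [smul_apply, smul_eq_mul, hΨ]
    rw [hnorm.fderiv_norm_self]
    obtain ⟨k, rfl⟩ : ∃ k, n = k + 1 := ⟨n - 1, by omega⟩
    simp only [Nat.add_sub_cancel, pow_succ]
    field_simp
    ring
  set e : Fin n → EuclideanSpace ℝ (Fin n) := fun j => EuclideanSpace.single j 1 with he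
  have hsum : ∀ x : EuclideanSpace ℝ (Fin n), ∑ j, x j • e j = x := by
    intro x
    have := (EuclideanSpace.basisFun (Fin n) ℝ).sum_repr x
    simpa [he] using this
  have hφs : ∀ j, ContDiff ℝ ∞ fun x => Ψ x * EuclideanSpace.proj (𝕜 := ℝ) j x := fun j =>
    hΨs.mul (EuclideanSpace.proj (𝕜 := ℝ) j).contDiff
  have hφc : ∀ j, HasCompactSupport fun x => Ψ x * EuclideanSpace.proj (𝕜 := ℝ) j x := fun j =>
    hΨc.mul_right
  have hfd : ∀ j x, fderiv ℝ (fun x => Ψ x * EuclideanSpace.proj (𝕜 := ℝ) j x) x (e j) =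
      Ψ x + x j * fderiv ℝ Ψ x (e j) := by
    intro j x
    rw [fderiv_fun_mul (hΨs.differentiable (by simp) x)
      (EuclideanSpace.proj (𝕜 := ℝ) j).differentiableAt, ContinuousLinearMap.fderiv]
    simp [he]
  have i1 : ∀ j, Integrable fun x => f x *
      fderiv ℝ (fun x => Ψ x * EuclideanSpace.proj (𝕜 := ℝ) j x) x (e j) := fun j => by
    have := hw.locallyIntegrable.integrable_smul_right_of_hasCompactSupport
      (g := fun x => fderiv ℝ (fun x => Ψ x * EuclideanSpace.proj (𝕜 := ℝ) j x) x (e j))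
      (((hφs j).continuous_fderiv (by simp)).clm_apply continuous_const)
      ((hφc j).fderiv_apply ℝ (e j))
    simpa [mul_comm] using this
  have i2 : ∀ j, Integrable fun x => inner ℝ (G x) (e j) *
      (Ψ x * EuclideanSpace.proj (𝕜 := ℝ) j x) := fun j => by
    have h1 := hw.locallyIntegrable_grad.integrable_smul_left_of_hasCompactSupport
      (hφs j).continuous (hφc j)
    have h2 := h1.inner_const (𝕜 := ℝ) (e j)
    simpa [inner_smul_left, mul_comm] using h2
  have main : ∑ j, ∫ x, f x * fderiv ℝ (fun x => Ψ x * EuclideanSpace.proj (𝕜 := ℝ) j x) x (e j) =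
      ∑ j, -∫ x, inner ℝ (G x) (e j) * (Ψ x * EuclideanSpace.proj (𝕜 := ℝ) j x) :=
    Finset.sum_congr rfl fun j _ => hw.integral_eq _ (hφs j) (hφc j) (e j)
  rw [Finset.sum_neg_distrib, ← integral_finsetSum _ fun j _ => i1 j,
    ← integral_finsetSum _ fun j _ => i2 j] at main
  have e1 : ∀ᵐ x, ∑ j, f x * fderiv ℝ (fun x => Ψ x * EuclideanSpace.proj (𝕜 := ℝ) j x) x (e j) =
      f x * (deriv η ‖x‖ * (‖x‖ ^ (n - 1))⁻¹) := by
    filter_upwards [ae_ne_zero hn] with x hx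
    rw [← Finset.mul_sum, ← hdiv x hx]
    simp only [hfd]
    rw [Finset.sum_add_distrib]
    congr 2
    · simp
    · conv_rhs => rw [← hsum x, map_sum]
      simp only [map_smul, smul_eq_mul, hsum]
  have e2 : ∀ x, ∑ j, inner ℝ (G x) (e j) * (Ψ x * EuclideanSpace.proj (𝕜 := ℝ) j x) =
      inner ℝ (G x) x * (η ‖x‖ * (‖x‖ ^ n)⁻¹) := by
    intro x
    conv_rhs => rw [← hsum x, inner_sum]
    rw [Finset.sum_mul]
    refine Finset.sum_congr rfl fun j _ => ?_
    rw [inner_smul_right, hsum]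
    have : EuclideanSpace.proj (𝕜 := ℝ) j x = x j := rfl
    rw [this]
    simp only [hΨ]
    ring
  rw [integral_congr_ae e1] at main
  simpa only [e2] using main

/-- One-dimensional form of the radial test: in the weak sense, the integral of `|G|` over the
sphere of radius `t`, scaled to the unit sphere, is `τ` times an upper gradient of the profile. -/
theorem HasWeakGradient.profile_test {n : ℕ} (hn : 0 < n)
    {f : EuclideanSpace ℝ (Fin n) → ℝ}
    {G : EuclideanSpace ℝ (Fin n) → EuclideanSpace ℝ (Fin n)} (hw : HasWeakGradient f G)
    {F₀ : ℝ → ℝ} (hf : f =ᵐ[volume] fun x => F₀ ‖x‖)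
    {g : EuclideanSpace ℝ (Fin n) → ℝ≥0∞} (hg : Measurable g) (hGg : ∀ᵐ x, ‖G x‖ₑ = g x)
    {τ : ℝ} (hτ : 0 < τ)
    (hτv : (volume : Measure (EuclideanSpace ℝ (Fin n))).toSphere univ = ENNReal.ofReal τ)
    {η : ℝ → ℝ} (hη : ContDiff ℝ ∞ η) {a b : ℝ} (ha : 0 < a)
    (hab : ∀ t, t ∉ Icc a b → η t = 0) (hη1 : ∀ t, |η t| ≤ 1) :
    ENNReal.ofReal (τ * |∫ t in Ioi (0 : ℝ), F₀ t * deriv η t|) ≤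
      ∫⁻ t in Icc a b, ∫⁻ w : sphere (0 : EuclideanSpace ℝ (Fin n)) 1,
        g (t • (w : EuclideanSpace ℝ (Fin n)))
        ∂(volume : Measure (EuclideanSpace ℝ (Fin n))).toSphere := by
  have : Nontrivial (EuclideanSpace ℝ (Fin n)) := by
    have : Nonempty (Fin n) := ⟨⟨0, hn⟩⟩
    infer_instance
  have main := hw.integral_radial_test hn hη ha hab
  have e1 : ∫ x, f x * (deriv η ‖x‖ * (‖x‖ ^ (n - 1))⁻¹) =
      τ * ∫ t in Ioi (0 : ℝ), F₀ t * deriv η t := by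
    have h1 : ∫ x, f x * (deriv η ‖x‖ * (‖x‖ ^ (n - 1))⁻¹) =
        ∫ x : EuclideanSpace ℝ (Fin n), (fun t => F₀ t * (deriv η t * (t ^ (n - 1))⁻¹)) ‖x‖ := by
      refine integral_congr_ae ?_
      filter_upwards [hf] with x hx
      rw [hx]
    have h2 : τ = n * (volume : Measure (EuclideanSpace ℝ (Fin n))).real (ball 0 1) := by
      have := (volume : Measure (EuclideanSpace ℝ (Fin n))).toSphere_real_apply_univ
      rw [finrank_euclideanSpace_fin, measureReal_def, hτv, ENNReal.toReal_ofReal hτ.le] at this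
      exact this
    have h4 := integral_fun_norm_addHaar (volume : Measure (EuclideanSpace ℝ (Fin n)))
      (fun t => F₀ t * (deriv η t * (t ^ (n - 1))⁻¹))
    rw [finrank_euclideanSpace_fin, nsmul_eq_mul, smul_eq_mul, ← mul_assoc] at h4
    rw [h1, h2]
    refine h4.trans ?_
    congr 1
    refine setIntegral_congr_fun measurableSet_Ioi fun t ht => ?_
    have ht : 0 < t := ht
    simp only [smul_eq_mul]
    field_simp
  rw [e1] at main
  have h3 : τ * |∫ t in Ioi (0 : ℝ), F₀ t * deriv η t| =
      ‖∫ x, inner ℝ (G x) x * (η ‖x‖ * (‖x‖ ^ n)⁻¹)‖ := by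
    rw [← norm_neg, ← main, Real.norm_eq_abs, abs_mul, abs_of_pos hτ]
  rw [h3, ofReal_norm]
  refine (enorm_integral_le_lintegral_enorm _).trans ?_
  have hm1 : Measurable fun x : EuclideanSpace ℝ (Fin n) =>
      (Icc a b).indicator (fun t : ℝ => (ENNReal.ofReal (t ^ (n - 1)))⁻¹) ‖x‖ :=
    (((measurable_id.pow_const _).ennreal_ofReal.inv).indicator measurableSet_Icc).comp
      measurable_norm
  calc _ ≤ ∫⁻ x, (Icc a b).indicator (fun t : ℝ => (ENNReal.ofReal (t ^ (n - 1)))⁻¹) ‖x‖ * g x := by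
        refine lintegral_mono_ae ?_
        filter_upwards [hGg] with x hx
        by_cases hxa : ‖x‖ ∈ Icc a b
        · rw [indicator_of_mem hxa, ← hx]
          have hρ : 0 < ‖x‖ := ha.trans_le hxa.1
          rw [← ENNReal.ofReal_inv_of_pos (by positivity), ← ofReal_norm, ← ofReal_norm,
            ← ENNReal.ofReal_mul (by positivity)]
          refine ENNReal.ofReal_le_ofReal ?_
          rw [norm_mul, norm_mul, norm_inv, norm_pow, norm_norm]
          have h1 : ‖inner ℝ (G x) x‖ ≤ ‖G x‖ * ‖x‖ := norm_inner_le_norm _ _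
          have h2 : ‖η ‖x‖‖ ≤ 1 := hη1 _
          calc _ ≤ (‖G x‖ * ‖x‖) * (1 * (‖x‖ ^ n)⁻¹) := by gcongr
            _ = _ := by
              obtain ⟨k, rfl⟩ : ∃ k, n = k + 1 := ⟨n - 1, by omega⟩
              simp only [Nat.add_sub_cancel, pow_succ]
              field_simp
        · rw [indicator_of_notMem hxa, hab _ hxa]; simp
    _ = ∫⁻ t in Ioi (0 : ℝ), ENNReal.ofReal (t ^ (n - 1)) *
          ∫⁻ w : sphere (0 : EuclideanSpace ℝ (Fin n)) 1,
          (Icc a b).indicator (fun t : ℝ => (ENNReal.ofReal (t ^ (n - 1)))⁻¹)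
            ‖t • (w : EuclideanSpace ℝ (Fin n))‖ * g (t • (w : EuclideanSpace ℝ (Fin n)))
          ∂(volume : Measure (EuclideanSpace ℝ (Fin n))).toSphere :=
        lintegral_polar hn (hm1.mul hg)
    _ ≤ ∫⁻ t, (Icc a b).indicator (fun t =>
          ∫⁻ w : sphere (0 : EuclideanSpace ℝ (Fin n)) 1, g (t • (w : EuclideanSpace ℝ (Fin n)))
          ∂(volume : Measure (EuclideanSpace ℝ (Fin n))).toSphere) t := by
        refine le_trans ?_ (setLIntegral_le_lintegral (Ioi 0) _)
        refine setLIntegral_mono' measurableSet_Ioi fun t ht => ?_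
        have ht : 0 < t := ht
        have hnt : ∀ w : sphere (0 : EuclideanSpace ℝ (Fin n)) 1,
            ‖t • (w : EuclideanSpace ℝ (Fin n))‖ = t := fun w => by
          rw [norm_smul, norm_eq_of_mem_sphere, mul_one, Real.norm_eq_abs, abs_of_pos ht]
        simp only [hnt]
        by_cases hta : t ∈ Icc a b
        · have h0 : ENNReal.ofReal (t ^ (n - 1)) ≠ 0 := by simpa using pow_pos ht _
          rw [indicator_of_mem hta, indicator_of_mem hta, lintegral_const_mul' _ _
            (ENNReal.inv_ne_top.2 h0), ← mul_assoc, ENNReal.mul_inv_cancel h0 ENNReal.ofReal_ne_top,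
            one_mul]
        · simp [hta]
    _ = _ := lintegral_indicator measurableSet_Icc _

/-! ### Profiles of radial Sobolev functions -/

/-- The primitive of a normalised bump function: a smooth step from `0` to `1`. -/
theorem exists_smooth_step (φ : ContDiffBump (0 : ℝ)) (hφ : φ.rOut ≤ 1) :
    ∃ A : ℝ → ℝ, ContDiff ℝ ∞ A ∧ (∀ s, deriv A s = φ.normed volume s) ∧
      (∀ s, A s ∈ Icc (0 : ℝ) 1) ∧ (∀ s ≤ -φ.rOut, A s = 0) ∧ ∀ s, φ.rOut ≤ s → A s = 1 := by
  set k := φ.normed volume with hk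
  have hks : ContDiff ℝ ∞ k := φ.contDiff_normed
  have hk0 : ∀ s, 0 ≤ k s := fun s => φ.nonneg_normed s
  have hki : Integrable k := φ.integrable_normed
  have hkz : ∀ s, s ≤ -φ.rOut → k s = 0 := fun s hs => by
    by_contra h
    have : s ∈ ball (0 : ℝ) φ.rOut := by
      rw [← φ.support_normed_eq (μ := volume)]; exact h
    rw [mem_ball_zero_iff, Real.norm_eq_abs, abs_lt] at this
    linarith [this.1]
  have hder : ∀ s, HasDerivAt (fun s => ∫ x in (-1 : ℝ)..s, k x) (k s) s := fun s =>
    (hks.continuous.integral_hasStrictDerivAt (-1) s).hasDerivAt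
  have hzero : ∀ s ≤ -φ.rOut, ∫ x in (-1 : ℝ)..s, k x = 0 := fun s hs => by
    rw [intervalIntegral.integral_congr (g := fun _ => (0 : ℝ)), intervalIntegral.integral_zero]
    intro x hx
    refine hkz x (hx.2.trans (max_le ?_ hs))
    linarith
  refine ⟨fun s => ∫ x in (-1 : ℝ)..s, k x, ?_, fun s => (hder s).deriv, fun s => ?_, hzero,
    fun s hs => ?_⟩
  · rw [contDiff_infty_iff_deriv]
    refine ⟨fun s => (hder s).differentiableAt, ?_⟩
    rwa [show deriv (fun s => ∫ x in (-1 : ℝ)..s, k x) = k from funext fun s => (hder s).deriv]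
  · rcases le_total s (-φ.rOut) with hs | hs
    · simp only [hzero s hs]; simp
    · have h1 : (-1 : ℝ) ≤ s := by linarith
      refine ⟨intervalIntegral.integral_nonneg h1 fun x _ => hk0 x, ?_⟩
      simp only [intervalIntegral.integral_of_le h1]
      rw [← φ.integral_normed (μ := volume)]
      exact setIntegral_le_integral hki (Eventually.of_forall hk0)
  · simp only
    rw [intervalIntegral.integral_eq_integral_of_support_subset, φ.integral_normed]
    rw [hk, φ.support_normed_eq, Real.ball_eq_Ioo]
    intro x hx
    exact ⟨by linarith [hx.1], by linarith [hx.2]⟩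

/-- A function whose pairing with `η'` is controlled by `∫ h` over the support of `η` varies between
almost any two points by at most the integral of `h`: test with smoothed indicators of intervals. -/
theorem exists_ae_abs_sub_le_of_test {F₀ : ℝ → ℝ} {h : ℝ → ℝ≥0∞}
    (hF : ∀ a, 0 < a → IntegrableOn F₀ (Ioi a)) (hh : ∀ a, 0 < a → ∫⁻ t in Ioi a, h t ≠ ⊤)
    (test : ∀ η : ℝ → ℝ, ContDiff ℝ ∞ η → ∀ a b, 0 < a → (∀ t, t ∉ Icc a b → η t = 0) →
      (∀ t, |η t| ≤ 1) →
      ENNReal.ofReal |∫ t in Ioi (0 : ℝ), F₀ t * deriv η t| ≤ ∫⁻ t in Icc a b, h t) :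
    ∃ D ⊆ Ioi (0 : ℝ), (∀ᵐ t, 0 < t → t ∈ D) ∧
      ∀ u ∈ D, ∀ t ∈ D, u < t → ENNReal.ofReal |F₀ u - F₀ t| ≤ ∫⁻ s in Ioc u t, h s := by
  set ε : ℕ → ℝ := fun i => 1 / ((i : ℝ) + 1) with hε
  have hε0 : ∀ i, 0 < ε i := fun i => Nat.one_div_pos_of_nat
  have hε1 : ∀ i, ε i ≤ 1 := fun i => by
    rw [hε]; simp only; rw [div_le_one (by positivity)]; linarith [Nat.cast_nonneg (α := ℝ) i]
  have hεt : Tendsto ε atTop (𝓝 0) := tendsto_one_div_add_atTop_nhds_zero_nat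
  let φ : ℕ → ContDiffBump (0 : ℝ) := fun i =>
    ⟨ε i / 2, ε i, half_pos (hε0 i), half_lt_self (hε0 i)⟩
  have hout : ∀ i, (φ i).rOut = ε i := fun i => rfl
  choose A hA hAd hAI hA0 hA1 using fun i => exists_smooth_step (φ i) (hε1 i)
  -- truncations of `F₀`, which itself need not be locally integrable at the origin
  let g : ℕ → ℝ → ℝ := fun m => (Ioi (ε m)).indicator F₀
  have hg : ∀ m, Integrable (g m) := fun m =>
    (integrable_indicator_iff measurableSet_Ioi).2 (hF _ (hε0 m))
  have hconv : ∀ m, ∀ᵐ x, Tendsto (fun i => ∫ s, g m s * (φ i).normed volume (s - x)) atTop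
      (𝓝 (g m x)) := fun m => by
    have := ContDiffBump.ae_convolution_tendsto_right_of_locallyIntegrable (φ := φ) (l := atTop)
      (K := 2) (μ := volume) (g := g m) hεt
      (Eventually.of_forall fun i => by
        change ε i ≤ 2 * (ε i / 2)
        linarith)
      (hg m).locallyIntegrable
    filter_upwards [this] with x hx
    refine hx.congr fun i => ?_
    rw [convolution_lsmul_swap]
    refine integral_congr_ae (Eventually.of_forall fun s => ?_)
    simp only [smul_eq_mul]
    rw [mul_comm, ← (φ i).normed_neg, neg_sub]
  refine ⟨{x | 0 < x ∧ ∀ m, Tendsto (fun i => ∫ s, g m s * (φ i).normed volume (s - x)) atTop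
      (𝓝 (g m x))}, fun x hx => hx.1, ?_, ?_⟩
  · filter_upwards [ae_all_iff.2 hconv] with x hx h0 using ⟨h0, hx⟩
  rintro u ⟨hu, hu2⟩ t ⟨-, ht2⟩ hut
  obtain ⟨m, hm⟩ := ((hεt.eventually_lt_const (half_pos hu)).exists)
  have hgu : g m u = F₀ u := indicator_of_mem (show ε m < u by linarith) _
  have hgt : g m t = F₀ t := indicator_of_mem (show ε m < t by linarith) _
  have hl := (((hu2 m).sub (ht2 m)).abs)
  rw [hgu, hgt] at hl
  have hl2 := ENNReal.tendsto_ofReal hl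
  set H : ℝ → ℝ≥0∞ := (Ioi (u / 2)).indicator h with hH
  have hHt : ∫⁻ s, H s ≠ ⊤ := by
    rw [lintegral_indicator measurableSet_Ioi]; exact hh _ (half_pos hu)
  have hr : Tendsto (fun i => ∫⁻ s in Icc (u - ε i) u ∪ Icc t (t + ε i), H s) atTop (𝓝 0) := by
    refine tendsto_setLIntegral_zero hHt ?_
    have h1 : Tendsto (fun i => ENNReal.ofReal (ε i) + ENNReal.ofReal (ε i)) atTop (𝓝 0) := by
      have := ENNReal.tendsto_ofReal hεt
      simpa using this.add this
    refine tendsto_of_tendsto_of_tendsto_of_le_of_le tendsto_const_nhds h1 (fun _ => zero_le)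
      fun i => ?_
    refine (measure_union_le _ _).trans ?_
    simp
  have hr2 := hr.const_add (∫⁻ s in Ioc u t, h s)
  rw [add_zero] at hr2
  refine le_of_tendsto_of_tendsto hl2 hr2 ?_
  filter_upwards [hεt.eventually_lt_const (half_pos hu)] with i hi
  have hηs : ∀ c, ContDiff ℝ ∞ fun s => A i (s - c) := fun c =>
    (hA i).comp (contDiff_id.sub contDiff_const)
  have hηd : ∀ s, deriv (fun s => A i (s - u) - A i (s - t)) s =
      (φ i).normed volume (s - u) - (φ i).normed volume (s - t) := fun s => by
    rw [deriv_fun_sub ((hηs u).differentiable (by simp) s) ((hηs t).differentiable (by simp) s),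
      deriv_comp_sub_const, deriv_comp_sub_const, hAd, hAd]
  have hη0 : ∀ s, s ∉ Icc (u - ε i) (t + ε i) → A i (s - u) - A i (s - t) = 0 := fun s hs => by
    rw [mem_Icc, not_and_or, not_le, not_le] at hs
    rcases hs with hs | hs
    · rw [hA0 i _ (by rw [hout]; linarith), hA0 i _ (by rw [hout]; linarith), sub_zero]
    · rw [hA1 i _ (by rw [hout]; linarith), hA1 i _ (by rw [hout]; linarith), sub_self]
  have key := test (fun s => A i (s - u) - A i (s - t)) ((hηs u).sub (hηs t)) (u - ε i) (t + ε i)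
    (by linarith) hη0 fun s => by
      have h1 := hAI i (s - u); have h2 := hAI i (s - t)
      rw [abs_le]; constructor <;> linarith [h1.1, h1.2, h2.1, h2.2]
  have hint : ∀ c, Integrable fun s => g m s * (φ i).normed volume (s - c) := fun c => by
    obtain ⟨M, hM⟩ := ((φ i).continuous_normed (μ := volume)).bounded_above_of_compact_support
      (φ i).hasCompactSupport_normed
    refine (hg m).mul_bdd (c := M) ?_ (Eventually.of_forall fun s => hM _)
    exact (((φ i).continuous_normed (μ := volume)).comp
      (continuous_id.sub continuous_const)).aestronglyMeasurable
  have e1 : ∫ s in Ioi (0 : ℝ), F₀ s * deriv (fun s => A i (s - u) - A i (s - t)) s =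
      (∫ s, g m s * (φ i).normed volume (s - u)) - ∫ s, g m s * (φ i).normed volume (s - t) := by
    rw [← integral_sub (hint u) (hint t), ← integral_indicator measurableSet_Ioi]
    refine integral_congr_ae (Eventually.of_forall fun s => ?_)
    simp only [hηd]
    by_cases hs : ε m < s
    · simp only [g]
      rw [indicator_of_mem (show s ∈ Ioi (0 : ℝ) from (hε0 m).trans hs),
        indicator_of_mem (show s ∈ Ioi (ε m) from hs)]
      ring
    · have hz : ∀ c, u ≤ c → (φ i).normed volume (s - c) = 0 := fun c hc => by
        by_contra hne
        have : s - c ∈ ball (0 : ℝ) (φ i).rOut := by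
          rw [← (φ i).support_normed_eq (μ := volume)]; exact hne
        rw [mem_ball_zero_iff, Real.norm_eq_abs, abs_lt, hout] at this
        linarith [this.1]
      simp [indicator, hz u le_rfl, hz t hut.le]
  rw [e1] at key
  refine key.trans ?_
  have hsub : Icc (u - ε i) (t + ε i) ⊆ Ioc u t ∪ (Icc (u - ε i) u ∪ Icc t (t + ε i)) := by
    intro s hs
    by_cases h1 : s ≤ u
    · exact Or.inr (Or.inl ⟨hs.1, h1⟩)
    by_cases h2 : s ≤ t
    · exact Or.inl ⟨not_le.1 h1, h2⟩
    · exact Or.inr (Or.inr ⟨(not_le.1 h2).le, hs.2⟩)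
  refine (lintegral_mono_set hsub).trans ((lintegral_union_le _ _ _).trans ?_)
  gcongr 1
  refine setLIntegral_mono' (measurableSet_Icc.union measurableSet_Icc) fun s hs => ?_
  rw [hH, indicator_of_mem]
  rcases hs with hs | hs
  · exact mem_Ioi.2 (by linarith [hs.1])
  · exact mem_Ioi.2 (by linarith [hs.1])

/-- A function on `D ⊆ (0, ∞)` whose increments are bounded by the integrals of `h` extends to
`(0, ∞)` with the same bound. -/
theorem exists_extension_edist_le {F₀ : ℝ → ℝ} {h : ℝ → ℝ≥0∞} (hm : Measurable h)
    (hh : ∀ a, 0 < a → ∫⁻ t in Ioi a, h t ≠ ⊤) {D : Set ℝ} (hD : D ⊆ Ioi 0)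
    (hF : ∀ u ∈ D, ∀ t ∈ D, u < t → ENNReal.ofReal |F₀ u - F₀ t| ≤ ∫⁻ s in Ioc u t, h s) :
    ∃ F : ℝ → ℝ, (∀ t ∈ D, F t = F₀ t) ∧
      ∀ s t, 0 < s → s ≤ t → edist (F s) (F t) ≤ ∫⁻ u in Ioc s t, h u := by
  have hsub : ∀ s t : ℝ, 0 < s → ∫⁻ u in Ioc s t, h u ≠ ⊤ := fun s t hs =>
    ne_top_of_le_ne_top (hh s hs) (lintegral_mono_set Ioc_subset_Ioi_self)
  have hint : ∀ s t : ℝ, 0 < s → s ≤ t →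
      IntervalIntegrable (fun u => (h u).toReal) volume s t := fun s t hs hst => by
    rw [intervalIntegrable_iff_integrableOn_Ioc_of_le hst]
    exact integrable_toReal_of_lintegral_ne_top hm.aemeasurable (hsub s t hs)
  have hint' : ∀ s t : ℝ, 0 < s → 0 < t →
      IntervalIntegrable (fun u => (h u).toReal) volume s t := fun s t hs ht => by
    rcases le_total s t with hst | hst
    · exact hint s t hs hst
    · exact (hint t s ht hst).symm
  set P : ℝ → ℝ := fun t => ∫ u in (1 : ℝ)..t, (h u).toReal with hP
  have hPd : ∀ s t : ℝ, 0 < s → s ≤ t → edist (P s) (P t) = ∫⁻ u in Ioc s t, h u := by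
    intro s t hs hst
    have h0 : 0 < t := hs.trans_le hst
    rw [edist_comm, edist_dist, Real.dist_eq, hP]
    simp only
    rw [intervalIntegral.integral_interval_sub_left (hint' 1 t one_pos h0) (hint' 1 s one_pos hs),
      intervalIntegral.integral_of_le hst, integral_toReal hm.aemeasurable
        (ae_lt_top hm (hsub s t hs)), abs_of_nonneg ENNReal.toReal_nonneg,
      ENNReal.ofReal_toReal (hsub s t hs)]
  have hFP : ∀ s ∈ D, ∀ t ∈ D, edist (F₀ s) (F₀ t) ≤ edist (P s) (P t) := by
    intro s hs t ht
    rcases lt_trichotomy s t with hst | hst | hst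
    · rw [hPd _ _ (hD hs) hst.le, edist_dist, Real.dist_eq]
      exact hF _ hs _ ht hst
    · rw [hst, edist_self]; exact zero_le
    · rw [edist_comm, edist_comm (P s), hPd _ _ (hD ht) hst.le, edist_dist, Real.dist_eq]
      exact hF _ ht _ hs hst
  -- on `D` the function `F₀` factors through the primitive `P` as a `1`-Lipschitz function
  have hLip : LipschitzOnWith 1 (F₀ ∘ Function.invFunOn P D) (P '' D) := by
    rintro p hp q hq
    rw [ENNReal.coe_one, one_mul]
    refine (hFP _ (Function.invFunOn_mem hp) _ (Function.invFunOn_mem hq)).trans_eq ?_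
    rw [Function.invFunOn_eq hp, Function.invFunOn_eq hq]
  obtain ⟨G, hG, hGF⟩ := hLip.extend_real
  refine ⟨fun t => G (P t), fun t ht => ?_, fun s t hs hst => ?_⟩
  · have hp : P t ∈ P '' D := mem_image_of_mem P ht
    have := hFP _ (Function.invFunOn_mem hp) _ ht
    rw [Function.invFunOn_eq hp, edist_self, nonpos_iff_eq_zero, edist_eq_zero] at this
    exact (hGF hp).symm.trans this
  · have := hG (P s) (P t)
    rwa [ENNReal.coe_one, one_mul, hPd s t hs hst] at this

/-- Null sets of radii pull back to null sets of `ℝⁿ`. -/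
theorem ae_norm_of_ae {n : ℕ} (hn : 0 < n) {p : ℝ → Prop} (hp : ∀ᵐ t : ℝ, 0 < t → p t) :
    ∀ᵐ x : EuclideanSpace ℝ (Fin n), p ‖x‖ := by
  obtain ⟨N, hN, hNm, hN0⟩ := exists_measurable_superset_of_null hp
  have h1 := lintegral_radial hn (φ := N.indicator 1) (measurable_one.indicator hNm)
  have h2 : ∫⁻ t in Ioi (0 : ℝ), ENNReal.ofReal (t ^ (n - 1)) * N.indicator 1 t = 0 := by
    refine (lintegral_congr_ae ?_).trans lintegral_zero
    have : ∀ᵐ t, t ∉ N := measure_eq_zero_iff_ae_notMem.1 hN0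
    filter_upwards [ae_restrict_of_ae this] with t ht
    simp [ht]
  rw [h2, mul_zero] at h1
  replace h1 := (lintegral_eq_zero_iff ((measurable_one.indicator hNm).comp measurable_norm)).1 h1
  filter_upwards [h1, ae_ne_zero hn] with x hx hx0
  have hx1 : ‖x‖ ∉ N := fun h => by
    simp [h] at hx
  by_contra hpx
  exact hx1 (hN fun h => hpx (h (norm_pos_iff.2 hx0)))

/-- The absolute value of a radial Sobolev function has a radial profile; `τ` is the area of the
unit sphere, and the upper gradient is the mean of `|Df|` over spheres. -/
theorem HasWeakGradient.exists_radialProfile {n : ℕ} (hn : 0 < n)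
    {f : EuclideanSpace ℝ (Fin n) → ℝ} {Df : EuclideanSpace ℝ (Fin n) → EuclideanSpace ℝ (Fin n)}
    (hf : MemLp f 1) (hDf : MemLp Df 1) (hw : HasWeakGradient f Df) (hrad : IsRadial f)
    {τ : ℝ} (hτ : 0 < τ)
    (hτv : (volume : Measure (EuclideanSpace ℝ (Fin n))).toSphere univ = ENNReal.ofReal τ) :
    ∃ F h, RadialProfile n F h ∧ (∀ᵐ x, ‖f x‖ₑ = ENNReal.ofReal (F ‖x‖)) ∧
      ENNReal.ofReal τ * radialEnergy n h = eLpNorm Df 1 := by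
  have : Nontrivial (EuclideanSpace ℝ (Fin n)) := by
    have : Nonempty (Fin n) := ⟨⟨0, hn⟩⟩
    infer_instance
  obtain ⟨F₀, hF₀⟩ := hrad
  set g : EuclideanSpace ℝ (Fin n) → ℝ≥0∞ := fun x => ‖hDf.aestronglyMeasurable.mk Df x‖ₑ with hgd
  have hg : Measurable g := hDf.aestronglyMeasurable.stronglyMeasurable_mk.enorm
  have hGg : ∀ᵐ x, ‖Df x‖ₑ = g x := by
    filter_upwards [hDf.aestronglyMeasurable.ae_eq_mk] with x hx
    rw [hgd]; simp only; rw [← hx]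
  have hτ0 : ENNReal.ofReal τ ≠ 0 := by simpa using hτ
  set k : ℝ → ℝ≥0∞ := fun t => ∫⁻ w : sphere (0 : EuclideanSpace ℝ (Fin n)) 1,
    g (t • (w : EuclideanSpace ℝ (Fin n)))
    ∂(volume : Measure (EuclideanSpace ℝ (Fin n))).toSphere with hk
  have hkm : Measurable k := by
    refine Measurable.lintegral_prod_right'
      (f := fun p : ℝ × sphere (0 : EuclideanSpace ℝ (Fin n)) 1 =>
        g (p.1 • (p.2 : EuclideanSpace ℝ (Fin n)))) (hg.comp ?_)
    exact measurable_fst.smul (measurable_subtype_coe.comp measurable_snd)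
  set h : ℝ → ℝ≥0∞ := fun t => (ENNReal.ofReal τ)⁻¹ * k t with hh
  have hhm : Measurable h := hkm.const_mul _
  have hτh : ∀ t, ENNReal.ofReal τ * h t = k t := fun t => by
    rw [hh]; simp only
    rw [← mul_assoc, ENNReal.mul_inv_cancel hτ0 ENNReal.ofReal_ne_top, one_mul]
  have hE : ENNReal.ofReal τ * radialEnergy n h = eLpNorm Df 1 := by
    rw [eLpNorm_one_eq_lintegral_enorm, lintegral_congr_ae hGg, lintegral_polar hn hg, radialEnergy,
      ← lintegral_const_mul' _ _ ENNReal.ofReal_ne_top]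
    refine lintegral_congr fun t => ?_
    rw [mul_left_comm, hτh]
  have hEt : radialEnergy n h ≠ ⊤ := fun htop => by
    rw [htop, ENNReal.mul_top hτ0] at hE
    exact hDf.2.ne hE.symm
  have hht : ∀ a, 0 < a → ∫⁻ t in Ioi a, h t ≠ ⊤ := fun a ha =>
    lintegral_Ioi_ne_top_of_radialEnergy hEt ha
  have hFi : ∀ a, 0 < a → IntegrableOn F₀ (Ioi a) := by
    intro a ha
    have h1 : Integrable fun x : EuclideanSpace ℝ (Fin n) => F₀ ‖x‖ :=
      (memLp_one_iff_integrable.1 hf).congr hF₀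
    rw [integrable_fun_norm_addHaar, finrank_euclideanSpace_fin] at h1
    have h2 := h1.mono_set (Ioi_subset_Ioi ha.le)
    have h3 : IntegrableOn (fun t => (t ^ (n - 1))⁻¹ * (t ^ (n - 1) • F₀ t)) (Ioi a) := by
      refine h2.bdd_mul (c := (a ^ (n - 1))⁻¹) (by fun_prop) ?_
      filter_upwards [ae_restrict_mem measurableSet_Ioi] with t ht
      have ht : a < t := ht
      rw [norm_inv, norm_pow, Real.norm_eq_abs, abs_of_pos (ha.trans ht)]
      gcongr
    refine h3.congr_fun (fun t ht => ?_) measurableSet_Ioi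
    have ht : 0 < t := ha.trans ht
    simp only [smul_eq_mul]
    field_simp
  obtain ⟨D, hD, hDae, hDF⟩ := exists_ae_abs_sub_le_of_test hFi hht fun η hη a b ha hab hη1 => by
    have := hw.profile_test hn hF₀ hg hGg hτ hτv hη ha hab hη1
    rw [ENNReal.ofReal_mul hτ.le] at this
    simp only [hh]
    rw [lintegral_const_mul' _ _ (ENNReal.inv_ne_top.2 hτ0)]
    rwa [← ENNReal.div_eq_inv_mul, ENNReal.le_div_iff_mul_le (Or.inl hτ0)
      (Or.inl ENNReal.ofReal_ne_top), mul_comm]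
  obtain ⟨F, hFD, hFe⟩ := exists_extension_edist_le hhm hht hD hDF
  refine ⟨fun t => if 0 < t then |F t| else 0, h, ⟨fun t ht => if_neg (not_lt.2 ht), hhm,
    fun t => ?_, fun s t hs hst => ?_, hEt⟩, ?_, hE⟩
  · split_ifs
    exacts [abs_nonneg _, le_rfl]
  · simp only [hs, hs.trans_le hst, if_true]
    refine le_trans ?_ (hFe s t hs hst)
    rw [edist_dist, edist_dist, Real.dist_eq, Real.dist_eq]
    exact ENNReal.ofReal_le_ofReal (abs_abs_sub_abs_le_abs_sub _ _)
  · filter_upwards [hF₀, ae_norm_of_ae hn hDae, ae_ne_zero hn] with x hx hxD hx0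
    rw [if_pos (norm_pos_iff.2 hx0), hFD _ hxD, hx, ← ofReal_norm, Real.norm_eq_abs]

/-- For radial `f ∈ W^{1,1}(ℝⁿ)` with weak gradient `Df`, the function `M_β f` is finite a.e.,
weakly differentiable, and its weak gradient `G` satisfies `‖G‖_q ≤ C(n,β) ‖Df‖₁`. -/
theorem theorem1 (n : ℕ) (β : ℝ) (hβ : 0 < β) (hβn : β < n) :
    ∃ C : ℝ, 0 < C ∧
      ∀ (f : EuclideanSpace ℝ (Fin n) → ℝ)
        (Df : EuclideanSpace ℝ (Fin n) → EuclideanSpace ℝ (Fin n)),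
        MemLp f 1 volume → MemLp Df 1 volume → HasWeakGradient f Df → IsRadial f →
          (∀ᵐ x, fracMaximal β f x < ⊤) ∧
          ∃ G : EuclideanSpace ℝ (Fin n) → EuclideanSpace ℝ (Fin n),
            HasWeakGradient (fun x => (fracMaximal β f x).toReal) G ∧
            eLpNorm G (ENNReal.ofReal ((n : ℝ) / ((n : ℝ) - β))) volume ≤
              ENNReal.ofReal C * eLpNorm Df 1 volume := by
  have hn : 0 < n := by exact_mod_cast hβ.trans hβn
  obtain ⟨τ, hτ, hτv⟩ := exists_pos_toSphere hn
  obtain ⟨C, hC, H⟩ := exists_weakGradient_bound hn hβ hβn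
  refine ⟨C * τ⁻¹, by positivity, fun f Df hf hDf hw hrad => ?_⟩
  obtain ⟨F, h, hp, hfF, hE⟩ := hw.exists_radialProfile hn hf hDf hrad hτ hτv
  have hcong : fracMaximal β f = fracMaximal β fun y => F ‖y‖ := by
    refine fracMaximal_congr ?_
    filter_upwards [hfF] with x hx
    rw [hx, ← ofReal_norm, Real.norm_of_nonneg (hp.nonneg _)]
  have hmass : ∫⁻ y : EuclideanSpace ℝ (Fin n), ENNReal.ofReal (F ‖y‖) ≠ ⊤ := by
    rw [← lintegral_congr_ae hfF, ← eLpNorm_one_eq_lintegral_enorm]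
    exact hf.2.ne
  obtain ⟨h1, G, hG, hGq⟩ := H F h hp hmass _ hcong
  refine ⟨h1, G, hG, hGq.trans_eq ?_⟩
  rw [ENNReal.ofReal_mul hC.le, ENNReal.ofReal_inv_of_pos hτ, ← hE, mul_assoc, ← mul_assoc _⁻¹,
    ENNReal.inv_mul_cancel (by simpa using hτ) ENNReal.ofReal_ne_top, one_mul]
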